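/- Let $f(z)=\big(e^{4\pi|z|^2}-1-4\pi|z|^2\big)z$ and $F(z)=\frac1{4\pi}\big(e^{4\pi|z|^2}-1-4\pi|z|^2-8\pi^2|z|^4\big)$ for $z\in\mathbb C$. Let $u_0\in H^1(\mathbb R^2;\mathbb C)$ be radial, with Hamiltonian $$H(u_0):=\int_{\mathbb R^2}\big(|\nabla u_0(x)|^2+F(u_0(x))\big)\,dx=1 ,$$ and let $u\in C(\mathbb R,H^1(\mathbb R^2))\cap L^4_{loc}(\mathbb R,W^{1,4}(\mathbb R^2))$ be a global solution, in the sense of distributions, of $$i\partial_t u+\Delta u=f(u)\quad\text{on }\mathbb R\times\mathbb R^2,\qquad u|_{t=0}=u_0 .$$ Then there exist $\varepsilon_0>0$, a sequence of times $t_n\to+\infty$ and a sequence of radii $R_n\to+\infty$ such that for every $n\in\mathbb N$ $$\int_{|x|\ge R_n}|\nabla u(t_n,x)|^2\,dx\ \ge\ \varepsilon_0 .$$ -/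

import Mathlib

open MeasureTheory Filter Topology
open scoped ContDiff

noncomputable section

/-- The Euclidean plane `ℝ²`. -/
abbrev Plane : Type := EuclideanSpace ℝ (Fin 2)

/-- Real-valued test functions on the plane: smooth with compact support. -/
def IsTestFunction (φ : Plane → ℝ) : Prop :=
  ContDiff ℝ ∞ φ ∧ HasCompactSupport φ

/-- `g` is a weak (distributional) gradient of `v`: both are locally integrable and
`∫ v ∂_j φ = - ∫ g_j φ` for every test function `φ` and `j = 1, 2`. -/
structure HasWeakGradient (v : Plane → ℂ) (g : Plane → EuclideanSpace ℂ (Fin 2)) : Prop where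
  locallyIntegrable : LocallyIntegrable v
  locallyIntegrable_grad : LocallyIntegrable g
  integral_eq : ∀ φ : Plane → ℝ, IsTestFunction φ → ∀ j : Fin 2,
    (∫ x, v x * ((fderiv ℝ φ x (EuclideanSpace.single j 1) : ℝ) : ℂ)) =
      - (∫ x, g x j * ((φ x : ℝ) : ℂ))

/-- A weak gradient is unique up to equality almost everywhere. -/
theorem HasWeakGradient.ae_eq {v : Plane → ℂ} {g g' : Plane → EuclideanSpace ℂ (Fin 2)}
    (h : HasWeakGradient v g) (h' : HasWeakGradient v g') : g =ᵐ[volume] g' := by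
  have comp : ∀ {k : Plane → EuclideanSpace ℂ (Fin 2)}, LocallyIntegrable k → ∀ j : Fin 2,
      LocallyIntegrable (fun x => k x j) := by
    intro k hk j x
    obtain ⟨s, hs, hi⟩ := hk x
    exact ⟨s, hs, (EuclideanSpace.proj (𝕜 := ℂ) j).integrable_comp hi⟩
  have key : ∀ j : Fin 2, ∀ᵐ x : Plane, g x j = g' x j := by
    intro j
    refine ae_eq_of_integral_contDiff_smul_eq (comp h.locallyIntegrable_grad j)
      (comp h'.locallyIntegrable_grad j) ?_
    intro φ hφ hc
    have e := (h.integral_eq φ ⟨hφ, hc⟩ j).symm.trans (h'.integral_eq φ ⟨hφ, hc⟩ j)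
    have e' := neg_injective e
    simpa [Complex.real_smul, mul_comm] using e'
  filter_upwards [ae_all_iff.2 key] with x hx
  ext j
  exact hx j

open Classical in
/-- The weak gradient `∇v` (a representative of it; it is `0` if `v` has no weak gradient). -/
def weakGradient (v : Plane → ℂ) : Plane → EuclideanSpace ℂ (Fin 2) :=
  if h : ∃ g, HasWeakGradient v g then h.choose else 0

/-- `v ∈ H¹(ℝ²)`: `v` and its weak gradient are square integrable. -/
def MemH1 (v : Plane → ℂ) : Prop :=
  MemLp v 2 ∧ ∃ g, HasWeakGradient v g ∧ MemLp g 2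

/-- `v` is radial: almost everywhere `v x` depends only on `|x|`. -/
def IsRadial (v : Plane → ℂ) : Prop :=
  ∃ h : ℝ → ℂ, v =ᵐ[volume] fun x => h ‖x‖

/-- The nonlinearity `f(z) = (exp(4π|z|²) - 1 - 4π|z|²) z`. -/
def nonlin (z : ℂ) : ℂ :=
  ((Real.exp (4 * Real.pi * ‖z‖ ^ 2) - 1 - 4 * Real.pi * ‖z‖ ^ 2 : ℝ) : ℂ) * z

/-- The potential `F(z) = (exp(4π|z|²) - 1 - 4π|z|² - 8π²|z|⁴) / (4π)`. -/
def potential (z : ℂ) : ℝ :=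
  1 / (4 * Real.pi) * (Real.exp (4 * Real.pi * ‖z‖ ^ 2) - 1 - 4 * Real.pi * ‖z‖ ^ 2
    - 8 * Real.pi ^ 2 * ‖z‖ ^ 4)

/-- The Hamiltonian `H(v) = ∫ (|∇v|² + F(v)) dx`. -/
def hamiltonian (v : Plane → ℂ) : ℝ :=
  ∫ x, (‖weakGradient v x‖ ^ 2 + potential (v x))

/-- `u` is a global solution of `i ∂ₜu + Δu = f(u)`, `u|ₜ₌₀ = u₀`, in the class
`C(ℝ, H¹(ℝ²)) ∩ L⁴_loc(ℝ, W^{1,4}(ℝ²))`; the equation is understood in the sense of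
distributions in `x`, integrated in time. -/
structure IsNLSSolution (u₀ : Plane → ℂ) (u : ℝ → Plane → ℂ) : Prop where
  /-- Each `u(t)` lies in `H¹`. -/
  memH1 : ∀ t, MemH1 (u t)
  /-- `t ↦ u(t)` is continuous with values in `H¹`. -/
  continuous_H1 : ∀ t₀, Tendsto
    (fun t => eLpNorm (u t - u t₀) 2 volume
      + eLpNorm (weakGradient (u t) - weakGradient (u t₀)) 2 volume) (𝓝 t₀) (𝓝 0)
  /-- `u ∈ L⁴((-T, T), W^{1,4})` for every `T`. -/
  locL4_W14 : ∀ T : ℝ, ∫⁻ t in Set.Icc (-T) T,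
    (eLpNorm (u t) 4 volume + eLpNorm (weakGradient (u t)) 4 volume) ^ 4 < ⊤
  /-- The initial condition. -/
  initial : u 0 =ᵐ[volume] u₀
  /-- The equation `∂ₜu = i (Δu - f(u))`, tested against `φ` and integrated from `0` to `t`. -/
  equation : ∀ φ : Plane → ℝ, IsTestFunction φ → ∀ t : ℝ,
    (∫ x, u t x * ((φ x : ℝ) : ℂ)) = (∫ x, u₀ x * ((φ x : ℝ) : ℂ))
      + Complex.I * (∫ s in (0 : ℝ)..t, (∫ x,
          (u s x * ((Laplacian.laplacian φ x : ℝ) : ℂ) - nonlin (u s x) * ((φ x : ℝ) : ℂ))))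

end

noncomputable section

/-! The proof is a localized virial argument by contradiction. If the statement failed, then for
every ε there would be R and T such that the kinetic energy outside the disc of radius R stays below
ε for all t ≥ T; `IsFlow.not_extKin_small` refutes this. Let φ be |x/R|² on the disc of radius R,
cut off at twice that radius. The quantity Im ∫ ū ∇φ·∇u is bounded in time by conservation of mass
and energy. Its derivative, times R², is at least four times the energy minus three errors
(`exists_le_virialRate`): a multiple of the exterior kinetic energy, a term of size 1/R, and a
multiple of the exterior integral of |u||f(u)| - F(u). The sign of the main term comes from F ≤
|z||f(z)| - F(z) (`potential_le_virialDens`). The third error is small when the exterior kinetic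
energy is, by a Moser-Trudinger inequality applied to the solution cut off near the origin
(`exists_exterior_virialDens_le`). Hence the derivative is eventually at least E/R², which
contradicts boundedness.

A Moser-Trudinger inequality with some small constant is enough (`exists_moser_trudinger`). It
follows, without rearrangement, from the L¹ Sobolev inequality iterated over level sets. Density of
bounded functions in H¹ then makes every exponential integral locally bounded in H¹
(`HasGrad.exists_expInt_le`), so that the nonlinearity is a continuous curve in L² along the
solution.

Conservation of energy (`IsFlow.energy_eq`) is the delicate point, since ∂ₜu cannot be paired with
the equation. The potential energy at times t and t + τ is compared through the trapezoidal rule.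
Integrated over t, the trapezoidal terms collapse to boundary integrals whose quotients by τ tend to
the energies at the two ends. The remainder is o(τ): testing the equation with |w|^{1/2} w, where w
is the increment of u, bounds w in L^{5/2}, and this is where the L⁴ bound on the gradient is used.
All other identities are proved for the mollified solution, which is differentiable in time with
values in L², and pass to the limit. -/

/-- The Hilbert space `L²(ℝ²; ℂ)`. -/
abbrev L2C : Type := Lp ℂ 2 (volume : Measure Plane)

/-! ### Test functions and their density in L². -/

/-- Bundled test functions. -/
structure Test where
  fn : Plane → ℝ
  smooth : ContDiff ℝ ∞ fn
  cpt : HasCompactSupport fn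

namespace Test

instance : CoeFun Test (fun _ => Plane → ℝ) := ⟨Test.fn⟩

@[ext] theorem ext {φ ψ : Test} (h : ∀ x, φ x = ψ x) : φ = ψ := by
  cases φ; cases ψ; congr; exact funext h

theorem isTest (φ : Test) : IsTestFunction φ := ⟨φ.smooth, φ.cpt⟩

theorem continuous (φ : Test) : Continuous φ := φ.smooth.continuous

theorem differentiable (φ : Test) : Differentiable ℝ φ := φ.smooth.differentiable (by simp)

/-- The partial derivative of a test function. -/
def pd (j : Fin 2) (φ : Test) : Test where
  fn x := fderiv ℝ φ x (EuclideanSpace.single j 1)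
  smooth := (φ.smooth.fderiv_right (m := ∞) (by simp)).clm_apply contDiff_const
  cpt := (φ.cpt.fderiv (𝕜 := ℝ)).mono (by
    intro x hx h
    apply hx
    simp [h])

/-- The product of two test functions. -/
def mul (φ ψ : Test) : Test := ⟨fun x => φ x * ψ x, φ.smooth.mul ψ.smooth, φ.cpt.mul_right⟩

def add (φ ψ : Test) : Test := ⟨fun x => φ x + ψ x, φ.smooth.add ψ.smooth, φ.cpt.add ψ.cpt⟩

/-- The reflection `x ↦ φ (-x)`. -/
def refl (φ : Test) : Test :=
  ⟨fun x => φ (-x), φ.smooth.comp contDiff_neg, φ.cpt.comp_homeomorph (Homeomorph.neg Plane)⟩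

def neg (φ : Test) : Test := ⟨fun x => -φ x, φ.smooth.neg, φ.cpt.neg⟩

/-- The convolution of two test functions. -/
def conv (ρ φ : Test) : Test where
  fn := convolution ρ φ (ContinuousLinearMap.lsmul ℝ ℝ) volume
  smooth := ρ.cpt.contDiff_convolution_left _ ρ.smooth φ.continuous.locallyIntegrable
  cpt := ρ.cpt.convolution _ φ.cpt

theorem pd_apply (j : Fin 2) (φ : Test) (x : Plane) :
    φ.pd j x = fderiv ℝ φ x (EuclideanSpace.single j 1) := rfl

theorem pd_mul (j : Fin 2) (φ ψ : Test) : (φ.mul ψ).pd j = ((φ.pd j).mul ψ).add (φ.mul (ψ.pd j)) := by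
  ext x
  change fderiv ℝ (fun x => φ x * ψ x) x _ = _ * _ + _ * _
  rw [fderiv_fun_mul (φ.differentiable x) (ψ.differentiable x)]
  simp [pd_apply]; ring

theorem pd_refl (j : Fin 2) (φ : Test) : φ.refl.pd j = ((φ.pd j).refl).neg := by
  ext x
  change fderiv ℝ (fun x => φ (-x)) x _ = - fderiv ℝ φ (-x) _
  have : HasFDerivAt (fun x => φ (-x)) ((fderiv ℝ φ (-x)).comp (-ContinuousLinearMap.id ℝ Plane)) x :=
    (φ.differentiable (-x)).hasFDerivAt.comp x (hasFDerivAt_id x).neg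
  rw [this.fderiv]; simp

theorem conv_pd (j : Fin 2) (ρ φ : Test) : (ρ.conv φ).pd j = ρ.conv (φ.pd j) := by
  ext x
  have h := φ.cpt.hasFDerivAt_convolution_right (μ := volume) (ContinuousLinearMap.lsmul ℝ ℝ)
    ρ.continuous.locallyIntegrable (φ.smooth.of_le (by simp)) x
  change fderiv ℝ (convolution ρ φ (ContinuousLinearMap.lsmul ℝ ℝ) volume) x _ = _
  rw [h.fderiv]
  exact convolution_precompR_apply (ContinuousLinearMap.lsmul ℝ ℝ) ρ.continuous.locallyIntegrable
    (φ.cpt.fderiv (𝕜 := ℝ)) (φ.smooth.continuous_fderiv (by simp)) x _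

theorem conv_comm (ρ φ : Test) : ρ.conv φ = φ.conv ρ := by
  ext x
  change convolution ρ φ (ContinuousLinearMap.lsmul ℝ ℝ) volume x =
    convolution φ ρ (ContinuousLinearMap.lsmul ℝ ℝ) volume x
  rw [convolution_eq_swap, convolution_def]
  simp [mul_comm]

theorem pd_conv (j : Fin 2) (ρ φ : Test) : (ρ.conv φ).pd j = (ρ.pd j).conv φ := by
  rw [conv_comm, conv_pd, conv_comm]

/-- The Laplacian of a test function. -/
def lap (φ : Test) : Test := ((φ.pd 0).pd 0).add ((φ.pd 1).pd 1)

theorem pd_pd_apply (i l : Fin 2) (φ : Test) (x : Plane) : (φ.pd i).pd l x =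
    fderiv ℝ (fderiv ℝ φ) x (EuclideanSpace.single l 1) (EuclideanSpace.single i 1) := by
  change fderiv ℝ (fun x => fderiv ℝ φ x (EuclideanSpace.single i 1)) x _ = _
  have hd : DifferentiableAt ℝ (fderiv ℝ φ) x :=
    (φ.smooth.fderiv_right (m := ∞) (by simp)).differentiable (by simp) x
  rw [fderiv_clm_apply hd (by fun_prop)]
  simp

theorem laplacian_eq (φ : Test) (x : Plane) : Laplacian.laplacian φ.fn x = φ.lap x := by
  rw [InnerProductSpace.laplacian_eq_iteratedFDeriv_orthonormalBasis _ (EuclideanSpace.basisFun (Fin 2) ℝ)]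
  simp only [Fin.sum_univ_two, iteratedFDeriv_two_apply, lap, add, pd_pd_apply]
  simp

theorem pd_comm (j k : Fin 2) (φ : Test) : (φ.pd j).pd k = (φ.pd k).pd j := by
  ext x
  rw [pd_pd_apply, pd_pd_apply]
  exact (φ.smooth.contDiffAt (x := x)).isSymmSndFDerivAt (n := ∞) (by simp; exact WithTop.coe_le_coe.2 le_top) _ _

theorem memLp (φ : Test) (p : ENNReal) : MemLp (fun x => (φ x : ℂ)) p (volume : Measure Plane) :=
  (Complex.continuous_ofReal.comp φ.continuous).memLp_of_hasCompactSupport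
    (φ.cpt.comp_left (g := Complex.ofReal) (by simp))

/-- A test function as an element of `L²`. -/
def toL2 (φ : Test) : L2C := (φ.memLp 2).toLp _

theorem coeFn_toL2 (φ : Test) : φ.toL2 =ᵐ[volume] fun x => (φ x : ℂ) := MemLp.coeFn_toLp _

theorem exists_bound (φ : Test) : ∃ C, 0 ≤ C ∧ ∀ x, |φ x| ≤ C := by
  obtain ⟨C, hC⟩ := φ.continuous.bounded_above_of_compact_support φ.cpt
  exact ⟨C, (norm_nonneg _).trans (hC 0), hC⟩

theorem toL2_add (φ ψ : Test) : (φ.add ψ).toL2 = φ.toL2 + ψ.toL2 := by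
  rw [toL2, toL2, toL2, ← MemLp.toLp_add]
  congr 1; ext x; simp [add]

theorem toL2_neg (φ : Test) : φ.neg.toL2 = -φ.toL2 := by
  rw [toL2, toL2, ← MemLp.toLp_neg]
  congr 1; ext x; simp [neg]

theorem inner_toL2 (φ : Test) (v : L2C) : inner ℂ φ.toL2 v = ∫ x, v x * (φ x : ℂ) := by
  rw [L2.inner_def]
  apply integral_congr_ae
  filter_upwards [φ.coeFn_toL2] with x hx
  rw [hx]; simp

end Test

theorem L2C.ext_test {v w : L2C} (h : ∀ φ : Test, inner ℂ φ.toL2 v = inner ℂ φ.toL2 w) : v = w := by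
  apply Lp.ext
  refine ae_eq_of_integral_contDiff_smul_eq ((Lp.memLp v).locallyIntegrable (by norm_num))
    ((Lp.memLp w).locallyIntegrable (by norm_num)) fun φ hφ hc => ?_
  have := h ⟨φ, hφ, hc⟩
  rw [Test.inner_toL2, Test.inner_toL2] at this
  simpa [Complex.real_smul, mul_comm] using this

/-- A vector orthogonal to all test functions vanishes, so the orthogonal complement of their span
is trivial. -/
theorem span_test_topologicalClosure :
    (Submodule.span ℂ (Set.range Test.toL2)).topologicalClosure = ⊤ := by
  rw [Submodule.topologicalClosure_eq_top_iff, Submodule.eq_bot_iff]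
  intro v hv
  apply L2C.ext_test
  intro φ
  rw [inner_zero_right]
  exact hv _ (Submodule.subset_span ⟨φ, rfl⟩)

/-! ### Multiplication operators and weak gradients in L². -/

/-- Multiplication by a test function on `L²`. -/
def mulOp (φ : Test) : L2C →L[ℂ] L2C :=
  LinearMap.mkContinuousOfExistsBound
    { toFun := fun v => ((Lp.memLp v).mul (φ.memLp ⊤)).toLp _
      map_add' := fun v w => by
        rw [← MemLp.toLp_add]
        apply MemLp.toLp_congr
        filter_upwards [Lp.coeFn_add v w] with x hx
        simp only [Pi.mul_apply, Pi.add_apply] at hx ⊢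
        rw [hx, mul_add]
      map_smul' := fun c v => by
        rw [RingHom.id_apply, ← MemLp.toLp_const_smul]
        apply MemLp.toLp_congr
        filter_upwards [Lp.coeFn_smul c v] with x hx
        simp only [Pi.mul_apply, Pi.smul_apply, smul_eq_mul] at hx ⊢
        rw [hx]; ring }
    (by
      obtain ⟨C, hC0, hC⟩ := φ.exists_bound
      refine ⟨C, fun v => Lp.norm_le_mul_norm_of_ae_le_mul ?_⟩
      filter_upwards [((Lp.memLp v).mul (φ.memLp ⊤) : MemLp _ 2 _).coeFn_toLp] with x hx
      change ‖(((Lp.memLp v).mul (φ.memLp ⊤)).toLp _ : L2C) x‖ ≤ _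
      rw [hx]
      simp only [Pi.mul_apply, norm_mul, Complex.norm_real, Real.norm_eq_abs]
      gcongr
      exact hC x)

theorem coeFn_mulOp (φ : Test) (v : L2C) : mulOp φ v =ᵐ[volume] fun x => (φ x : ℂ) * v x := by
  change (((Lp.memLp v).mul (φ.memLp ⊤)).toLp _ : L2C) =ᵐ[volume] _
  exact ((Lp.memLp v).mul (φ.memLp ⊤)).coeFn_toLp

theorem norm_mulOp_le (φ : Test) {C : ℝ} (hC : ∀ x, |φ x| ≤ C) (v : L2C) : ‖mulOp φ v‖ ≤ C * ‖v‖ := by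
  refine Lp.norm_le_mul_norm_of_ae_le_mul ?_
  filter_upwards [coeFn_mulOp φ v] with x hx
  rw [hx]
  simp only [norm_mul, Complex.norm_real, Real.norm_eq_abs]
  gcongr
  exact hC x

theorem inner_mulOp (φ : Test) (v w : L2C) : inner ℂ (mulOp φ v) w = inner ℂ v (mulOp φ w) := by
  rw [L2.inner_def, L2.inner_def]
  apply integral_congr_ae
  filter_upwards [coeFn_mulOp φ v, coeFn_mulOp φ w] with x h1 h2
  rw [h1, h2]; simp; ring

theorem mulOp_toL2 (φ ψ : Test) : mulOp φ ψ.toL2 = (φ.mul ψ).toL2 := by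
  apply Lp.ext
  filter_upwards [coeFn_mulOp φ ψ.toL2, ψ.coeFn_toL2, (φ.mul ψ).coeFn_toL2] with x h1 h2 h3
  rw [h1, h2, h3]; simp [Test.mul]

theorem mulOp_add_left (φ ψ : Test) (v : L2C) : mulOp (φ.add ψ) v = mulOp φ v + mulOp ψ v := by
  apply Lp.ext
  filter_upwards [coeFn_mulOp (φ.add ψ) v, Lp.coeFn_add (mulOp φ v) (mulOp ψ v), coeFn_mulOp φ v,
    coeFn_mulOp ψ v] with x h1 h2 h3 h4
  rw [h1, h2, Pi.add_apply, h3, h4]; simp [Test.add]; ring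

/-- `g` is the weak gradient of `v`, for elements of `L²`. -/
def HasGrad (v : L2C) (g : Fin 2 → L2C) : Prop :=
  ∀ (φ : Test) (j : Fin 2), inner ℂ (φ.pd j).toL2 v = - inner ℂ φ.toL2 (g j)

namespace HasGrad

variable {v w : L2C} {g k : Fin 2 → L2C}

theorem sub (hv : HasGrad v g) (hw : HasGrad w k) : HasGrad (v - w) (fun j => g j - k j) := by
  intro φ j
  rw [inner_sub_right, inner_sub_right, hv, hw]; ring

theorem mul_test (χ : Test) (hv : HasGrad v g) :
    HasGrad (mulOp χ v) (fun j => mulOp χ (g j) + mulOp (χ.pd j) v) := by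
  intro φ j
  have h := hv (χ.mul φ) j
  rw [Test.pd_mul, Test.toL2_add, inner_add_left] at h
  rw [inner_add_right, ← inner_mulOp, ← inner_mulOp, ← inner_mulOp, mulOp_toL2, mulOp_toL2, mulOp_toL2]
  linear_combination h

end HasGrad

/-! ### Convolution operators and mollification. -/

/-- Young's inequality L¹ ∗ L² ⊂ L²: Cauchy-Schwarz for the measure f(t) dt, then Tonelli. It makes
convolution a bounded operator on L². -/
theorem lintegral_conv_sq_le {f g : Plane → ENNReal} (hf : Measurable f) (hg : Measurable g) :
    ∫⁻ x, (∫⁻ t, f t * g (x - t)) ^ 2 ≤ (∫⁻ t, f t) ^ 2 * ∫⁻ x, g x ^ 2 := by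
  have hcs : ∀ x, (∫⁻ t, f t * g (x - t)) ^ 2 ≤ (∫⁻ t, f t) * ∫⁻ t, f t * g (x - t) ^ 2 := by
    intro x
    have hgx : Measurable fun t => g (x - t) := hg.comp (measurable_const.sub measurable_id)
    have h := ENNReal.lintegral_mul_le_Lp_mul_Lq volume Real.HolderConjugate.two_two
      (f := fun t => f t ^ (1 / 2 : ℝ)) (g := fun t => f t ^ (1 / 2 : ℝ) * g (x - t))
      (hf.pow_const _).aemeasurable ((hf.pow_const _).mul hgx).aemeasurable
    have e0 : ∀ a : ENNReal, a ^ (1 / 2 : ℝ) * a ^ (1 / 2 : ℝ) = a := fun a => by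
      rw [← ENNReal.rpow_add_of_nonneg _ _ (by norm_num) (by norm_num)]; norm_num
    have e1 : ∀ a : ENNReal, (a ^ (1 / 2 : ℝ)) ^ (2 : ℝ) = a := fun a => by
      rw [← ENNReal.rpow_mul]; norm_num
    simp only [Pi.mul_apply, ← mul_assoc, e0] at h
    calc (∫⁻ t, f t * g (x - t)) ^ 2 ≤ _ := pow_le_pow_left' h 2
      _ = _ := by
        rw [mul_pow, ← ENNReal.rpow_natCast, ← ENNReal.rpow_natCast, ← ENNReal.rpow_mul,
          ← ENNReal.rpow_mul]
        norm_num
        congr 1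
        · apply lintegral_congr; intro t
          have := e1 (f t); norm_num at this; exact this
        · apply lintegral_congr; intro t
          have := e1 (f t); norm_num at this; rw [mul_pow, this]
  have hm : Measurable fun z : Plane × Plane => f z.2 * g (z.1 - z.2) ^ 2 :=
    (hf.comp measurable_snd).mul ((hg.comp (measurable_fst.sub measurable_snd)).pow_const 2)
  calc ∫⁻ x, (∫⁻ t, f t * g (x - t)) ^ 2
      ≤ ∫⁻ x, (∫⁻ t, f t) * ∫⁻ t, f t * g (x - t) ^ 2 := lintegral_mono hcs
    _ = (∫⁻ t, f t) * ∫⁻ x, ∫⁻ t, f t * g (x - t) ^ 2 := by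
        rw [lintegral_const_mul]
        exact hm.lintegral_prod_right'
    _ = (∫⁻ t, f t) * ∫⁻ t, ∫⁻ x, f t * g (x - t) ^ 2 := by
        rw [lintegral_lintegral_swap hm.aemeasurable]
    _ = (∫⁻ t, f t) * ∫⁻ t, f t * ∫⁻ x, g x ^ 2 := by
        congr 1
        apply lintegral_congr; intro t
        have hgt : Measurable fun x => g (x - t) ^ 2 :=
          (hg.comp (measurable_id.sub measurable_const)).pow_const 2
        rw [lintegral_const_mul _ hgt]
        congr 1
        exact lintegral_sub_right_eq_self (fun x => g x ^ 2) t
    _ = _ := by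
        rw [lintegral_mul_const _ hf]; ring

/-- The convolution `ρ ⋆ v` as a function. -/
def convFn (ρ : Test) (v : Plane → ℂ) : Plane → ℂ :=
  convolution ρ v (ContinuousLinearMap.lsmul ℝ ℝ) volume

theorem L2C.locallyIntegrable (v : L2C) : LocallyIntegrable v :=
  (Lp.memLp v).locallyIntegrable (by norm_num)

theorem contDiff_convFn (ρ : Test) (v : L2C) : ContDiff ℝ ∞ (convFn ρ v) :=
  ρ.cpt.contDiff_convolution_left _ ρ.smooth v.locallyIntegrable

theorem convFn_congr (ρ : Test) {v w : Plane → ℂ} (h : v =ᵐ[volume] w) : convFn ρ v = convFn ρ w :=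
  convolution_congr _ (ae_eq_refl _) h

theorem eLpNorm_convFn_le (ρ : Test) (v : L2C) :
    eLpNorm (convFn ρ v) 2 volume ≤ ENNReal.ofReal (∫ x, |ρ x|) * eLpNorm v 2 volume := by
  have hv : Measurable fun x => ‖v x‖ₑ := (Lp.stronglyMeasurable v).measurable.enorm
  have hρ : Measurable fun x => ‖ρ x‖ₑ := ρ.continuous.measurable.enorm
  have key := lintegral_conv_sq_le hρ hv
  have hpt : ∀ x, ‖convFn ρ v x‖ₑ ≤ ∫⁻ t, ‖ρ t‖ₑ * ‖v (x - t)‖ₑ := by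
    intro x
    refine (enorm_integral_le_lintegral_enorm _).trans (le_of_eq ?_)
    apply lintegral_congr; intro t
    rw [ContinuousLinearMap.lsmul_apply, enorm_smul]
  have hi : ∫⁻ t, ‖ρ t‖ₑ = ENNReal.ofReal (∫ x, |ρ x|) := by
    rw [← ofReal_integral_norm_eq_lintegral_enorm (ρ.continuous.integrable_of_hasCompactSupport ρ.cpt)]
    simp
  rw [← hi, eLpNorm_eq_lintegral_rpow_enorm_toReal (by norm_num) (by norm_num),
    eLpNorm_eq_lintegral_rpow_enorm_toReal (by norm_num) (by norm_num)]
  simp only [ENNReal.toReal_ofNat, ENNReal.rpow_ofNat]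
  calc (∫⁻ x, ‖convFn ρ v x‖ₑ ^ 2) ^ (1 / 2 : ℝ)
      ≤ ((∫⁻ t, ‖ρ t‖ₑ) ^ 2 * ∫⁻ x, ‖v x‖ₑ ^ 2) ^ (1 / 2 : ℝ) := by
        gcongr
        exact (lintegral_mono fun x => pow_le_pow_left' (hpt x) 2).trans key
    _ = _ := by
        rw [ENNReal.mul_rpow_of_nonneg _ _ (by norm_num), ← ENNReal.rpow_natCast, ← ENNReal.rpow_mul]
        norm_num

theorem memLp_convFn (ρ : Test) (v : L2C) : MemLp (convFn ρ v) 2 volume :=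
  ⟨(contDiff_convFn ρ v).continuous.aestronglyMeasurable, (eLpNorm_convFn_le ρ v).trans_lt
    (ENNReal.mul_lt_top ENNReal.ofReal_lt_top (Lp.memLp v).2)⟩

/-- Convolution with a test function, as an operator on `L²`. -/
def convOp (ρ : Test) : L2C →L[ℂ] L2C :=
  LinearMap.mkContinuous
    { toFun := fun v => (memLp_convFn ρ v).toLp _
      map_add' := fun v w => by
        rw [← MemLp.toLp_add]
        apply MemLp.toLp_congr
        rw [convFn_congr ρ (Lp.coeFn_add v w)]
        apply Eventually.of_forall
        intro x
        exact ((ρ.cpt.convolutionExists_left _ ρ.continuous v.locallyIntegrable x).distrib_add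
          (ρ.cpt.convolutionExists_left _ ρ.continuous w.locallyIntegrable x))
      map_smul' := fun c v => by
        rw [RingHom.id_apply, ← MemLp.toLp_const_smul]
        apply MemLp.toLp_congr
        rw [convFn_congr ρ (Lp.coeFn_smul c v)]
        apply Eventually.of_forall
        intro x
        simp only [convFn, convolution_def, Pi.smul_apply, ContinuousLinearMap.lsmul_apply]
        rw [← integral_smul]
        apply integral_congr_ae
        apply Eventually.of_forall
        intro t
        exact smul_comm _ _ _ }
    (∫ x, |ρ x|)
    (by
      intro v
      change ‖(memLp_convFn ρ v).toLp _‖ ≤ _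
      rw [Lp.norm_toLp, Lp.norm_def]
      have := ENNReal.toReal_mono (ENNReal.mul_lt_top ENNReal.ofReal_lt_top (Lp.memLp v).2).ne
        (eLpNorm_convFn_le ρ v)
      rwa [ENNReal.toReal_mul, ENNReal.toReal_ofReal (integral_nonneg fun x => abs_nonneg _)] at this)

theorem coeFn_convOp (ρ : Test) (v : L2C) : convOp ρ v =ᵐ[volume] convFn ρ v := by
  change ((memLp_convFn ρ v).toLp _ : L2C) =ᵐ[volume] _
  exact (memLp_convFn ρ v).coeFn_toLp

theorem norm_convOp_le (ρ : Test) (v : L2C) : ‖convOp ρ v‖ ≤ (∫ x, |ρ x|) * ‖v‖ :=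
  (LinearMap.mkContinuous_norm_le _ (integral_nonneg fun x => abs_nonneg _) _ |>
    (convOp ρ).le_of_opNorm_le) v

theorem Test.refl_refl (φ : Test) : φ.refl.refl = φ := by
  ext x; simp [Test.refl]

theorem convOp_toL2 (ρ φ : Test) : convOp ρ φ.toL2 = (ρ.conv φ).toL2 := by
  apply Lp.ext
  filter_upwards [coeFn_convOp ρ φ.toL2, (ρ.conv φ).coeFn_toL2] with x h1 h2
  rw [h1, h2, convFn_congr ρ φ.coeFn_toL2]
  simp only [convFn, Test.conv, convolution_def, ContinuousLinearMap.lsmul_apply]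
  rw [← integral_complex_ofReal]
  simp

/-- The adjoint of convolution is convolution with the reflected kernel. Against a test function
this is Fubini. -/
theorem inner_test_convOp (ρ φ : Test) (v : L2C) :
    inner ℂ φ.toL2 (convOp ρ v) = inner ℂ (ρ.refl.conv φ).toL2 v := by
  rw [Test.inner_toL2, Test.inner_toL2]
  have e1 : ∫ x, convOp ρ v x * (φ x : ℂ) = ∫ x, ∫ y, ((φ x * ρ (x - y) : ℝ) : ℂ) * v y := by
    apply integral_congr_ae
    filter_upwards [coeFn_convOp ρ v] with x hx
    rw [hx, convFn, convolution_eq_swap, mul_comm, ← integral_const_mul]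
    congr 1; ext y
    simp [mul_assoc]
  have e2 : ∫ y, v y * ((ρ.refl.conv φ) y : ℂ) = ∫ y, ∫ x, ((φ x * ρ (x - y) : ℝ) : ℂ) * v y := by
    congr 1; ext y
    rw [integral_mul_const, integral_complex_ofReal, mul_comm]
    congr 2
    simp only [Test.conv, convolution_eq_swap, ContinuousLinearMap.lsmul_apply, Test.refl, smul_eq_mul]
    congr 1; ext x
    rw [neg_sub, mul_comm]
  rw [e1, e2]
  refine integral_integral_swap ?_
  obtain ⟨C, hC0, hC⟩ := ρ.exists_bound
  -- Only y in supp φ - supp ρ contribute, a compact set, so local integrability of v suffices for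
  -- Fubini.
  set K : Set Plane := (fun z : Plane × Plane => z.1 - z.2) '' (tsupport φ ×ˢ tsupport ρ)
  have hK : IsCompact K := (φ.cpt.isCompact.prod ρ.cpt.isCompact).image (by fun_prop)
  have hg : Integrable (K.indicator fun y => ‖v y‖) := by
    rw [integrable_indicator_iff hK.measurableSet]
    exact (v.locallyIntegrable.integrableOn_isCompact hK).norm
  have hf : Integrable fun x => C * |φ x| :=
    ((φ.continuous.integrable_of_hasCompactSupport φ.cpt).norm).const_mul C
  refine (hf.mul_prod hg).mono' ?_ (Eventually.of_forall ?_)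
  · apply AEStronglyMeasurable.mul
    · apply Continuous.aestronglyMeasurable
      have := φ.continuous; have := ρ.continuous
      change Continuous fun z : Plane × Plane => ((φ z.1 * ρ (z.1 - z.2) : ℝ) : ℂ)
      fun_prop
    · exact ((Lp.stronglyMeasurable v).comp_measurable measurable_snd).aestronglyMeasurable
  · rintro ⟨x, y⟩
    simp only [Function.uncurry]
    rw [norm_mul, Complex.norm_real, Real.norm_eq_abs]
    by_cases hy : y ∈ K
    · rw [Set.indicator_of_mem hy, abs_mul, mul_comm |φ x|]
      gcongr
      exact hC _
    · rw [Set.indicator_of_notMem hy]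
      have : φ x * ρ (x - y) = 0 := by
        by_contra h
        rw [mul_eq_zero, not_or] at h
        exact hy ⟨(x, x - y), ⟨subset_tsupport _ h.1, subset_tsupport _ h.2⟩, by simp⟩
      rw [this]; simp

/-- The vectors v satisfying the identity form a closed subspace, and it contains the test
functions. -/
theorem inner_convOp (ρ : Test) (v w : L2C) :
    inner ℂ (convOp ρ v) w = inner ℂ v (convOp ρ.refl w) := by
  have hc : IsClosed {v : L2C | inner ℂ (convOp ρ v) w = inner ℂ v (convOp ρ.refl w)} :=
    isClosed_eq (by fun_prop) (by fun_prop)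
  let S : Submodule ℂ L2C :=
    { carrier := {v : L2C | inner ℂ (convOp ρ v) w = inner ℂ v (convOp ρ.refl w)}
      add_mem' := fun {a b} ha hb => by
        simp only [Set.mem_ofPred_eq, map_add, inner_add_left] at *
        rw [ha, hb]
      zero_mem' := by simp
      smul_mem' := fun c a ha => by
        simp only [Set.mem_ofPred_eq, map_smul, inner_smul_left] at *
        rw [ha] }
  have h1 : (Submodule.span ℂ (Set.range Test.toL2)).topologicalClosure ≤ S := by
    apply Submodule.topologicalClosure_minimal _ _ hc
    rw [Submodule.span_le]
    rintro _ ⟨φ, rfl⟩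
    change inner ℂ (convOp ρ φ.toL2) w = _
    rw [convOp_toL2, inner_test_convOp, Test.refl_refl]
  rw [span_test_topologicalClosure] at h1
  exact h1 (Submodule.mem_top (x := v))

theorem Test.neg_conv (ρ φ : Test) : ρ.neg.conv φ = (ρ.conv φ).neg := by
  ext x
  simp only [Test.conv, Test.neg, convolution_def, ContinuousLinearMap.lsmul_apply]
  simp [integral_neg]

theorem inner_pd_convOp (ρ φ : Test) (j : Fin 2) (v : L2C) :
    inner ℂ (φ.pd j).toL2 (convOp ρ v) = - inner ℂ φ.toL2 (convOp (ρ.pd j) v) := by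
  rw [inner_test_convOp, inner_test_convOp, ← Test.conv_pd, Test.pd_conv, Test.pd_refl, Test.neg_conv,
    Test.toL2_neg, inner_neg_left]

theorem hasGrad_convOp (ρ : Test) (v : L2C) :
    HasGrad (convOp ρ v) (fun j => convOp (ρ.pd j) v) := fun φ j => inner_pd_convOp ρ φ j v

/-- A derivative on the kernel can be moved onto v; thus convolution commutes with the weak
gradient. -/
theorem HasGrad.convOp_pd {v : L2C} {g : Fin 2 → L2C} (h : HasGrad v g) (ρ : Test) (j : Fin 2) :
    convOp (ρ.pd j) v = convOp ρ (g j) := by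
  apply L2C.ext_test
  intro φ
  rw [← neg_inj, ← inner_pd_convOp, inner_test_convOp, inner_test_convOp, ← Test.conv_pd, h]

/-- A sequence of standard bump functions shrinking to the origin. -/
def bump (n : ℕ) : ContDiffBump (0 : Plane) where
  rIn := 1 / (2 * (n + 1))
  rOut := 1 / (n + 1)
  rIn_pos := by positivity
  rIn_lt_rOut := by
    apply one_div_lt_one_div_of_lt <;> [positivity; skip]
    have : (0 : ℝ) ≤ n := by positivity
    linarith

/-- The corresponding mollifiers. -/
def moll (n : ℕ) : Test where
  fn := (bump n).normed volume
  smooth := (bump n).contDiff_normed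
  cpt := (bump n).hasCompactSupport_normed

theorem moll_refl (n : ℕ) : (moll n).refl = moll n := by
  ext x
  exact (bump n).normed_neg x

theorem norm_convOp_moll_le (n : ℕ) (v : L2C) : ‖convOp (moll n) v‖ ≤ ‖v‖ := by
  have h : ∫ x, |moll n x| = 1 := by
    rw [← (bump n).integral_normed (μ := volume)]
    congr 1; ext x
    exact abs_of_nonneg ((bump n).nonneg_normed x)
  have := norm_convOp_le (moll n) v
  rwa [h, one_mul] at this

/-- Uniform continuity gives uniform closeness, and the difference is supported in the 1-thickening
of the support, which has finite measure. -/
theorem Test.tendsto_convOp_moll (φ : Test) :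
    Tendsto (fun n => convOp (moll n) φ.toL2) atTop (𝓝 φ.toL2) := by
  set K : Set Plane := Metric.cthickening 1 (tsupport φ)
  have hK : IsCompact K := φ.cpt.isCompact.cthickening
  set m : ℝ := (volume K).toReal ^ (1 / 2 : ℝ) with hm
  have hm0 : 0 ≤ m := by positivity
  rw [Metric.tendsto_atTop]
  intro ε hε
  have hu : UniformContinuous φ := φ.continuous.uniformContinuous_of_tendsto_cocompact
    (x := 0) (by simpa using φ.cpt.is_zero_at_infty)
  rw [Metric.uniformContinuous_iff] at hu
  -- Since m is the square root of the measure of `K`, this uniform error costs at most ε / 2 in L²;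
  -- the summand 1 guards against m = 0.
  obtain ⟨δ, hδ, hd⟩ := hu (ε / (2 * (m + 1))) (by positivity)
  obtain ⟨N, hN⟩ := exists_nat_one_div_lt hδ
  refine ⟨N, fun n hn => ?_⟩
  have hrn : 1 / ((n : ℝ) + 1) < δ := lt_of_le_of_lt (by gcongr) hN
  have hpt : ∀ x, |(moll n).conv φ x - φ x| ≤ ε / (2 * (m + 1)) := by
    intro x
    rw [← Real.dist_eq]
    apply (bump n).dist_normed_convolution_le φ.continuous.aestronglyMeasurable
    intro y hy
    exact (hd (lt_of_lt_of_le (Metric.mem_ball.1 hy) hrn.le)).le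
  have hsupp : ∀ x, x ∉ K → (moll n).conv φ x - φ x = 0 := by
    intro x hx
    have h1 : ∀ y ∈ Metric.closedBall x 1, φ y = 0 := by
      intro y hy
      by_contra h
      exact hx (Metric.mem_cthickening_of_dist_le x y 1 _ (subset_tsupport _ h)
        (by rw [dist_comm]; exact Metric.mem_closedBall.1 hy))
    have h2 : φ x = 0 := h1 x (by simp)
    have h3 : dist ((moll n).conv φ x) (φ x) ≤ 0 := by
      apply (bump n).dist_normed_convolution_le φ.continuous.aestronglyMeasurable
      intro y hy
      have hr : (bump n).rOut ≤ 1 := by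
        change 1 / ((n : ℝ) + 1) ≤ 1
        rw [div_le_one (by positivity)]
        have : (0 : ℝ) ≤ n := by positivity
        linarith
      rw [h1 y (Metric.ball_subset_closedBall (Metric.ball_subset_ball hr hy)), h2]
      simp
    rw [dist_le_zero] at h3
    rw [h3, sub_self]
  rw [dist_eq_norm, convOp_toL2, Lp.norm_def]
  have hle : eLpNorm ((((moll n).conv φ).toL2 - φ.toL2 : L2C) : Plane → ℂ) 2 volume ≤
      eLpNorm (K.indicator fun _ => ε / (2 * (m + 1))) 2 volume := by
    apply eLpNorm_mono_ae
    filter_upwards [Lp.coeFn_sub ((moll n).conv φ).toL2 φ.toL2, ((moll n).conv φ).coeFn_toL2,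
      φ.coeFn_toL2] with x h1 h2 h3
    rw [h1, Pi.sub_apply, h2, h3, ← Complex.ofReal_sub, Complex.norm_real]
    by_cases hx : x ∈ K
    · rw [Set.indicator_of_mem hx, Real.norm_eq_abs]
      exact (hpt x).trans (le_abs_self _)
    · rw [hsupp x hx]; simp
  have hfin : volume K ≠ ⊤ := hK.measure_lt_top.ne
  rw [eLpNorm_indicator_const hK.measurableSet (by norm_num) (by norm_num)] at hle
  have hle' := ENNReal.toReal_mono (ENNReal.mul_ne_top (by simp) (ENNReal.rpow_ne_top_of_nonneg (by simp) hfin)) hle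
  refine hle'.trans_lt ?_
  rw [ENNReal.toReal_mul, ← ENNReal.toReal_rpow, toReal_enorm, Real.norm_of_nonneg (by positivity)]
  simp only [ENNReal.toReal_ofNat]
  rw [← hm]
  calc ε / (2 * (m + 1)) * m ≤ ε / (2 * (m + 1)) * (m + 1) := by gcongr; linarith
    _ = ε / 2 := by field_simp
    _ < ε := by linarith

/-- Contractions converging strongly to the identity on test functions do so on `L²`. -/
theorem tendsto_of_test (T : ℕ → L2C →L[ℂ] L2C) (hT : ∀ n v, ‖T n v‖ ≤ ‖v‖)
    (h : ∀ φ : Test, Tendsto (fun n => T n φ.toL2) atTop (𝓝 φ.toL2)) (v : L2C) :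
    Tendsto (fun n => T n v) atTop (𝓝 v) := by
  let S : Submodule ℂ L2C :=
    { carrier := {v : L2C | Tendsto (fun n => T n v) atTop (𝓝 v)}
      add_mem' := fun {a b} ha hb => by
        simp only [Set.mem_ofPred_eq, map_add] at *
        exact ha.add hb
      zero_mem' := by simp
      smul_mem' := fun c a ha => by
        simp only [Set.mem_ofPred_eq, map_smul] at *
        exact ha.const_smul c }
  have hc : IsClosed (S : Set L2C) := by
    rw [← closure_subset_iff_isClosed]
    intro v hv
    rw [Metric.mem_closure_iff] at hv
    change Tendsto _ _ _
    rw [Metric.tendsto_atTop]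
    intro ε hε
    obtain ⟨w, hw, hvw⟩ := hv (ε / 3) (by positivity)
    obtain ⟨N, hN⟩ := Metric.tendsto_atTop.1 (show Tendsto _ _ _ from hw) (ε / 3) (by positivity)
    refine ⟨N, fun n hn => ?_⟩
    have h1 : dist (T n v) (T n w) ≤ dist v w := by
      rw [dist_eq_norm, dist_eq_norm, ← map_sub]
      exact hT n _
    have h2 := hN n hn
    have h3 := dist_triangle4 (T n v) (T n w) w v
    rw [dist_comm w v] at h3
    linarith
  have h1 : (Submodule.span ℂ (Set.range Test.toL2)).topologicalClosure ≤ S := by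
    apply Submodule.topologicalClosure_minimal _ _ hc
    rw [Submodule.span_le]
    rintro _ ⟨φ, rfl⟩
    exact h φ
  rw [span_test_topologicalClosure] at h1
  exact h1 (Submodule.mem_top (x := v))

theorem tendsto_convOp_moll (v : L2C) : Tendsto (fun n => convOp (moll n) v) atTop (𝓝 v) :=
  tendsto_of_test _ norm_convOp_moll_le Test.tendsto_convOp_moll v

theorem convOp_neg_left (ρ : Test) (v : L2C) : convOp ρ.neg v = -convOp ρ v := by
  apply Lp.ext
  filter_upwards [coeFn_convOp ρ.neg v, Lp.coeFn_neg (convOp ρ v), coeFn_convOp ρ v] with x h1 h2 h3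
  rw [h1, h2, Pi.neg_apply, h3]
  simp only [convFn, Test.neg, convolution_def, ContinuousLinearMap.lsmul_apply, neg_smul]
  rw [integral_neg]

/-- Integration by parts for pairs of `H¹` elements. -/
theorem HasGrad.inner_eq {v y : L2C} {g k : Fin 2 → L2C} (hv : HasGrad v g) (hy : HasGrad y k)
    (j : Fin 2) : inner ℂ v (k j) = - inner ℂ (g j) y := by
  have h1 : Tendsto (fun n => inner ℂ v (convOp (moll n) (k j))) atTop (𝓝 (inner ℂ v (k j))) :=
    tendsto_const_nhds.inner (tendsto_convOp_moll _)
  have h2 : Tendsto (fun n => - inner ℂ (convOp (moll n) (g j)) y) atTop (𝓝 (-inner ℂ (g j) y)) :=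
    ((tendsto_convOp_moll _).inner tendsto_const_nhds).neg
  refine tendsto_nhds_unique h1 (h2.congr fun n => ?_)
  -- The mollifier is even, so its derivatives are odd; this is the sign in the formula.
  have h3 : ((moll n).pd j).refl = ((moll n).pd j).neg := by
    have h4 := Test.pd_refl j (moll n)
    rw [moll_refl] at h4
    ext x
    have h5 := congrArg (fun φ : Test => φ x) h4
    simp only [Test.neg] at h5 ⊢
    linarith
  rw [← hy.convOp_pd, ← hv.convOp_pd, inner_convOp, h3, convOp_neg_left, inner_neg_right, neg_neg]

theorem fderiv_convFn (ρ : Test) (v : L2C) (x : Plane) (j : Fin 2) :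
    fderiv ℝ (convFn ρ v) x (EuclideanSpace.single j 1) = convFn (ρ.pd j) v x := by
  have h := ρ.cpt.hasFDerivAt_convolution_right (μ := volume)
    (ContinuousLinearMap.lsmul ℝ ℝ : ℝ →L[ℝ] ℂ →L[ℝ] ℂ).flip v.locallyIntegrable
    (ρ.smooth.of_le (by simp)) x
  rw [convolution_flip] at h
  rw [convFn, h.fderiv, convolution_precompR_apply _ v.locallyIntegrable
    (ρ.cpt.fderiv (𝕜 := ℝ)) (ρ.smooth.continuous_fderiv (by simp)), convolution_flip]
  rfl

/-! ### Cutoffs and density of smooth functions in H¹. -/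

/-- A fixed cutoff function, equal to `1` on the closed unit ball. -/
def stdBump : ContDiffBump (0 : Plane) := ⟨1, 2, one_pos, one_lt_two⟩

/-- The dilation `x ↦ φ (c⁻¹ x)`. -/
def Test.dil (φ : Test) (c : ℝ) (hc : c ≠ 0) : Test where
  fn x := φ (c⁻¹ • x)
  smooth := φ.smooth.comp (contDiff_const_smul _)
  cpt := φ.cpt.comp_homeomorph (Homeomorph.smulOfNeZero c⁻¹ (inv_ne_zero hc))

theorem Test.pd_dil (φ : Test) (c : ℝ) (hc : c ≠ 0) (j : Fin 2) (x : Plane) :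
    (φ.dil c hc).pd j x = c⁻¹ * ((φ.pd j).dil c hc) x := by
  change fderiv ℝ (fun x => φ (c⁻¹ • x)) x _ = c⁻¹ * fderiv ℝ φ (c⁻¹ • x) _
  have : HasFDerivAt (fun x => φ (c⁻¹ • x))
      ((fderiv ℝ φ (c⁻¹ • x)).comp (c⁻¹ • ContinuousLinearMap.id ℝ Plane)) x :=
    (φ.differentiable (c⁻¹ • x)).hasFDerivAt.comp x ((hasFDerivAt_id x).const_smul c⁻¹)
  rw [this.fderiv]; simp

/-- The cutoff function as a test function. -/
def cutoff : Test := ⟨stdBump, stdBump.contDiff, stdBump.hasCompactSupport⟩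

/-- The cutoff at scale `n + 1`. -/
def cutoffN (n : ℕ) : Test := cutoff.dil (n + 1) (by positivity)

theorem cutoff_abs_le (x : Plane) : |cutoff x| ≤ 1 := by
  change |stdBump x| ≤ 1
  rw [abs_of_nonneg stdBump.nonneg]; exact stdBump.le_one

theorem cutoff_eq_one {x : Plane} (hx : ‖x‖ ≤ 1) : cutoff x = 1 :=
  stdBump.one_of_mem_closedBall (by simpa [stdBump] using hx)

theorem tendsto_mulOp_cutoffN (v : L2C) : Tendsto (fun n => mulOp (cutoffN n) v) atTop (𝓝 v) := by
  refine tendsto_of_test _ (fun n v => ?_) (fun φ => ?_) v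
  · simpa using norm_mulOp_le (cutoffN n) (C := 1) (fun x => cutoff_abs_le _) v
  · obtain ⟨R, hR⟩ := φ.cpt.isCompact.isBounded.exists_norm_le
    obtain ⟨N, hN⟩ := exists_nat_gt R
    refine tendsto_const_nhds.congr' ?_
    filter_upwards [eventually_ge_atTop N] with n hn
    rw [mulOp_toL2]
    congr 1; ext x
    simp only [Test.mul]
    by_cases hx : φ x = 0
    · simp [hx]
    · have h1 : cutoffN n x = 1 := by
        apply cutoff_eq_one
        have h2 := hR x (subset_tsupport _ hx)
        have h3 : (N : ℝ) ≤ n := by exact_mod_cast hn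
        rw [norm_smul, norm_inv, Real.norm_of_nonneg (by positivity), inv_mul_le_iff₀ (by positivity)]
        linarith
      rw [h1, one_mul]

/-- By scaling, the gradient of the cutoff has size 1 / (n + 1). -/
theorem tendsto_mulOp_pd_cutoffN (v : L2C) (j : Fin 2) :
    Tendsto (fun n => mulOp ((cutoffN n).pd j) v) atTop (𝓝 0) := by
  obtain ⟨C, hC0, hC⟩ := (cutoff.pd j).exists_bound
  refine squeeze_zero_norm (a := fun n : ℕ => (1 / ((n : ℝ) + 1)) * (C * ‖v‖)) (fun n => ?_) ?_
  · rw [← mul_assoc]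
    apply norm_mulOp_le
    intro x
    rw [cutoffN, Test.pd_dil, abs_mul, abs_of_nonneg (by positivity), one_div]
    gcongr
    exact hC _
  · simpa using tendsto_one_div_add_atTop_nhds_zero_nat.mul_const (C * ‖v‖)

theorem coeFn_convOp_pd (ρ : Test) (v : L2C) (j : Fin 2) :
    convOp (ρ.pd j) v =ᵐ[volume] fun x => fderiv ℝ (convFn ρ v) x (EuclideanSpace.single j 1) := by
  filter_upwards [coeFn_convOp (ρ.pd j) v] with x hx
  rw [hx, fderiv_convFn]

theorem hasCompactSupport_convFn_mulOp (ρ χ : Test) (v : L2C) :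
    HasCompactSupport (convFn ρ (mulOp χ v)) := by
  rw [convFn_congr ρ (coeFn_mulOp χ v)]
  apply ρ.cpt.convolution
  exact (χ.cpt.comp_left (g := Complex.ofReal) (by simp)).mul_right

theorem tendsto_clm_apply {T : ℕ → L2C →L[ℂ] L2C} (hT : ∀ n v, ‖T n v‖ ≤ ‖v‖)
    (h : ∀ v, Tendsto (fun n => T n v) atTop (𝓝 v)) {v : ℕ → L2C} {w : L2C}
    (hv : Tendsto v atTop (𝓝 w)) : Tendsto (fun n => T n (v n)) atTop (𝓝 w) := by
  have h1 : Tendsto (fun n => T n (v n - w)) atTop (𝓝 0) :=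
    squeeze_zero_norm (fun n => hT n _) (by simpa using (hv.sub_const w).norm)
  have := h1.add (h w)
  simpa using this

/-- Smooth compactly supported functions are dense in `H¹`. -/
theorem HasGrad.exists_approx {v : L2C} {g : Fin 2 → L2C} (h : HasGrad v g) :
    ∃ (ψ : ℕ → Plane → ℂ) (V : ℕ → L2C) (G : ℕ → Fin 2 → L2C),
      (∀ n, ContDiff ℝ ∞ (ψ n)) ∧ (∀ n, HasCompactSupport (ψ n)) ∧ (∀ n, V n =ᵐ[volume] ψ n) ∧
      (∀ n j, G n j =ᵐ[volume] fun x => fderiv ℝ (ψ n) x (EuclideanSpace.single j 1)) ∧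
      (∀ n, HasGrad (V n) (G n)) ∧
      Tendsto V atTop (𝓝 v) ∧ ∀ j, Tendsto (fun n => G n j) atTop (𝓝 (g j)) := by
  -- Cut off, then mollify: the gradient gains only the cutoff term, which tends to zero.
  refine ⟨fun n => convFn (moll n) (mulOp (cutoffN n) v), fun n => convOp (moll n) (mulOp (cutoffN n) v),
    fun n j => convOp ((moll n).pd j) (mulOp (cutoffN n) v), fun n => contDiff_convFn _ _,
    fun n => hasCompactSupport_convFn_mulOp _ _ _, fun n => coeFn_convOp _ _,
    fun n j => coeFn_convOp_pd _ _ _, fun n => hasGrad_convOp _ _, ?_, fun j => ?_⟩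
  · exact tendsto_clm_apply norm_convOp_moll_le tendsto_convOp_moll (tendsto_mulOp_cutoffN v)
  · have : ∀ n, convOp ((moll n).pd j) (mulOp (cutoffN n) v) =
        convOp (moll n) (mulOp (cutoffN n) (g j) + mulOp ((cutoffN n).pd j) v) :=
      fun n => (h.mul_test (cutoffN n)).convOp_pd (moll n) j
    simp only [this]
    apply tendsto_clm_apply norm_convOp_moll_le tendsto_convOp_moll
    simpa using (tendsto_mulOp_cutoffN (g j)).add (tendsto_mulOp_pd_cutoffN v j)

/-! ### The chain rule for weak gradients. -/

theorem exists_subseq_ae {V : ℕ → L2C} {v : L2C} (h : Tendsto V atTop (𝓝 v)) :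
    ∃ ns : ℕ → ℕ, StrictMono ns ∧ ∀ᵐ x : Plane, Tendsto (fun i => V (ns i) x) atTop (𝓝 (v x)) :=
  (tendstoInMeasure_of_tendsto_Lp h).exists_seq_tendsto_ae

theorem integrable_mul_test (v : L2C) (φ : Test) : Integrable (fun x => v x * (φ x : ℂ)) := by
  have := (Lp.memLp v).integrable_mul (φ.memLp 2)
  exact this

theorem tendsto_integral_mul_test {V : ℕ → L2C} {v : L2C} (h : Tendsto V atTop (𝓝 v)) (φ : Test) :
    Tendsto (fun n => ∫ x, ‖V n x - v x‖ * |φ x|) atTop (𝓝 0) := by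
  have hb : ∀ n, ∫ x, ‖V n x - v x‖ * |φ x| ≤ ‖V n - v‖ * ‖φ.toL2‖ := by
    intro n
    have h1 := integral_mul_norm_le_Lp_mul_Lq (μ := (volume : Measure Plane))
      (f := fun x => (V n - v) x) (g := fun x => φ.toL2 x) Real.HolderConjugate.two_two
      (by simpa using Lp.memLp (V n - v)) (by simpa using Lp.memLp φ.toL2)
    have e : ∀ w : L2C, (∫ x, ‖w x‖ ^ (2 : ℝ)) ^ (1 / 2 : ℝ) = ‖w‖ := by
      intro w
      rw [Lp.norm_def, (Lp.memLp w).eLpNorm_eq_integral_rpow_norm (by norm_num) (by norm_num),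
        ENNReal.toReal_ofReal (by positivity)]
      simp
    rw [e, e] at h1
    refine le_trans (le_of_eq ?_) h1
    apply integral_congr_ae
    filter_upwards [Lp.coeFn_sub (V n) v, φ.coeFn_toL2] with x h2 h3
    rw [h2, h3]; simp
  refine squeeze_zero (fun n => integral_nonneg fun x => by positivity) hb ?_
  have := (h.sub_const v).norm
  simpa using this.mul_const ‖φ.toL2‖

theorem aestronglyMeasurable_fderiv_apply {Φ : ℂ → ℂ} (hΦ : ContDiff ℝ 1 Φ) {a b : Plane → ℂ}
    (ha : AEStronglyMeasurable a) (hb : AEStronglyMeasurable b) :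
    AEStronglyMeasurable (fun x => fderiv ℝ Φ (a x) (b x)) :=
  (hΦ.continuous_fderiv_apply one_ne_zero).comp_aestronglyMeasurable (ha.prodMk hb)

theorem integral_comp_mul_pd {Φ : ℂ → ℂ} (hΦ : ContDiff ℝ 1 Φ) {ψ : Plane → ℂ} (hψ : ContDiff ℝ 1 ψ)
    (φ : Test) (j : Fin 2) :
    ∫ x, Φ (ψ x) * (φ.pd j x : ℂ) =
      - ∫ x, fderiv ℝ Φ (ψ x) (fderiv ℝ ψ x (EuclideanSpace.single j 1)) * (φ x : ℂ) := by
  have hc : ContDiff ℝ 1 (fun x => Φ (ψ x)) := hΦ.comp hψ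
  have hd : ∀ x, fderiv ℝ (fun x => Φ (ψ x)) x (EuclideanSpace.single j 1) =
      fderiv ℝ Φ (ψ x) (fderiv ℝ ψ x (EuclideanSpace.single j 1)) := by
    intro x
    have := ((hΦ.differentiable one_ne_zero (ψ x)).hasFDerivAt.comp x
      (hψ.differentiable one_ne_zero x).hasFDerivAt).fderiv
    change fderiv ℝ (Φ ∘ ψ) x _ = _
    rw [this]; rfl
  have hφc : Continuous fun x => (φ x : ℂ) := Complex.continuous_ofReal.comp φ.continuous
  have hφd : ∀ x, HasFDerivAt (fun x => (φ x : ℂ)) (Complex.ofRealCLM.comp (fderiv ℝ φ x)) x :=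
    fun x => Complex.ofRealCLM.hasFDerivAt.comp x (φ.differentiable x).hasFDerivAt
  have hφs : HasCompactSupport fun x => (φ x : ℂ) := φ.cpt.comp_left (g := Complex.ofReal) (by simp)
  have hφ1 : ContDiff ℝ 1 fun x => (φ x : ℂ) := Complex.ofRealCLM.contDiff.comp (φ.smooth.of_le (by simp))
  have hp : ∀ x, fderiv ℝ (fun x => (φ x : ℂ)) x (EuclideanSpace.single j 1) = (φ.pd j x : ℂ) := by
    intro x; rw [(hφd x).fderiv]; rfl
  have := integral_mul_fderiv_eq_neg_fderiv_mul_of_integrable (μ := (volume : Measure Plane))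
    (f := fun x => Φ (ψ x)) (g := fun x => (φ x : ℂ)) (v := EuclideanSpace.single j 1)
    (by
      apply Continuous.integrable_of_hasCompactSupport
      · exact (hc.continuous_fderiv one_ne_zero).clm_apply continuous_const |>.mul hφc
      · exact hφs.mul_left)
    (by
      apply Continuous.integrable_of_hasCompactSupport
      · exact hc.continuous.mul ((hφ1.continuous_fderiv one_ne_zero).clm_apply continuous_const)
      · simp only [hp]
        exact ((φ.pd j).cpt.comp_left (g := Complex.ofReal) (by simp)).mul_left)
    (by
      apply Continuous.integrable_of_hasCompactSupport
      · exact hc.continuous.mul hφc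
      · exact hφs.mul_left)
    (fun x _ => hc.differentiable one_ne_zero x) (fun x _ => hφ1.differentiable one_ne_zero x)
  simp only [hp, hd] at this
  exact this

/-- Chain rule for `C¹` functions with bounded derivative. -/
theorem HasGrad.chain_of_bounded {v : L2C} {g : Fin 2 → L2C} (h : HasGrad v g) {Φ : ℂ → ℂ}
    (hΦ : ContDiff ℝ 1 Φ) {K : ℝ} (hK : ∀ z, ‖fderiv ℝ Φ z‖ ≤ K) (φ : Test) (j : Fin 2) :
    ∫ x, Φ (v x) * (φ.pd j x : ℂ) = - ∫ x, fderiv ℝ Φ (v x) (g j x) * (φ x : ℂ) := by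
  have hLip : ∀ z w, ‖Φ z - Φ w‖ ≤ K * ‖z - w‖ := fun z w =>
    convex_univ.norm_image_sub_le_of_norm_fderiv_le (𝕜 := ℝ)
      (fun x _ => hΦ.differentiable one_ne_zero x) (fun x _ => hK x) (Set.mem_univ w) (Set.mem_univ z)
  have hK0 : 0 ≤ K := (norm_nonneg _).trans (hK 0)
  -- Convergence almost everywhere is needed because the derivative of Φ is only continuous and
  -- bounded, not Lipschitz.
  obtain ⟨ns, hns, hae⟩ := exists_subseq_ae (tendsto_convOp_moll v)
  set V : ℕ → L2C := fun n => convOp (moll (ns n)) v with hV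
  set G : ℕ → L2C := fun n => convOp (moll (ns n)) (g j) with hG
  have hVt : Tendsto V atTop (𝓝 v) := (tendsto_convOp_moll v).comp hns.tendsto_atTop
  have hGt : Tendsto G atTop (𝓝 (g j)) := (tendsto_convOp_moll (g j)).comp hns.tendsto_atTop
  have hφm : ∀ φ : Test, AEStronglyMeasurable (fun x => (φ x : ℂ)) (volume : Measure Plane) := fun φ =>
    (Complex.continuous_ofReal.comp φ.continuous).aestronglyMeasurable
  have hΦint : ∀ w : L2C, Integrable fun x => Φ (w x) * (φ.pd j x : ℂ) := by
    intro w
    refine ((memLp_one_iff_integrable.1 ((φ.pd j).memLp 1)).norm.const_mul ‖Φ 0‖ |>.add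
      ((integrable_mul_test w (φ.pd j)).norm.const_mul K)).mono'
      ((hΦ.continuous.comp_aestronglyMeasurable (Lp.memLp w).1).mul (hφm _)) (Eventually.of_forall fun x => ?_)
    simp only [Pi.add_apply, norm_mul]
    rw [← mul_assoc, ← add_mul]
    gcongr
    have h1 := hLip (w x) 0
    have h2 := norm_sub_norm_le (Φ (w x)) (Φ 0)
    rw [sub_zero] at h1
    linarith
  have hDint : ∀ w y : L2C, Integrable fun x => fderiv ℝ Φ (w x) (y x) * (φ x : ℂ) := by
    intro w y
    refine ((integrable_mul_test y φ).norm.const_mul K).mono'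
      ((aestronglyMeasurable_fderiv_apply hΦ (Lp.memLp w).1 (Lp.memLp y).1).mul (hφm _))
      (Eventually.of_forall fun x => ?_)
    rw [norm_mul, norm_mul, ← mul_assoc]
    gcongr
    exact (ContinuousLinearMap.le_opNorm _ _).trans (by gcongr; exact hK _)
  have hid : ∀ n, ∫ x, Φ (V n x) * (φ.pd j x : ℂ) = - ∫ x, fderiv ℝ Φ (V n x) (G n x) * (φ x : ℂ) := by
    intro n
    have h1 := integral_comp_mul_pd hΦ ((contDiff_convFn (moll (ns n)) v).of_le (by simp)) φ j
    have h2 : V n =ᵐ[volume] convFn (moll (ns n)) v := coeFn_convOp _ _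
    have h3 : G n =ᵐ[volume] fun x => fderiv ℝ (convFn (moll (ns n)) v) x (EuclideanSpace.single j 1) := by
      rw [hG]; simp only; rw [← h.convOp_pd]
      exact coeFn_convOp_pd _ _ _
    have e1 : ∫ x, Φ (V n x) * (φ.pd j x : ℂ) = ∫ x, Φ (convFn (moll (ns n)) v x) * (φ.pd j x : ℂ) := by
      apply integral_congr_ae
      filter_upwards [h2] with x hx
      rw [hx]
    rw [e1, h1]
    congr 1
    apply integral_congr_ae
    filter_upwards [h2, h3] with x hx hx'
    rw [hx, hx']
  have hL : Tendsto (fun n => ∫ x, Φ (V n x) * (φ.pd j x : ℂ)) atTop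
      (𝓝 (∫ x, Φ (v x) * (φ.pd j x : ℂ))) := by
    rw [tendsto_iff_norm_sub_tendsto_zero]
    have h0 := (tendsto_integral_mul_test hVt (φ.pd j)).const_mul K
    rw [mul_zero] at h0
    refine squeeze_zero (fun _ => norm_nonneg _) (fun n => ?_) h0
    rw [← integral_sub (hΦint _) (hΦint _), ← integral_const_mul]
    have hi : Integrable fun x => K * (‖V n x - v x‖ * |φ.pd j x|) := by
      refine (((integrable_mul_test (V n - v) (φ.pd j)).norm).const_mul K).congr ?_
      filter_upwards [Lp.coeFn_sub (V n) v] with x hx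
      rw [hx]; simp
    refine norm_integral_le_of_norm_le hi (Eventually.of_forall fun x => ?_)
    rw [← sub_mul, norm_mul, Complex.norm_real, Real.norm_eq_abs, ← mul_assoc]
    gcongr
    exact hLip _ _
  -- The gradient term is split: the error in the gradient is handled by L² convergence, the change
  -- of base point in the derivative by dominated convergence.
  have hR1 : Tendsto (fun n => ∫ x, fderiv ℝ Φ (V n x) (G n x - g j x) * (φ x : ℂ)) atTop (𝓝 0) := by
    have h0 := (tendsto_integral_mul_test hGt φ).const_mul K
    rw [mul_zero] at h0
    refine squeeze_zero_norm (fun n => ?_) h0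
    rw [← integral_const_mul]
    have hi : Integrable fun x => K * (‖G n x - g j x‖ * |φ x|) := by
      refine (((integrable_mul_test (G n - g j) φ).norm).const_mul K).congr ?_
      filter_upwards [Lp.coeFn_sub (G n) (g j)] with x hx
      rw [hx]; simp
    refine norm_integral_le_of_norm_le hi (Eventually.of_forall fun x => ?_)
    rw [norm_mul, Complex.norm_real, Real.norm_eq_abs, ← mul_assoc]
    gcongr
    exact (ContinuousLinearMap.le_opNorm _ _).trans (by gcongr; exact hK _)
  have hR2 : Tendsto (fun n => ∫ x, fderiv ℝ Φ (V n x) (g j x) * (φ x : ℂ)) atTop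
      (𝓝 (∫ x, fderiv ℝ Φ (v x) (g j x) * (φ x : ℂ))) := by
    refine tendsto_integral_of_dominated_convergence (fun x => K * ‖g j x * (φ x : ℂ)‖)
      (fun n => (hDint _ _).1) ((integrable_mul_test (g j) φ).norm.const_mul K) (fun n => ?_) ?_
    · refine Eventually.of_forall fun x => ?_
      rw [norm_mul, norm_mul, ← mul_assoc]
      gcongr
      exact (ContinuousLinearMap.le_opNorm _ _).trans (by gcongr; exact hK _)
    · filter_upwards [hae] with x hx
      refine Tendsto.mul_const _ ?_
      exact (((hΦ.continuous_fderiv_apply one_ne_zero).comp (continuous_id.prodMk continuous_const)).tendsto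
        (v x)).comp hx
  have hR : Tendsto (fun n => - ∫ x, fderiv ℝ Φ (V n x) (G n x) * (φ x : ℂ)) atTop
      (𝓝 (- ∫ x, fderiv ℝ Φ (v x) (g j x) * (φ x : ℂ))) := by
    have h0 := (hR1.add hR2).neg
    rw [zero_add] at h0
    refine h0.congr fun n => ?_
    rw [← integral_add _ (hDint _ _)]
    · congr 1
      apply integral_congr_ae
      refine Eventually.of_forall fun x => ?_
      simp only [map_sub]; ring
    · refine ((hDint (V n) (G n)).sub (hDint (V n) (g j))).congr (Eventually.of_forall fun x => ?_)
      simp only [map_sub, Pi.sub_apply]; ring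
  simp only [hid] at hL
  exact tendsto_nhds_unique hL hR

/-- A cutoff function on `ℂ`. -/
def complexBump : ContDiffBump (0 : ℂ) := ⟨1, 2, one_pos, one_lt_two⟩

/-- Smooth bounded approximations of the identity map of `ℂ`. -/
def trunc (k : ℕ) (z : ℂ) : ℂ := (complexBump (((k : ℝ) + 1)⁻¹ • z)) • z

theorem contDiff_trunc (k : ℕ) : ContDiff ℝ 1 (trunc k) :=
  (complexBump.contDiff.comp (contDiff_const_smul _)).smul contDiff_id

theorem norm_trunc_le (k : ℕ) (z : ℂ) : ‖trunc k z‖ ≤ ‖z‖ := by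
  rw [trunc, norm_smul, Real.norm_of_nonneg complexBump.nonneg]
  exact mul_le_of_le_one_left (norm_nonneg _) complexBump.le_one

theorem norm_trunc_le' (k : ℕ) (z : ℂ) : ‖trunc k z‖ ≤ 2 * (k + 1) := by
  by_cases hz : ‖z‖ ≤ 2 * (k + 1)
  · exact (norm_trunc_le k z).trans hz
  · have : complexBump (((k : ℝ) + 1)⁻¹ • z) = 0 := by
      apply complexBump.zero_of_le_dist
      rw [dist_zero_right, norm_smul, norm_inv, Real.norm_of_nonneg (by positivity), ← div_eq_inv_mul,
        le_div_iff₀ (by positivity)]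
      exact (not_le.1 hz).le
    rw [trunc, this, zero_smul, norm_zero]
    positivity

theorem trunc_eq {k : ℕ} {z : ℂ} (hz : ‖z‖ ≤ k + 1) : trunc k z = z := by
  have : complexBump (((k : ℝ) + 1)⁻¹ • z) = 1 := by
    apply complexBump.one_of_mem_closedBall
    rw [mem_closedBall_zero_iff, norm_smul, norm_inv, Real.norm_of_nonneg (by positivity),
      ← div_eq_inv_mul, div_le_iff₀ (by positivity)]
    simpa [complexBump] using hz
  rw [trunc, this, one_smul]

/-- The bound is uniform in k by scaling: where the cutoff varies, |z| ≤ 2(k + 1), and this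
compensates the factor 1 / (k + 1) from its derivative. -/
theorem exists_fderiv_trunc_le : ∃ C, 0 ≤ C ∧ ∀ k z, ‖fderiv ℝ (trunc k) z‖ ≤ C := by
  have hcs : HasCompactSupport (fderiv ℝ complexBump) := complexBump.hasCompactSupport.fderiv (𝕜 := ℝ)
  obtain ⟨C, hC⟩ := (complexBump.contDiff (n := 1)).continuous_fderiv one_ne_zero
    |>.bounded_above_of_compact_support hcs
  have hC0 : 0 ≤ C := (norm_nonneg _).trans (hC 0)
  refine ⟨1 + 2 * C, by positivity, fun k z => ?_⟩
  set c : ℝ := ((k : ℝ) + 1)⁻¹ with hc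
  have hcpos : 0 < c := by positivity
  have h1 : HasFDerivAt (fun z : ℂ => complexBump (c • z))
      ((fderiv ℝ complexBump (c • z)).comp (c • ContinuousLinearMap.id ℝ ℂ)) z :=
    (complexBump.contDiff.differentiable one_ne_zero (c • z)).hasFDerivAt.comp z
      ((hasFDerivAt_id z).const_smul c)
  have h2 := h1.smul (hasFDerivAt_id z)
  have h3 : fderiv ℝ (trunc k) z = _ := h2.fderiv
  rw [h3]
  refine ContinuousLinearMap.opNorm_le_bound _ (by positivity) fun w => ?_
  simp only [id]
  change ‖complexBump (c • z) • w + (fderiv ℝ complexBump (c • z) (c • w)) • z‖ ≤ _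
  have h4 : ‖complexBump (c • z) • w‖ ≤ ‖w‖ := by
    rw [norm_smul, Real.norm_of_nonneg complexBump.nonneg]
    exact mul_le_of_le_one_left (norm_nonneg _) complexBump.le_one
  have h5 : ‖(fderiv ℝ complexBump (c • z) (c • w)) • z‖ ≤ 2 * C * ‖w‖ := by
    by_cases hz : c * ‖z‖ ≤ 2
    · rw [norm_smul, map_smul, norm_smul, Real.norm_of_nonneg hcpos.le]
      calc c * ‖fderiv ℝ complexBump (c • z) w‖ * ‖z‖ = (c * ‖z‖) * ‖fderiv ℝ complexBump (c • z) w‖ := by ring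
        _ ≤ 2 * (C * ‖w‖) := by
          gcongr
          exact (ContinuousLinearMap.le_opNorm _ _).trans (by gcongr; exact hC _)
        _ = _ := by ring
    · have : fderiv ℝ complexBump (c • z) = 0 := by
        by_contra hne
        have h6 := support_fderiv_subset ℝ (f := complexBump) (Function.mem_support.2 hne)
        rw [complexBump.tsupport_eq, mem_closedBall_zero_iff, norm_smul, Real.norm_of_nonneg hcpos.le] at h6
        exact hz (by simpa [complexBump] using h6)
      rw [this]; simp; positivity
  calc _ ≤ ‖w‖ + 2 * C * ‖w‖ := (norm_add_le _ _).trans (add_le_add h4 h5)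
    _ = _ := by ring

theorem fderiv_trunc_eq {k : ℕ} {z : ℂ} (hz : ‖z‖ < k + 1) :
    fderiv ℝ (trunc k) z = ContinuousLinearMap.id ℝ ℂ := by
  have : trunc k =ᶠ[𝓝 z] id := by
    filter_upwards [continuous_norm.continuousAt.eventually (gt_mem_nhds hz)] with w hw
    exact trunc_eq (le_of_lt hw)
  rw [this.fderiv_eq, fderiv_id]

/-- Chain rule for `C¹` functions with controlled growth. -/
theorem HasGrad.chain {v : L2C} {g : Fin 2 → L2C} (h : HasGrad v g) {Φ : ℂ → ℂ}
    (hΦ : ContDiff ℝ 1 Φ) {b₀ b₁ : ℝ → ℝ} (hb₀ : ∀ z, ‖Φ z‖ ≤ b₀ ‖z‖)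
    (hb₁ : ∀ z, ‖fderiv ℝ Φ z‖ ≤ b₁ ‖z‖) (hm₀ : ∀ s t, 0 ≤ s → s ≤ t → b₀ s ≤ b₀ t)
    (hm₁ : ∀ s t, 0 ≤ s → s ≤ t → b₁ s ≤ b₁ t) (φ : Test) (j : Fin 2)
    (hi₀ : Integrable fun x => b₀ ‖v x‖ * |φ.pd j x|)
    (hi₁ : Integrable fun x => b₁ ‖v x‖ * ‖g j x‖ * |φ x|) :
    ∫ x, Φ (v x) * (φ.pd j x : ℂ) = - ∫ x, fderiv ℝ Φ (v x) (g j x) * (φ x : ℂ) := by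
  obtain ⟨C, hC0, hC⟩ := exists_fderiv_trunc_le
  -- Composition with `trunc k` makes the derivative bounded, so `HasGrad.chain_of_bounded` applies;
  -- monotonicity of the growth bounds gives a dominating function uniform in k.
  have hΨ : ∀ k, ContDiff ℝ 1 (fun z => Φ (trunc k z)) := fun k => hΦ.comp (contDiff_trunc k)
  have hd : ∀ k z, fderiv ℝ (fun z => Φ (trunc k z)) z =
      (fderiv ℝ Φ (trunc k z)).comp (fderiv ℝ (trunc k) z) := fun k z =>
    ((hΦ.differentiable one_ne_zero (trunc k z)).hasFDerivAt.comp z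
      ((contDiff_trunc k).differentiable one_ne_zero z).hasFDerivAt).fderiv
  have hnb : ∀ k z, ‖fderiv ℝ (fun z => Φ (trunc k z)) z‖ ≤ b₁ ‖z‖ * C := by
    intro k z
    rw [hd]
    refine (ContinuousLinearMap.opNorm_comp_le _ _).trans ?_
    have h1 := (hb₁ (trunc k z)).trans (hm₁ _ _ (norm_nonneg _) (norm_trunc_le k z))
    have h2 := hC k z
    have h3 : 0 ≤ b₁ ‖z‖ := (norm_nonneg _).trans h1
    gcongr
  have hnb' : ∀ k z, ‖fderiv ℝ (fun z => Φ (trunc k z)) z‖ ≤ b₁ (2 * (k + 1)) * C := by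
    intro k z
    rw [hd]
    refine (ContinuousLinearMap.opNorm_comp_le _ _).trans ?_
    have h1 := (hb₁ (trunc k z)).trans (hm₁ _ _ (norm_nonneg _) (norm_trunc_le' k z))
    have h2 := hC k z
    have h3 : 0 ≤ b₁ (2 * (k + 1)) := (norm_nonneg _).trans h1
    gcongr
  have hid := fun k => h.chain_of_bounded (hΨ k) (hnb' k) φ j
  have hφm : ∀ φ : Test, AEStronglyMeasurable (fun x => (φ x : ℂ)) (volume : Measure Plane) := fun φ =>
    (Complex.continuous_ofReal.comp φ.continuous).aestronglyMeasurable
  have hL : Tendsto (fun k : ℕ => ∫ x, Φ (trunc k (v x)) * (φ.pd j x : ℂ)) atTop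
      (𝓝 (∫ x, Φ (v x) * (φ.pd j x : ℂ))) := by
    refine tendsto_integral_of_dominated_convergence _ (fun k => ?_) hi₀ (fun k => ?_) ?_
    · exact ((hΨ k).continuous.comp_aestronglyMeasurable (Lp.memLp v).1).mul (hφm _)
    · refine Eventually.of_forall fun x => ?_
      rw [norm_mul, Complex.norm_real, Real.norm_eq_abs]
      gcongr
      exact (hb₀ _).trans (hm₀ _ _ (norm_nonneg _) (norm_trunc_le k _))
    · refine Eventually.of_forall fun x => ?_
      refine tendsto_const_nhds.congr' ?_
      obtain ⟨N, hN⟩ := exists_nat_gt ‖v x‖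
      filter_upwards [eventually_ge_atTop N] with k hk
      have : (N : ℝ) ≤ k := by exact_mod_cast hk
      rw [trunc_eq (by linarith)]
  have hR : Tendsto (fun k : ℕ => - ∫ x, fderiv ℝ (fun z => Φ (trunc k z)) (v x) (g j x) * (φ x : ℂ)) atTop
      (𝓝 (- ∫ x, fderiv ℝ Φ (v x) (g j x) * (φ x : ℂ))) := by
    refine (tendsto_integral_of_dominated_convergence _ (fun k => ?_) (hi₁.const_mul C) (fun k => ?_) ?_).neg
    · exact (aestronglyMeasurable_fderiv_apply (hΨ k) (Lp.memLp v).1 (Lp.memLp (g j)).1).mul (hφm _)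
    · refine Eventually.of_forall fun x => ?_
      rw [norm_mul, Complex.norm_real, Real.norm_eq_abs, ← mul_assoc]
      gcongr
      refine (ContinuousLinearMap.le_opNorm _ _).trans ?_
      calc _ ≤ (b₁ ‖v x‖ * C) * ‖g j x‖ := by gcongr; exact hnb k _
        _ = _ := by ring
    · refine Eventually.of_forall fun x => ?_
      refine tendsto_const_nhds.congr' ?_
      obtain ⟨N, hN⟩ := exists_nat_gt ‖v x‖
      filter_upwards [eventually_ge_atTop N] with k hk
      have : (N : ℝ) ≤ k := by exact_mod_cast hk
      rw [hd, trunc_eq (by linarith), fderiv_trunc_eq (by linarith)]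
      rfl
  simp only [hid] at hL
  exact tendsto_nhds_unique hL hR

/-! ### Level sets and a weak Moser-Trudinger inequality. -/

/-- Off the open unit interval the function attains its minimum 0 or maximum 1, so the derivative
vanishes, endpoints included; inside, compactness bounds it. -/
theorem exists_bound_deriv_smoothTransition : ∃ L, 0 < L ∧
    ∀ t, |deriv Real.smoothTransition t| ≤ L ∧ (t ∉ Set.Ioo 0 1 → deriv Real.smoothTransition t = 0) := by
  have hz : ∀ t, t ∉ Set.Ioo (0 : ℝ) 1 → deriv Real.smoothTransition t = 0 := by
    intro t ht
    rw [Set.mem_Ioo, not_and_or, not_lt, not_lt] at ht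
    rcases ht with ht | ht
    · apply IsLocalMin.deriv_eq_zero
      refine Eventually.of_forall fun s => ?_
      simp only [Real.smoothTransition.zero_of_nonpos ht]
      exact Real.smoothTransition.nonneg s
    · apply IsLocalMax.deriv_eq_zero
      refine Eventually.of_forall fun s => ?_
      simp only [Real.smoothTransition.one_of_one_le ht]
      exact Real.smoothTransition.le_one s
  have hcont : Continuous (deriv Real.smoothTransition) :=
    (Real.smoothTransition.contDiff (n := 1)).continuous_deriv le_rfl
  obtain ⟨C, hC⟩ := (isCompact_Icc (a := (0 : ℝ)) (b := 1)).exists_bound_of_continuousOn hcont.continuousOn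
  refine ⟨|C| + 1, by positivity, fun t => ⟨?_, hz t⟩⟩
  by_cases ht : t ∈ Set.Ioo (0 : ℝ) 1
  · have := hC t (Set.Ioo_subset_Icc_self ht)
    rw [Real.norm_eq_abs] at this
    linarith [le_abs_self C]
  · rw [hz t ht]; simp; positivity

/-- A smooth regularization of the modulus. -/
def regAbs (ψ : Plane → ℂ) (ε : ℝ) (x : Plane) : ℝ := Real.sqrt (‖ψ x‖ ^ 2 + ε ^ 2)

section levels

variable {ψ : Plane → ℂ} {ε : ℝ}

theorem contDiff_regAbs (hψ : ContDiff ℝ 1 ψ) (hε : 0 < ε) : ContDiff ℝ 1 (regAbs ψ ε) := by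
  apply ContDiff.sqrt
  · exact (hψ.norm_sq ℝ).add contDiff_const
  · intro x; positivity

/-- The gradient is Re(ψ̄ ∇ψ) divided by the regularized modulus, which is at least |ψ|. -/
theorem norm_fderiv_regAbs_le (hψ : ContDiff ℝ 1 ψ) (hε : 0 < ε) (x : Plane) :
    ‖fderiv ℝ (regAbs ψ ε) x‖ ≤ ‖fderiv ℝ ψ x‖ := by
  have h1 : HasFDerivAt (fun x => ‖ψ x‖ ^ 2 + ε ^ 2) _ x :=
    ((hψ.differentiable one_ne_zero x).hasFDerivAt.norm_sq).add_const (ε ^ 2)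
  have hpos : 0 < ‖ψ x‖ ^ 2 + ε ^ 2 := by positivity
  have h2 := h1.sqrt hpos.ne'
  have h3 : fderiv ℝ (regAbs ψ ε) x = _ := h2.fderiv
  have hs : 0 < Real.sqrt (‖ψ x‖ ^ 2 + ε ^ 2) := Real.sqrt_pos.2 hpos
  have hle : ‖ψ x‖ ≤ Real.sqrt (‖ψ x‖ ^ 2 + ε ^ 2) := Real.le_sqrt_of_sq_le (by nlinarith [sq_nonneg ε])
  rw [h3]
  refine ContinuousLinearMap.opNorm_le_bound _ (norm_nonneg _) fun w => ?_
  simp only [smul_apply, ContinuousLinearMap.comp_apply, innerSL_apply_apply, smul_eq_mul,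
    nsmul_eq_mul, Nat.cast_ofNat]
  have h4 : |inner ℝ (ψ x) (fderiv ℝ ψ x w)| ≤ ‖ψ x‖ * (‖fderiv ℝ ψ x‖ * ‖w‖) :=
    (abs_real_inner_le_norm _ _).trans (by gcongr; exact ContinuousLinearMap.le_opNorm _ _)
  rw [Real.norm_eq_abs, abs_mul, abs_mul, abs_of_pos (by positivity : (0:ℝ) < 2),
    abs_of_pos (by positivity : 0 < 1 / (2 * Real.sqrt (‖ψ x‖ ^ 2 + ε ^ 2)))]
  rw [div_mul_eq_mul_div, one_mul, div_le_iff₀ (by positivity)]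
  calc 2 * |inner ℝ (ψ x) (fderiv ℝ ψ x w)| ≤ 2 * (‖ψ x‖ * (‖fderiv ℝ ψ x‖ * ‖w‖)) := by gcongr
    _ ≤ 2 * (Real.sqrt (‖ψ x‖ ^ 2 + ε ^ 2) * (‖fderiv ℝ ψ x‖ * ‖w‖)) := by gcongr
    _ = _ := by ring

theorem regAbs_of_eq_zero (hε : 0 < ε) {x : Plane} (hx : ψ x = 0) : regAbs ψ ε x = ε := by
  simp [regAbs, hx, Real.sqrt_sq hε.le]

/-- The Sobolev inequality at p = 1; in dimension 2 the target exponent is 2. It plays the role of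
the isoperimetric inequality. -/
theorem exists_gns : ∃ C : NNReal, ∀ T : Plane → ℝ, ContDiff ℝ 1 T → HasCompactSupport T →
    ∫⁻ x, ‖T x‖ₑ ^ 2 ≤ (C * ∫⁻ x, ‖fderiv ℝ T x‖ₑ) ^ 2 := by
  refine ⟨eLpNormLESNormFDerivOneConst (volume : Measure Plane) 2, fun T hT hc => ?_⟩
  have hp : NNReal.HolderConjugate (Module.finrank ℝ Plane : NNReal) 2 := by
    rw [finrank_euclideanSpace_fin]
    exact NNReal.HolderConjugate.two_two
  have h := eLpNorm_le_eLpNorm_fderiv_one (μ := (volume : Measure Plane)) hT hc hp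
  rw [eLpNorm_one_eq_lintegral_enorm] at h
  have h2 := pow_le_pow_left' h 2
  refine le_trans (le_of_eq ?_) h2
  have := eLpNorm_nnreal_pow_eq_lintegral (μ := (volume : Measure Plane)) (f := T) (p := 2) (by norm_num)
  simp at this ⊢
  exact this.symm

set_option maxHeartbeats 400000 in
/-- Decay of the distribution function between two levels. -/
theorem exists_level_le : ∃ C : ℝ, 0 < C ∧ ∀ (ψ : Plane → ℂ), ContDiff ℝ 1 ψ → HasCompactSupport ψ →
    ∀ ε s s' : ℝ, 0 < ε → ε < s → s < s' →
    (s' - s) ^ 2 * volume.real {x | s' ≤ regAbs ψ ε x} ≤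
      C * ((∫ x in {x | regAbs ψ ε x < s'}, ‖fderiv ℝ ψ x‖ ^ 2) -
        ∫ x in {x | regAbs ψ ε x < s}, ‖fderiv ℝ ψ x‖ ^ 2) * volume.real {x | s ≤ regAbs ψ ε x} := by
  obtain ⟨C0, hC0⟩ := exists_gns
  obtain ⟨L, hL, hLd⟩ := exists_bound_deriv_smoothTransition
  refine ⟨(C0 * L) ^ 2 + 1, by positivity, fun ψ hψ hψc ε s s' hε hs hs' => ?_⟩
  have hd : 0 < s' - s := sub_pos.2 hs'
  set β := regAbs ψ ε with hβ
  have hβ1 : ContDiff ℝ 1 β := contDiff_regAbs hψ hε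
  have hβc : Continuous β := hβ1.continuous
  -- T climbs from 0 to 1 across the band s ≤ β < s'. Its L² norm controls the measure above s', and
  -- its gradient lives on the band.
  set T : Plane → ℝ := fun x => Real.smoothTransition ((β x - s) / (s' - s)) with hT
  have hT1 : ContDiff ℝ 1 T := Real.smoothTransition.contDiff.comp ((hβ1.sub contDiff_const).div_const _)
  have hTc : HasCompactSupport T := by
    refine hψc.mono ?_
    intro x hx h0
    apply hx
    simp only [hT]
    apply Real.smoothTransition.zero_of_nonpos
    apply div_nonpos_of_nonpos_of_nonneg _ hd.le
    rw [hβ, regAbs_of_eq_zero hε h0]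
    linarith
  set A : Set Plane := {x | s ≤ β x ∧ β x < s'} with hA
  have hAm : MeasurableSet A :=
    (measurableSet_le measurable_const hβc.measurable).inter (measurableSet_lt hβc.measurable measurable_const)
  have hDc : Continuous fun x => ‖fderiv ℝ ψ x‖ := (hψ.continuous_fderiv one_ne_zero).norm
  have hDs : HasCompactSupport fun x => ‖fderiv ℝ ψ x‖ := (hψc.fderiv (𝕜 := ℝ)).norm
  have hDi : Integrable fun x => ‖fderiv ℝ ψ x‖ ^ 2 := by
    apply (hDc.pow 2).integrable_of_hasCompactSupport
    refine hDs.mono fun x hx h0 => hx ?_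
    simp only [Pi.pow_apply, h0]
    norm_num
  have hTd : ∀ x, ‖fderiv ℝ T x‖ ≤ A.indicator (fun x => L / (s' - s) * ‖fderiv ℝ ψ x‖) x := by
    intro x
    have hq : HasFDerivAt (fun x => (β x - s) / (s' - s)) ((s' - s)⁻¹ • fderiv ℝ β x) x := by
      simpa only [div_eq_mul_inv] using
        ((hβ1.differentiable one_ne_zero x).hasFDerivAt.sub_const s).mul_const (s' - s)⁻¹
    have h0 : HasDerivAt Real.smoothTransition (deriv Real.smoothTransition ((β x - s) / (s' - s)))
        ((β x - s) / (s' - s)) :=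
      ((Real.smoothTransition.contDiff (n := 1)).differentiable one_ne_zero _).hasDerivAt
    have h1 : HasFDerivAt T (deriv Real.smoothTransition ((β x - s) / (s' - s)) •
        ((s' - s)⁻¹ • fderiv ℝ β x)) x :=
      HasDerivAt.comp_hasFDerivAt (h₂ := Real.smoothTransition) x h0 hq
    rw [h1.fderiv, norm_smul, norm_smul, Real.norm_eq_abs, Real.norm_eq_abs, abs_of_pos (inv_pos.2 hd)]
    by_cases hx : x ∈ A
    · rw [Set.indicator_of_mem hx, div_mul_eq_mul_div, mul_div_assoc]
      gcongr
      · exact (hLd _).1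
      · rw [div_eq_inv_mul]
        gcongr
        exact norm_fderiv_regAbs_le hψ hε x
    · rw [Set.indicator_of_notMem hx, (hLd _).2]
      · simp
      · intro hmem
        apply hx
        rw [Set.mem_Ioo, lt_div_iff₀ hd, div_lt_iff₀ hd] at hmem
        constructor <;> linarith [hmem.1, hmem.2]
  have hms : volume {x | s ≤ β x} < ⊤ := by
    refine lt_of_le_of_lt (measure_mono ?_) hψc.isCompact.measure_lt_top
    intro x hx
    by_contra h
    have h0 : ψ x = 0 := image_eq_zero_of_notMem_tsupport h
    have : s ≤ β x := hx
    rw [hβ, regAbs_of_eq_zero hε h0] at this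
    linarith
  have hAfin : volume A < ⊤ := lt_of_le_of_lt (measure_mono fun x hx => hx.1) hms
  have hL1 : ∫⁻ x, ‖fderiv ℝ T x‖ₑ ≤ ENNReal.ofReal (L / (s' - s) * ∫ x in A, ‖fderiv ℝ ψ x‖) := by
    rw [← integral_const_mul, ← integral_indicator hAm, ofReal_integral_eq_lintegral_ofReal]
    · refine lintegral_mono fun x => ?_
      rw [← ofReal_norm]
      exact ENNReal.ofReal_le_ofReal (hTd x)
    · exact ((hDc.integrable_of_hasCompactSupport hDs).const_mul _).indicator hAm
    · refine Eventually.of_forall fun x => ?_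
      apply Set.indicator_nonneg
      intro x _
      positivity
  -- Cauchy-Schwarz brings in the measure of the band, which is at most that of the lower superlevel
  -- set; this makes the estimate recursive.
  have hCS : (∫ x in A, ‖fderiv ℝ ψ x‖) ^ 2 ≤ (∫ x in A, ‖fderiv ℝ ψ x‖ ^ 2) * volume.real A := by
    have h1 := integral_mul_le_Lp_mul_Lq_of_nonneg (μ := volume.restrict A) Real.HolderConjugate.two_two
      (f := fun x => ‖fderiv ℝ ψ x‖) (g := fun _ => (1 : ℝ)) (Eventually.of_forall fun x => norm_nonneg _)
      (Eventually.of_forall fun x => zero_le_one)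
      (by
        simpa using (hDc.memLp_of_hasCompactSupport hDs (p := 2) (μ := volume)).restrict A)
      (by
        have : IsFiniteMeasure (volume.restrict A) := ⟨by simpa using hAfin⟩
        exact memLp_const _)
    simp only [mul_one, Real.rpow_ofNat, one_pow, integral_const, smul_eq_mul, measureReal_restrict_apply_univ] at h1
    calc (∫ x in A, ‖fderiv ℝ ψ x‖) ^ 2 ≤
          ((∫ x in A, ‖fderiv ℝ ψ x‖ ^ 2) ^ (1 / 2 : ℝ) * volume.real A ^ (1 / 2 : ℝ)) ^ 2 :=
          pow_le_pow_left₀ (by positivity) h1 2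
      _ = _ := by
        rw [mul_pow, ← Real.sqrt_eq_rpow, ← Real.sqrt_eq_rpow, Real.sq_sqrt (by positivity), Real.sq_sqrt (by positivity)]
  have hE : (∫ x in {x | β x < s'}, ‖fderiv ℝ ψ x‖ ^ 2) - ∫ x in {x | β x < s}, ‖fderiv ℝ ψ x‖ ^ 2 =
      ∫ x in A, ‖fderiv ℝ ψ x‖ ^ 2 := by
    have hu : {x | β x < s'} = {x | β x < s} ∪ A := by
      ext x
      simp only [hA, Set.mem_ofPred_eq, Set.mem_union]
      constructor
      · intro h
        rcases lt_or_ge (β x) s with h' | h'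
        · exact Or.inl h'
        · exact Or.inr ⟨h', h⟩
      · rintro (h | h)
        · exact h.trans hs'
        · exact h.2
    have hdis : Disjoint {x | β x < s} A := by
      rw [Set.disjoint_left]
      intro x hx hx'
      exact absurd hx'.1 (not_le.2 hx)
    rw [hu, setIntegral_union hdis hAm hDi.integrableOn hDi.integrableOn]
    ring
  have hlow : volume {x | s' ≤ β x} ≤ ∫⁻ x, ‖T x‖ₑ ^ 2 := by
    have hm : MeasurableSet {x | s' ≤ β x} := measurableSet_le measurable_const hβc.measurable
    rw [← lintegral_indicator_one hm]
    refine lintegral_mono fun x => ?_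
    by_cases hx : x ∈ {x | s' ≤ β x}
    · rw [Set.indicator_of_mem hx]
      have : T x = 1 := by
        apply Real.smoothTransition.one_of_one_le
        rw [le_div_iff₀ hd]
        have : s' ≤ β x := hx
        linarith
      rw [this]; simp
    · rw [Set.indicator_of_notMem hx]; exact zero_le
  have hfinal := hlow.trans (hC0 T hT1 hTc)
  have h2 : volume {x | s' ≤ β x} ≤
      ENNReal.ofReal ((C0 * (L / (s' - s) * ∫ x in A, ‖fderiv ℝ ψ x‖)) ^ 2) := by
    refine hfinal.trans ?_
    rw [ENNReal.ofReal_pow (by positivity), ENNReal.ofReal_mul (by positivity), ENNReal.ofReal_coe_nnreal]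
    gcongr
  have h3 := ENNReal.toReal_mono ENNReal.ofReal_ne_top h2
  rw [ENNReal.toReal_ofReal (by positivity)] at h3
  rw [hE]
  have hI0 : 0 ≤ ∫ x in A, ‖fderiv ℝ ψ x‖ ^ 2 := by positivity
  have hmA : volume.real A ≤ volume.real {x | s ≤ β x} :=
    ENNReal.toReal_mono hms.ne (measure_mono fun x hx => hx.1)
  calc (s' - s) ^ 2 * volume.real {x | s' ≤ β x}
      ≤ (s' - s) ^ 2 * (C0 * (L / (s' - s) * ∫ x in A, ‖fderiv ℝ ψ x‖)) ^ 2 := by gcongr; exact h3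
    _ = (C0 * L) ^ 2 * (∫ x in A, ‖fderiv ℝ ψ x‖) ^ 2 := by field_simp
    _ ≤ (C0 * L) ^ 2 * ((∫ x in A, ‖fderiv ℝ ψ x‖ ^ 2) * volume.real A) := by gcongr
    _ ≤ ((C0 * L) ^ 2 + 1) * ((∫ x in A, ‖fderiv ℝ ψ x‖ ^ 2) * volume.real {x | s ≤ β x}) := by
      gcongr; linarith
    _ = _ := by ring

theorem prod_le_mean_pow {n : ℕ} (hn : 0 < n) (a : ℕ → ℝ) (ha : ∀ i, 0 ≤ a i) :
    ∏ i ∈ Finset.range n, a i ≤ ((∑ i ∈ Finset.range n, a i) / n) ^ n := by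
  have hn' : (n : ℝ) ≠ 0 := by positivity
  have h := Real.geom_mean_le_arith_mean (Finset.range n) (fun _ => 1) a (fun _ _ => zero_le_one)
    (by simpa using hn) (fun i _ => ha i)
  simp only [Real.rpow_one, Finset.sum_const, Finset.card_range, nsmul_eq_mul, mul_one, one_mul] at h
  have hP : 0 ≤ ∏ i ∈ Finset.range n, a i := Finset.prod_nonneg fun i _ => ha i
  calc ∏ i ∈ Finset.range n, a i = ((∏ i ∈ Finset.range n, a i) ^ (n : ℝ)⁻¹) ^ n := by
        rw [← Real.rpow_natCast, ← Real.rpow_mul hP, inv_mul_cancel₀ hn', Real.rpow_one]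
    _ ≤ _ := by gcongr

theorem setIntegral_regAbs_mono (hψ : ContDiff ℝ 1 ψ) (hψc : HasCompactSupport ψ) {a b : ℝ}
    (hab : a ≤ b) : (∫ x in {x | regAbs ψ ε x < a}, ‖fderiv ℝ ψ x‖ ^ 2) ≤
      ∫ x in {x | regAbs ψ ε x < b}, ‖fderiv ℝ ψ x‖ ^ 2 := by
  have hi : Integrable fun x => ‖fderiv ℝ ψ x‖ ^ 2 := by
    apply ((hψ.continuous_fderiv one_ne_zero).norm.pow 2).integrable_of_hasCompactSupport
    refine (hψc.fderiv (𝕜 := ℝ)).mono fun x hx h0 => hx ?_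
    simp [h0]
  refine setIntegral_mono_set hi.integrableOn (Eventually.of_forall fun x => by positivity) ?_
  exact (show {x | regAbs ψ ε x < a} ⊆ {x | regAbs ψ ε x < b} from fun x hx => lt_of_lt_of_le hx hab).eventuallyLE

/-- Iterating the level estimate over `n` equidistant levels between `s / 2` and `s`. -/
theorem exists_iterate_level_le : ∃ C : ℝ, 0 < C ∧ ∀ (ψ : Plane → ℂ), ContDiff ℝ 1 ψ → HasCompactSupport ψ →
    ∀ ε s : ℝ, 0 < ε → 2 * ε < s → ∀ n : ℕ, 0 < n →
    volume.real {x | s ≤ regAbs ψ ε x} ≤ (C * (∫ x, ‖fderiv ℝ ψ x‖ ^ 2) * n / s ^ 2) ^ n *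
      volume.real {x | s / 2 ≤ regAbs ψ ε x} := by
  obtain ⟨C, hC, h⟩ := exists_level_le
  refine ⟨4 * C, by positivity, fun ψ hψ hψc ε s hε hs n hn => ?_⟩
  have hn0 : (0 : ℝ) < n := by exact_mod_cast hn
  have hs0 : 0 < s := by linarith
  set d : ℝ := s / (2 * n) with hd
  have hd0 : 0 < d := by positivity
  set l : ℕ → ℝ := fun k => s / 2 + k * d with hl
  set m : ℕ → ℝ := fun k => volume.real {x | l k ≤ regAbs ψ ε x} with hm
  set E : ℕ → ℝ := fun k => ∫ x in {x | regAbs ψ ε x < l k}, ‖fderiv ℝ ψ x‖ ^ 2 with hE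
  have hlk : ∀ k, l (k + 1) - l k = d := by intro k; simp only [hl]; push_cast; ring
  have hE1 : ∀ k, 0 ≤ E (k + 1) - E k := fun k =>
    sub_nonneg.2 (setIntegral_regAbs_mono hψ hψc (by linarith [hlk k]))
  have hstep : ∀ k, d ^ 2 * m (k + 1) ≤ C * (E (k + 1) - E k) * m k := by
    intro k
    have h1 := h ψ hψ hψc ε (l k) (l (k + 1)) hε
      (by
        have : 0 ≤ k * d := by positivity
        simp only [hl]; linarith) (by linarith [hlk k])
    rwa [hlk] at h1
  have hprod : ∀ k, (d ^ 2) ^ k * m k ≤ C ^ k * (∏ i ∈ Finset.range k, (E (i + 1) - E i)) * m 0 := by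
    intro k
    induction k with
    | zero => simp
    | succ k ih =>
      rw [Finset.prod_range_succ]
      calc (d ^ 2) ^ (k + 1) * m (k + 1) = (d ^ 2) ^ k * (d ^ 2 * m (k + 1)) := by ring
        _ ≤ (d ^ 2) ^ k * (C * (E (k + 1) - E k) * m k) := by gcongr ?_ * ?_; exact hstep k
        _ = C * (E (k + 1) - E k) * ((d ^ 2) ^ k * m k) := by ring
        _ ≤ C * (E (k + 1) - E k) * (C ^ k * (∏ i ∈ Finset.range k, (E (i + 1) - E i)) * m 0) := by
          have := hE1 k
          gcongr
        _ = _ := by ring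
  have hi : Integrable fun x => ‖fderiv ℝ ψ x‖ ^ 2 := by
    apply ((hψ.continuous_fderiv one_ne_zero).norm.pow 2).integrable_of_hasCompactSupport
    refine (hψc.fderiv (𝕜 := ℝ)).mono fun x hx h0 => hx ?_
    simp [h0]
  set D : ℝ := ∫ x, ‖fderiv ℝ ψ x‖ ^ 2 with hD
  -- The energies of the n bands telescope to at most the Dirichlet integral D, so by the
  -- arithmetic-geometric mean inequality their product is at most (D / n)^n.
  have hsum : ∑ i ∈ Finset.range n, (E (i + 1) - E i) ≤ D := by
    rw [Finset.sum_range_sub]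
    have h1 : E n ≤ D := setIntegral_le_integral hi (Eventually.of_forall fun x => by positivity)
    have h2 : 0 ≤ E 0 := by simp only [hE]; positivity
    linarith
  have hsum0 : 0 ≤ ∑ i ∈ Finset.range n, (E (i + 1) - E i) := Finset.sum_nonneg fun i _ => hE1 i
  have hm0 : m 0 = volume.real {x | s / 2 ≤ regAbs ψ ε x} := by simp [hm, hl]
  have hmn : m n = volume.real {x | s ≤ regAbs ψ ε x} := by
    have : l n = s := by simp only [hl, hd]; field_simp; ring
    simp only [hm, this]
  have hmm : 0 ≤ m 0 := by rw [hm0]; positivity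
  have h3 : (d ^ 2) ^ n * m n ≤ C ^ n * (D / n) ^ n * m 0 := by
    refine (hprod n).trans ?_
    gcongr
    refine (prod_le_mean_pow hn _ hE1).trans ?_
    gcongr
  rw [← hmn, ← hm0]
  have h4 : m n ≤ (C * (D / n)) ^ n / (d ^ 2) ^ n * m 0 := by
    rw [div_mul_eq_mul_div, le_div_iff₀ (by positivity), mul_pow]
    linarith
  refine h4.trans (le_of_eq ?_)
  rw [← div_pow]
  congr 2
  rw [hd]
  field_simp
  ring

/-- Gaussian decay of the distribution function. -/
theorem exists_gaussian_decay : ∃ c : ℝ, 0 < c ∧ ∀ (ψ : Plane → ℂ), ContDiff ℝ 1 ψ → HasCompactSupport ψ →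
    ∀ a : ℝ, 0 < a → a * (∫ x, ‖fderiv ℝ ψ x‖ ^ 2) ≤ c → ∀ s : ℝ, 0 < s →
    volume.real {x | s ≤ ‖ψ x‖} ≤ Real.exp 1 * Real.exp (-(a * s ^ 2)) *
      volume.real {x | s / 4 ≤ ‖ψ x‖} := by
  obtain ⟨C, hC, h⟩ := exists_iterate_level_le
  -- With about a s² levels, this constant makes each factor of the iteration at most 1 / e.
  -- Rounding the number of levels down costs the factor e in the conclusion.
  refine ⟨1 / (C * Real.exp 1), by positivity, fun ψ hψ hψc a ha hD s hs => ?_⟩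
  have hfin : ∀ t : ℝ, 0 < t → volume {x | t ≤ ‖ψ x‖} < ⊤ := by
    intro t ht
    refine lt_of_le_of_lt (measure_mono ?_) hψc.isCompact.measure_lt_top
    intro x hx
    by_contra h0
    have h0 : ψ x = 0 := image_eq_zero_of_notMem_tsupport h0
    have : t ≤ ‖ψ x‖ := hx
    rw [h0, norm_zero] at this
    linarith
  -- A regularized modulus of at least s / 2 then forces |ψ|² ≥ s² / 4 - s² / 16, hence |ψ| ≥ s / 4.
  set ε := s / 4 with hε
  have hε0 : 0 < ε := by positivity
  set n : ℕ := ⌊a * s ^ 2⌋₊ with hn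
  have hn1 : (n : ℝ) ≤ a * s ^ 2 := Nat.floor_le (by positivity)
  have hn2 : a * s ^ 2 < n + 1 := Nat.lt_floor_add_one _
  have hsub2 : {x | s / 2 ≤ regAbs ψ ε x} ⊆ {x | s / 4 ≤ ‖ψ x‖} := by
    intro x hx
    have h1 : s / 2 ≤ Real.sqrt (‖ψ x‖ ^ 2 + ε ^ 2) := hx
    rw [Real.le_sqrt' (by positivity)] at h1
    refine abs_le_of_sq_le_sq' ?_ (norm_nonneg _) |>.2
    rw [hε] at h1
    nlinarith
  have hsub1 : {x | s ≤ ‖ψ x‖} ⊆ {x | s ≤ regAbs ψ ε x} := by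
    intro x hx
    have h1 : s ≤ ‖ψ x‖ := hx
    exact h1.trans (Real.le_sqrt_of_sq_le (by nlinarith [sq_nonneg ε]))
  have hfin2 : volume {x | s ≤ regAbs ψ ε x} ≠ ⊤ :=
    (lt_of_le_of_lt (measure_mono ((show {x | s ≤ regAbs ψ ε x} ⊆ {x | s / 2 ≤ regAbs ψ ε x} from
      fun x hx => le_trans (by linarith) (show s ≤ regAbs ψ ε x from hx)).trans hsub2)) (hfin _ (by positivity))).ne
  have m1 : volume.real {x | s ≤ ‖ψ x‖} ≤ volume.real {x | s ≤ regAbs ψ ε x} :=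
    ENNReal.toReal_mono hfin2 (measure_mono hsub1)
  have m2 : volume.real {x | s / 2 ≤ regAbs ψ ε x} ≤ volume.real {x | s / 4 ≤ ‖ψ x‖} :=
    ENNReal.toReal_mono (hfin _ (by positivity)).ne (measure_mono hsub2)
  have key : volume.real {x | s ≤ ‖ψ x‖} ≤ Real.exp (-n) * volume.real {x | s / 4 ≤ ‖ψ x‖} := by
    rcases Nat.eq_zero_or_pos n with h0 | hpos
    · rw [h0]
      simp only [Nat.cast_zero, neg_zero, Real.exp_zero, one_mul]
      refine ENNReal.toReal_mono (hfin _ (by positivity)).ne (measure_mono fun x hx => ?_)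
      exact le_trans (by linarith) (show s ≤ ‖ψ x‖ from hx)
    · refine m1.trans ((h ψ hψ hψc ε s hε0 (by rw [hε]; linarith) n hpos).trans ?_)
      have hq : C * (∫ x, ‖fderiv ℝ ψ x‖ ^ 2) * n / s ^ 2 ≤ Real.exp (-1) := by
        have hD0 : 0 ≤ ∫ x, ‖fderiv ℝ ψ x‖ ^ 2 := by positivity
        rw [div_le_iff₀ (by positivity)]
        rw [le_div_iff₀ (by positivity)] at hD
        have h5 : Real.exp (-1) * Real.exp 1 = 1 := by rw [← Real.exp_add]; simp
        calc C * (∫ x, ‖fderiv ℝ ψ x‖ ^ 2) * n ≤ C * (∫ x, ‖fderiv ℝ ψ x‖ ^ 2) * (a * s ^ 2) := by gcongr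
          _ = Real.exp (-1) * Real.exp 1 * (C * (∫ x, ‖fderiv ℝ ψ x‖ ^ 2) * (a * s ^ 2)) := by rw [h5]; ring
          _ = Real.exp (-1) * s ^ 2 * (a * (∫ x, ‖fderiv ℝ ψ x‖ ^ 2) * (C * Real.exp 1)) := by ring
          _ ≤ Real.exp (-1) * s ^ 2 * 1 := by gcongr
          _ = _ := by ring
      have hexp : Real.exp (-n) = Real.exp (-1) ^ n := by
        rw [← Real.exp_nat_mul, mul_neg_one]
      rw [hexp]
      gcongr
  refine key.trans ?_
  gcongr
  rw [← Real.exp_add]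
  apply Real.exp_le_exp.2
  linarith

end levels

theorem integral_two_mul_exp (a s : ℝ) :
    ∫ t in (0 : ℝ)..s, 2 * a * t * Real.exp (a * t ^ 2) = Real.exp (a * s ^ 2) - 1 := by
  rw [intervalIntegral.integral_eq_sub_of_hasDerivAt (f := fun t => Real.exp (a * t ^ 2))]
  · simp
  · intro t _
    refine ((hasDerivAt_pow 2 t).const_mul a).exp.congr_deriv ?_
    simp only [Nat.cast_ofNat, Nat.add_one_sub_one, pow_one]
    ring
  · apply Continuous.intervalIntegrable; fun_prop

/-- A weak form of the Moser-Trudinger inequality for smooth functions. -/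
theorem exists_moser_trudinger_smooth : ∃ c : ℝ, 0 < c ∧ ∃ C : ℝ, 0 < C ∧
    ∀ (ψ : Plane → ℂ), ContDiff ℝ 1 ψ → HasCompactSupport ψ →
    ∀ a : ℝ, 0 < a → a * (∫ x, ‖fderiv ℝ ψ x‖ ^ 2) ≤ c →
    ∫⁻ x, ENNReal.ofReal (Real.exp (a * ‖ψ x‖ ^ 2) - 1) ≤
      ENNReal.ofReal (C * a) * ∫⁻ x, ENNReal.ofReal (‖ψ x‖ ^ 2) := by
  obtain ⟨c, hc, h⟩ := exists_gaussian_decay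
  -- The level t / 4 in the Gaussian decay amounts to replacing |ψ| by 4|ψ|, whose square gives 16.
  refine ⟨c, hc, 16 * Real.exp 1, by positivity, fun ψ hψ hψc a ha hD => ?_⟩
  have hmeas : AEMeasurable (fun x => ‖ψ x‖) := hψ.continuous.norm.measurable.aemeasurable
  have h1 := lintegral_comp_eq_lintegral_meas_le_mul (μ := (volume : Measure Plane)) (f := fun x => ‖ψ x‖)
    (g := fun t => 2 * a * t * Real.exp (a * t ^ 2)) (Eventually.of_forall fun x => norm_nonneg _) hmeas
    (fun t _ => by apply Continuous.intervalIntegrable; fun_prop)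
    (by
      filter_upwards [ae_restrict_mem measurableSet_Ioi] with t ht
      have : (0 : ℝ) < t := ht
      positivity)
  have h2 := lintegral_comp_eq_lintegral_meas_le_mul (μ := (volume : Measure Plane)) (f := fun x => 4 * ‖ψ x‖)
    (g := fun t => 2 * t) (Eventually.of_forall fun x => by positivity) (hmeas.const_mul 4)
    (fun t _ => by apply Continuous.intervalIntegrable; fun_prop)
    (by
      filter_upwards [ae_restrict_mem measurableSet_Ioi] with t ht
      have : (0 : ℝ) < t := ht
      positivity)
  simp only [integral_two_mul_exp] at h1
  have e2 : ∀ s : ℝ, ∫ t in (0 : ℝ)..s, 2 * t = s ^ 2 := by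
    intro s; rw [intervalIntegral.integral_const_mul, integral_id]; ring
  simp only [e2] at h2
  have e3 : ∫⁻ x, ENNReal.ofReal ((4 * ‖ψ x‖) ^ 2) =
      ENNReal.ofReal 16 * ∫⁻ x, ENNReal.ofReal (‖ψ x‖ ^ 2) := by
    rw [← lintegral_const_mul' _ _ ENNReal.ofReal_ne_top]
    apply lintegral_congr; intro x
    rw [← ENNReal.ofReal_mul (by norm_num)]; ring_nf
  rw [h1]
  have e4 : ENNReal.ofReal (16 * Real.exp 1 * a) * ∫⁻ x, ENNReal.ofReal (‖ψ x‖ ^ 2) =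
      ENNReal.ofReal (Real.exp 1 * a) * ∫⁻ x, ENNReal.ofReal ((4 * ‖ψ x‖) ^ 2) := by
    rw [e3, ← mul_assoc, ← ENNReal.ofReal_mul (by positivity)]; ring_nf
  rw [e4, h2, ← lintegral_const_mul']
  swap
  · simp
  -- In the layer-cake formula the Gaussian decay of the distribution function cancels the
  -- exponential growth level by level.
  refine setLIntegral_mono' measurableSet_Ioi fun t ht => ?_
  have ht0 : (0 : ℝ) < t := ht
  have hfin : ∀ t : ℝ, 0 < t → volume {x | t ≤ ‖ψ x‖} ≠ ⊤ := by
    intro t ht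
    refine (lt_of_le_of_lt (measure_mono ?_) hψc.isCompact.measure_lt_top).ne
    intro x hx
    by_contra h0
    have h0 : ψ x = 0 := image_eq_zero_of_notMem_tsupport h0
    have : t ≤ ‖ψ x‖ := hx
    rw [h0, norm_zero] at this
    linarith
  have e5 : {x | t ≤ 4 * ‖ψ x‖} = {x | t / 4 ≤ ‖ψ x‖} := by
    ext x
    simp only [Set.mem_ofPred_eq]
    rw [div_le_iff₀ (by norm_num), mul_comm]
  rw [e5, ← ENNReal.ofReal_toReal (hfin t ht0), ← ENNReal.ofReal_toReal (hfin (t / 4) (by positivity)),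
    ← ENNReal.ofReal_mul (by positivity), ← ENNReal.ofReal_mul (by positivity), ← ENNReal.ofReal_mul (by positivity)]
  apply ENNReal.ofReal_le_ofReal
  have h6 := h ψ hψ hψc a ha hD t ht0
  have h7 : Real.exp (-(a * t ^ 2)) * Real.exp (a * t ^ 2) = 1 := by rw [← Real.exp_add]; simp
  calc (volume {x | t ≤ ‖ψ x‖}).toReal * (2 * a * t * Real.exp (a * t ^ 2))
      ≤ (Real.exp 1 * Real.exp (-(a * t ^ 2)) * (volume {x | t / 4 ≤ ‖ψ x‖}).toReal) *
        (2 * a * t * Real.exp (a * t ^ 2)) := by gcongr; exact h6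
    _ = (Real.exp (-(a * t ^ 2)) * Real.exp (a * t ^ 2)) *
        (Real.exp 1 * a * ((volume {x | t / 4 ≤ ‖ψ x‖}).toReal * (2 * t))) := by ring
    _ = _ := by rw [h7, one_mul]

theorem L2C.lintegral_sq (v : L2C) : ∫⁻ x, ENNReal.ofReal (‖v x‖ ^ 2) = ENNReal.ofReal (‖v‖ ^ 2) := by
  have h1 : ‖v‖ ^ 2 = ∫ x, ‖v x‖ ^ 2 := by
    rw [← @real_inner_self_eq_norm_sq, L2.inner_def]
    simp
  rw [h1, ofReal_integral_eq_lintegral_ofReal]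
  · exact (memLp_two_iff_integrable_sq_norm (Lp.memLp v).1).1 (Lp.memLp v)
  · exact Eventually.of_forall fun x => by positivity

/-- The operator norm is at most the Hilbert-Schmidt norm. -/
theorem norm_fderiv_sq_le (L : Plane →L[ℝ] ℂ) :
    ‖L‖ ^ 2 ≤ ∑ j, ‖L (EuclideanSpace.single j 1)‖ ^ 2 := by
  have h : ‖L‖ ≤ Real.sqrt (∑ j, ‖L (EuclideanSpace.single j 1)‖ ^ 2) := by
    refine ContinuousLinearMap.opNorm_le_bound _ (Real.sqrt_nonneg _) fun x => ?_
    have hx : x = ∑ j, x j • EuclideanSpace.single j (1 : ℝ) := by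
      ext i
      fin_cases i <;> simp
    have h1 : ‖L x‖ ≤ ∑ j, |x j| * ‖L (EuclideanSpace.single j 1)‖ := by
      conv_lhs => rw [hx]
      rw [map_sum]
      refine (norm_sum_le _ _).trans (le_of_eq ?_)
      congr 1; ext j
      rw [map_smul, norm_smul, Real.norm_eq_abs]
    refine h1.trans ((Real.sum_mul_le_sqrt_mul_sqrt _ _ _).trans (le_of_eq ?_))
    rw [mul_comm, EuclideanSpace.norm_eq]
    simp
  calc ‖L‖ ^ 2 ≤ (Real.sqrt (∑ j, ‖L (EuclideanSpace.single j 1)‖ ^ 2)) ^ 2 := by gcongr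
    _ = _ := Real.sq_sqrt (by positivity)

/-- A weak form of the Moser-Trudinger inequality in `H¹`. -/
theorem exists_moser_trudinger : ∃ c : ℝ, 0 < c ∧ ∃ C : ℝ, 0 < C ∧
    ∀ (v : L2C) (g : Fin 2 → L2C), HasGrad v g → ∀ a : ℝ, 0 < a → a * ∑ j, ‖g j‖ ^ 2 < c →
    ∫⁻ x, ENNReal.ofReal (Real.exp (a * ‖v x‖ ^ 2) - 1) ≤ ENNReal.ofReal (C * a * ‖v‖ ^ 2) := by
  obtain ⟨c, hc, C, hC, h⟩ := exists_moser_trudinger_smooth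
  refine ⟨c, hc, C, hC, fun v g hvg a ha hD => ?_⟩
  obtain ⟨ψ, V, G, hψ, hψc, hV, hG, -, hVt, hGt⟩ := hvg.exists_approx
  obtain ⟨ns, hns, hae⟩ := exists_subseq_ae hVt
  have hgrad : ∀ n, ∫ x, ‖fderiv ℝ (ψ n) x‖ ^ 2 ≤ ∑ j, ‖G n j‖ ^ 2 := by
    intro n
    have hsq : ∀ w : L2C, ‖w‖ ^ 2 = ∫ x, ‖w x‖ ^ 2 := by
      intro w
      rw [← @real_inner_self_eq_norm_sq, L2.inner_def]
      simp
    have hi : ∀ w : L2C, Integrable fun x => ‖w x‖ ^ 2 := fun w =>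
      (memLp_two_iff_integrable_sq_norm (Lp.memLp w).1).1 (Lp.memLp w)
    simp only [hsq]
    rw [← integral_finsetSum _ (fun j _ => hi _)]
    refine integral_mono_of_nonneg (Eventually.of_forall fun x => by positivity)
      (integrable_finsetSum _ fun j _ => hi _) ?_
    filter_upwards [hG n 0, hG n 1] with x h0 h1
    refine (norm_fderiv_sq_le _).trans (le_of_eq ?_)
    simp only [Fin.sum_univ_two, h0, h1]
  have hGlim : Tendsto (fun n => a * ∑ j, ‖G n j‖ ^ 2) atTop (𝓝 (a * ∑ j, ‖g j‖ ^ 2)) :=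
    (tendsto_finsetSum _ fun j _ => ((hGt j).norm.pow 2)).const_mul a
  -- The hypothesis is strict, so the approximants satisfy it for large n; Fatou along an almost
  -- everywhere convergent subsequence concludes.
  have hev : ∀ᶠ n in atTop, ∫⁻ x, ENNReal.ofReal (Real.exp (a * ‖V n x‖ ^ 2) - 1) ≤
      ENNReal.ofReal (C * a * ‖V n‖ ^ 2) := by
    filter_upwards [hGlim.eventually (gt_mem_nhds hD)] with n hn
    have h1 := h (ψ n) ((hψ n).of_le (by simp)) (hψc n) a ha
      ((mul_le_mul_of_nonneg_left (hgrad n) ha.le).trans hn.le)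
    have e1 : ∫⁻ x, ENNReal.ofReal (Real.exp (a * ‖V n x‖ ^ 2) - 1) =
        ∫⁻ x, ENNReal.ofReal (Real.exp (a * ‖ψ n x‖ ^ 2) - 1) := by
      apply lintegral_congr_ae
      filter_upwards [hV n] with x hx
      rw [hx]
    have e2 : ∫⁻ x, ENNReal.ofReal (‖ψ n x‖ ^ 2) = ENNReal.ofReal (‖V n‖ ^ 2) := by
      rw [← L2C.lintegral_sq]
      apply lintegral_congr_ae
      filter_upwards [hV n] with x hx
      rw [hx]
    rw [e1, ENNReal.ofReal_mul (by positivity), ← e2]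
    exact h1
  have hlim : Tendsto (fun i => ENNReal.ofReal (C * a * ‖V (ns i)‖ ^ 2)) atTop
      (𝓝 (ENNReal.ofReal (C * a * ‖v‖ ^ 2))) :=
    ENNReal.tendsto_ofReal (((hVt.comp hns.tendsto_atTop).norm.pow 2).const_mul (C * a))
  have hcont : Continuous fun z : ℂ => ENNReal.ofReal (Real.exp (a * ‖z‖ ^ 2) - 1) :=
    ENNReal.continuous_ofReal.comp (by fun_prop)
  calc ∫⁻ x, ENNReal.ofReal (Real.exp (a * ‖v x‖ ^ 2) - 1)
      = ∫⁻ x, liminf (fun i => ENNReal.ofReal (Real.exp (a * ‖V (ns i) x‖ ^ 2) - 1)) atTop := by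
        apply lintegral_congr_ae
        filter_upwards [hae] with x hx
        exact ((hcont.tendsto _).comp hx).liminf_eq.symm
    _ ≤ liminf (fun i => ∫⁻ x, ENNReal.ofReal (Real.exp (a * ‖V (ns i) x‖ ^ 2) - 1)) atTop :=
        lintegral_liminf_le' fun i => hcont.measurable.comp_aemeasurable (Lp.memLp _).1.aemeasurable
    _ ≤ liminf (fun i => ENNReal.ofReal (C * a * ‖V (ns i)‖ ^ 2)) atTop :=
        liminf_le_liminf (hns.tendsto_atTop.eventually hev)
    _ = _ := hlim.liminf_eq

/-! ### Pointwise estimates for the nonlinearity and the potential. -/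

/-- The exponential weight controlling differences of the nonlinearity. -/
def expWeight (z : ℂ) : ℝ := Real.exp (12 * Real.pi * ‖z‖ ^ 2) - 1

theorem expWeight_nonneg (z : ℂ) : 0 ≤ expWeight z :=
  sub_nonneg.2 (Real.one_le_exp (by positivity))

theorem continuous_expWeight : Continuous expWeight := by unfold expWeight; fun_prop

theorem expWeight_mono {z w : ℂ} (h : ‖z‖ ≤ ‖w‖) : expWeight z ≤ expWeight w := by
  unfold expWeight; gcongr

/-- From y^n + 1 ≤ (y + 1)^n. It turns powers of `expWeight` into exponential integrals. -/
theorem exp_sub_one_pow_le {x : ℝ} (hx : 0 ≤ x) {n : ℕ} (hn : n ≠ 0) :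
    (Real.exp x - 1) ^ n ≤ Real.exp (n * x) - 1 := by
  have key : ∀ (y : ℝ), 0 ≤ y → ∀ m : ℕ, y ^ (m + 1) + 1 ≤ (y + 1) ^ (m + 1) := by
    intro y hy m
    induction m with
    | zero => simp
    | succ m ih =>
      calc y ^ (m + 1 + 1) + 1 ≤ (y ^ (m + 1) + 1) * (y + 1) := by
            have : 0 ≤ y ^ (m + 1) := by positivity
            ring_nf at this ⊢
            nlinarith
        _ ≤ (y + 1) ^ (m + 1) * (y + 1) := by gcongr
        _ = _ := by ring
  obtain ⟨m, rfl⟩ := Nat.exists_eq_succ_of_ne_zero hn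
  have h := key (Real.exp x - 1) (sub_nonneg.2 (Real.one_le_exp hx)) m
  rw [sub_add_cancel, ← Real.exp_nat_mul] at h
  exact le_sub_iff_add_le.2 h

/-- The scalar factor of the nonlinearity as a function of `|z|²`. -/
def nlFactor (A : ℝ) : ℝ := Real.exp (4 * Real.pi * A) - 1 - 4 * Real.pi * A

theorem nlFactor_nonneg (A : ℝ) : 0 ≤ nlFactor A := by
  have := Real.add_one_le_exp (4 * Real.pi * A)
  unfold nlFactor; linarith

theorem nonlin_eq (z : ℂ) : nonlin z = (nlFactor (‖z‖ ^ 2) : ℂ) * z := rfl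

theorem continuous_nonlin : Continuous nonlin := by unfold nonlin; fun_prop

theorem hasDerivAt_nlFactor (A : ℝ) :
    HasDerivAt nlFactor (4 * Real.pi * (Real.exp (4 * Real.pi * A) - 1)) A := by
  have h1 : HasDerivAt (fun A : ℝ => 4 * Real.pi * A) (4 * Real.pi) A := by
    simpa using (hasDerivAt_id A).const_mul (4 * Real.pi)
  refine ((h1.exp.sub_const 1).sub h1).congr_deriv ?_
  ring

theorem nlFactor_sub_le {A B : ℝ} (hB : 0 ≤ B) (hBA : B ≤ A) :
    |nlFactor A - nlFactor B| ≤ 4 * Real.pi * (Real.exp (4 * Real.pi * A) - 1) * (A - B) := by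
  have h := Convex.norm_image_sub_le_of_norm_hasDerivWithin_le (f := nlFactor)
    (s := Set.Icc B A) (x := B) (y := A) (C := 4 * Real.pi * (Real.exp (4 * Real.pi * A) - 1))
    (fun x _ => (hasDerivAt_nlFactor x).hasDerivWithinAt)
    (fun x hx => by
      have h0 : 0 ≤ x := hB.trans hx.1
      have h1 : 1 ≤ Real.exp (4 * Real.pi * x) := Real.one_le_exp (by positivity)
      have h2 : Real.exp (4 * Real.pi * x) ≤ Real.exp (4 * Real.pi * A) := by gcongr; exact hx.2
      rw [Real.norm_of_nonneg (by have := Real.pi_pos; have : 0 ≤ Real.exp (4 * Real.pi * x) - 1 := by linarith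
                                  positivity)]
      gcongr) (convex_Icc B A)
    (Set.left_mem_Icc.2 hBA) (Set.right_mem_Icc.2 hBA)
  rwa [Real.norm_eq_abs, Real.norm_of_nonneg (sub_nonneg.2 hBA)] at h

/-- For |w| ≤ |z| the difference is nlFactor(|z|²)(z - w) plus the variation of the factor times w,
bounded by the mean value theorem. With x = 4π|z|² the total is at most (1 + 2x)(exp x - 1) ≤
exp(3x) - 1, which explains the 12π in `expWeight`. -/
theorem norm_nonlin_sub_le (z w : ℂ) :
    ‖nonlin z - nonlin w‖ ≤ ‖z - w‖ * (expWeight z + expWeight w) := by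
  wlog hzw : ‖w‖ ≤ ‖z‖ generalizing z w
  · rw [norm_sub_rev, norm_sub_rev z, add_comm]
    exact this w z (not_le.1 hzw).le
  have hkey : ‖nonlin z - nonlin w‖ ≤ ‖z - w‖ * expWeight z := by
    set A := ‖z‖ ^ 2 with hA
    set B := ‖w‖ ^ 2 with hB
    have hBA : B ≤ A := by rw [hA, hB]; gcongr
    have hB0 : 0 ≤ B := by positivity
    have hA0 : 0 ≤ A := by positivity
    set x := 4 * Real.pi * A with hx
    have hx0 : 0 ≤ x := by positivity
    have e1 : nonlin z - nonlin w = (nlFactor A : ℂ) * (z - w) + ((nlFactor A - nlFactor B : ℝ) : ℂ) * w := by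
      rw [nonlin_eq, nonlin_eq]; push_cast; ring
    have hE : 1 ≤ Real.exp x := Real.one_le_exp hx0
    have h2 : (A - B) * ‖w‖ ≤ 2 * A * ‖z - w‖ := by
      have h3 : ‖z‖ - ‖w‖ ≤ ‖z - w‖ := norm_sub_norm_le z w
      have h4 : A - B = (‖z‖ - ‖w‖) * (‖z‖ + ‖w‖) := by rw [hA, hB]; ring
      rw [h4]
      calc (‖z‖ - ‖w‖) * (‖z‖ + ‖w‖) * ‖w‖ ≤ ‖z - w‖ * (‖z‖ + ‖z‖) * ‖z‖ := by gcongr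
        _ = _ := by rw [hA]; ring
    have h5 : ‖nonlin z - nonlin w‖ ≤ nlFactor A * ‖z - w‖ + (4 * Real.pi * (Real.exp x - 1) * (A - B)) * ‖w‖ := by
      rw [e1]
      refine (norm_add_le _ _).trans ?_
      rw [norm_mul, norm_mul, Complex.norm_real, Complex.norm_real, Real.norm_of_nonneg (nlFactor_nonneg A),
        Real.norm_eq_abs]
      gcongr
      exact nlFactor_sub_le hB0 hBA
    have h6 : nlFactor A ≤ Real.exp x - 1 := by unfold nlFactor; linarith
    have h7 : (1 + 2 * x) * (Real.exp x - 1) ≤ expWeight z := by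
      have h8 : 1 + 2 * x ≤ Real.exp (2 * x) := by linarith [Real.add_one_le_exp (2 * x)]
      have h9 : expWeight z = Real.exp (2 * x) * Real.exp x - 1 := by
        rw [← Real.exp_add, expWeight]; congr 2; rw [hx, hA]; ring
      have h10 : 1 ≤ Real.exp (2 * x) := Real.one_le_exp (by positivity)
      rw [h9]
      nlinarith
    calc ‖nonlin z - nonlin w‖ ≤ _ := h5
      _ ≤ (Real.exp x - 1) * ‖z - w‖ + 4 * Real.pi * (Real.exp x - 1) * (2 * A * ‖z - w‖) := by
        have : 0 ≤ Real.exp x - 1 := by linarith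
        rw [mul_assoc (4 * Real.pi * (Real.exp x - 1))]
        gcongr
      _ = ‖z - w‖ * ((1 + 2 * x) * (Real.exp x - 1)) := by rw [hx]; ring
      _ ≤ _ := by gcongr
  refine hkey.trans ?_
  gcongr
  linarith [expWeight_nonneg w]

theorem norm_nonlin_le (z : ℂ) : ‖nonlin z‖ ≤ ‖z‖ * expWeight z := by
  have h := norm_nonlin_sub_le z 0
  have h0 : nonlin 0 = 0 := by simp [nonlin]
  have h1 : expWeight 0 = 0 := by simp [expWeight]
  rwa [h0, h1, sub_zero, sub_zero, add_zero] at h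

/-- The nonlinearity is half the gradient of the potential; hence the trapezoidal rule below carries
the sum of the two endpoint values, not their mean. -/
theorem hasFDerivAt_potential (z : ℂ) :
    HasFDerivAt potential ((2 : ℝ) • innerSL ℝ (nonlin z)) z := by
  have h1 : HasFDerivAt (fun z : ℂ => ‖z‖ ^ 2) ((2 : ℕ) • (innerSL ℝ z).comp (ContinuousLinearMap.id ℝ ℂ)) z :=
    (hasFDerivAt_id z).norm_sq
  have h2 : HasDerivAt (fun A : ℝ => 1 / (4 * Real.pi) * (Real.exp (4 * Real.pi * A) - 1 - 4 * Real.pi * A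
      - 8 * Real.pi ^ 2 * A ^ 2)) (nlFactor (‖z‖ ^ 2)) (‖z‖ ^ 2) := by
    have h3 : HasDerivAt (fun A : ℝ => 4 * Real.pi * A) (4 * Real.pi) (‖z‖ ^ 2) := by
      simpa using (hasDerivAt_id (‖z‖ ^ 2)).const_mul (4 * Real.pi)
    refine ((((h3.exp.sub_const 1).sub h3).sub ((hasDerivAt_pow 2 (‖z‖ ^ 2)).const_mul
      (8 * Real.pi ^ 2))).const_mul (1 / (4 * Real.pi))).congr_deriv ?_
    have := Real.pi_pos
    simp only [nlFactor, Nat.cast_ofNat, Nat.add_one_sub_one, pow_one]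
    field_simp
    ring
  have h4 := HasDerivAt.comp_hasFDerivAt (h₂ := fun A : ℝ => 1 / (4 * Real.pi) * (Real.exp (4 * Real.pi * A) - 1
    - 4 * Real.pi * A - 8 * Real.pi ^ 2 * A ^ 2)) z h2 h1
  have e : potential = (fun A : ℝ => 1 / (4 * Real.pi) * (Real.exp (4 * Real.pi * A) - 1
    - 4 * Real.pi * A - 8 * Real.pi ^ 2 * A ^ 2)) ∘ fun z : ℂ => ‖z‖ ^ 2 := by
    ext z; simp only [potential, Function.comp]; ring
  rw [e]
  refine h4.congr_fderiv ?_
  ext w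
  simp [nonlin_eq, innerSL_apply_apply]; ring

theorem continuous_potential : Continuous potential :=
  continuous_iff_continuousAt.2 fun z => (hasFDerivAt_potential z).continuousAt

theorem potential_nonneg (z : ℂ) : 0 ≤ potential z := by
  have h := Real.quadratic_le_exp_of_nonneg (x := 4 * Real.pi * ‖z‖ ^ 2) (by positivity)
  unfold potential
  have : 0 ≤ Real.exp (4 * Real.pi * ‖z‖ ^ 2) - 1 - 4 * Real.pi * ‖z‖ ^ 2 - 8 * Real.pi ^ 2 * ‖z‖ ^ 4 := by
    nlinarith
  positivity

theorem potential_le (z : ℂ) : potential z ≤ Real.exp (4 * Real.pi * ‖z‖ ^ 2) - 1 := by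
  have h1 : 0 ≤ Real.exp (4 * Real.pi * ‖z‖ ^ 2) - 1 := sub_nonneg.2 (Real.one_le_exp (by positivity))
  have h2 : 1 / (4 * Real.pi) ≤ 1 := by
    rw [div_le_one (by positivity)]
    linarith [Real.pi_gt_three]
  have h3 : 0 ≤ 4 * Real.pi * ‖z‖ ^ 2 := by positivity
  have h4 : 0 ≤ 8 * Real.pi ^ 2 * ‖z‖ ^ 4 := by positivity
  unfold potential
  calc _ ≤ 1 / (4 * Real.pi) * (Real.exp (4 * Real.pi * ‖z‖ ^ 2) - 1) := by
          refine mul_le_mul_of_nonneg_left ?_ (by positivity)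
          linarith
    _ ≤ 1 * (Real.exp (4 * Real.pi * ‖z‖ ^ 2) - 1) := by gcongr
    _ = _ := one_mul _

/-- Error of the trapezoidal rule on the segment from z to w: 4 from comparison with the tangent at
z, 1 from replacing one value at z by the value at w. The symmetric form is what lets the time
integral collapse in `IsFlow.integral_potDefect_eq`. -/
theorem abs_potential_sub_sub_le (z w : ℂ) :
    |potential w - potential z - inner ℝ (nonlin z + nonlin w) (w - z)| ≤
      5 * (‖w - z‖ ^ 2 * (expWeight z + expWeight w)) := by
  set d := w - z with hd
  set M := expWeight z + expWeight w with hM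
  have hseg : ∀ s ∈ Set.Icc (0 : ℝ) 1, ‖nonlin (z + s • d) - nonlin z‖ ≤ ‖d‖ * (2 * M) := by
    intro s hs
    refine (norm_nonlin_sub_le _ _).trans ?_
    have h1 : ‖z + s • d - z‖ ≤ ‖d‖ := by
      rw [add_sub_cancel_left, norm_smul, Real.norm_of_nonneg hs.1]
      exact mul_le_of_le_one_left (norm_nonneg _) hs.2
    have h2 : ‖z + s • d‖ ≤ max ‖z‖ ‖w‖ := by
      have : z + s • d = (1 - s) • z + s • w := by rw [hd, smul_sub, sub_smul, one_smul]; ring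
      rw [this]
      refine (norm_add_le _ _).trans ?_
      rw [norm_smul, norm_smul, Real.norm_of_nonneg hs.1, Real.norm_of_nonneg (sub_nonneg.2 hs.2)]
      have := le_max_left ‖z‖ ‖w‖
      have := le_max_right ‖z‖ ‖w‖
      nlinarith [hs.1, hs.2]
    have h3 : expWeight (z + s • d) ≤ M := by
      have hz := expWeight_nonneg z
      have hw := expWeight_nonneg w
      rcases le_max_iff.1 h2 with h | h
      · linarith [expWeight_mono h]
      · linarith [expWeight_mono h]
    have h4 : expWeight z ≤ M := by linarith [expWeight_nonneg w]
    have h5 := expWeight_nonneg (z + s • d)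
    have h6 := expWeight_nonneg z
    gcongr
    linarith
  have hM0 : 0 ≤ M := add_nonneg (expWeight_nonneg z) (expWeight_nonneg w)
  have hder : ∀ s : ℝ, HasDerivAt (fun s : ℝ => potential (z + s • d) - s * (2 * inner ℝ (nonlin z) d))
      (2 * inner ℝ (nonlin (z + s • d) - nonlin z) d) s := by
    intro s
    have h1 : HasDerivAt (fun s : ℝ => z + s • d) d s := by
      simpa using ((hasDerivAt_id s).smul_const d).const_add z
    have h2 := (hasFDerivAt_potential (z + s • d)).comp_hasDerivAt s h1
    have h3 := h2.sub ((hasDerivAt_id s).mul_const (2 * inner ℝ (nonlin z) d))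
    refine h3.congr_deriv ?_
    simp only [inner_sub_left, smul_apply, innerSL_apply_apply, smul_eq_mul]
    ring
  have hb : ∀ s ∈ Set.Icc (0 : ℝ) 1, |2 * inner ℝ (nonlin (z + s • d) - nonlin z) d| ≤ 4 * (‖d‖ ^ 2 * M) := by
    intro s hs
    rw [abs_mul, abs_of_pos two_pos]
    calc 2 * |inner ℝ (nonlin (z + s • d) - nonlin z) d| ≤ 2 * (‖nonlin (z + s • d) - nonlin z‖ * ‖d‖) := by
          gcongr; exact abs_real_inner_le_norm _ _
      _ ≤ 2 * (‖d‖ * (2 * M) * ‖d‖) := by gcongr; exact hseg s hs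
      _ = _ := by ring
  have h1 := norm_image_sub_le_of_norm_deriv_le_segment_01' (C := 4 * (‖d‖ ^ 2 * M))
    (fun s _ => (hder s).hasDerivWithinAt) (fun s hs => hb s (Set.Ico_subset_Icc_self hs))
  simp only [one_smul, zero_smul, add_zero, one_mul, zero_mul, sub_zero, Real.norm_eq_abs] at h1
  have e : z + d = w := by rw [hd]; ring
  rw [e] at h1
  have h2 : |inner ℝ (nonlin w - nonlin z) d| ≤ ‖d‖ ^ 2 * M := by
    refine (abs_real_inner_le_norm _ _).trans ?_
    calc ‖nonlin w - nonlin z‖ * ‖d‖ ≤ ‖w - z‖ * (expWeight w + expWeight z) * ‖d‖ := by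
          gcongr; exact norm_nonlin_sub_le _ _
      _ = _ := by rw [hM, ← hd]; ring
  have e2 : potential w - potential z - inner ℝ (nonlin z + nonlin w) d =
      (potential w - 2 * inner ℝ (nonlin z) d - potential z) - inner ℝ (nonlin w - nonlin z) d := by
    rw [inner_add_left, inner_sub_left]; ring
  rw [e2]
  refine (abs_sub _ _).trans ?_
  linarith

/-! ### Exponential integrability in H¹ and the nonlinearity on L². -/

/-- The exponential integral `∫ (exp (a |v|²) - 1)`. -/
def expInt (a : ℝ) (v : L2C) : ENNReal := ∫⁻ x, ENNReal.ofReal (Real.exp (a * ‖v x‖ ^ 2) - 1)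

/-- Exponential integrals are locally bounded in `H¹`. -/
theorem HasGrad.exists_expInt_le {v : L2C} {g : Fin 2 → L2C} (h : HasGrad v g) {a : ℝ} (ha : 0 < a) :
    ∃ δ > 0, ∃ C < (⊤ : ENNReal), ∀ (w : L2C) (k : Fin 2 → L2C), HasGrad w k → ‖w - v‖ < δ →
      (∀ j, ‖k j - g j‖ < δ) → expInt a w ≤ C := by
  obtain ⟨c, hc, C₀, hC₀, hMT⟩ := exists_moser_trudinger
  -- Any exponent is reached by splitting off a bounded ψ: exp(a|w|²) ≤ exp(2a|ψ|²) exp(2a|w - ψ|²),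
  -- with the first factor bounded and w - ψ of small gradient.
  obtain ⟨ψ, V, G, hψ, hψc, hV, -, hVG, hVt, hGt⟩ := h.exists_approx
  -- Both gradient components of w - ψ are below 2δ and δ ≤ 1, so 2a times the sum of their squares
  -- is at most 16aδ ≤ c / 2.
  set δ : ℝ := min 1 (c / (32 * a)) with hδ
  have hδ0 : 0 < δ := lt_min one_pos (by positivity)
  have hδ1 : δ ≤ 1 := min_le_left _ _
  have hδ2 : δ * (32 * a) ≤ c := by
    rw [← le_div_iff₀ (by positivity)]; exact min_le_right _ _
  have hev : ∀ᶠ n in atTop, ‖V n - v‖ < δ ∧ ‖G n 0 - g 0‖ < δ ∧ ‖G n 1 - g 1‖ < δ := by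
    have e1 : ∀ {x : ℕ → L2C} {y : L2C}, Tendsto x atTop (𝓝 y) → ∀ᶠ n in atTop, ‖x n - y‖ < δ := by
      intro x y hx
      filter_upwards [Metric.tendsto_nhds.1 hx δ hδ0] with n hn
      rwa [← dist_eq_norm]
    exact (e1 hVt).and ((e1 (hGt 0)).and (e1 (hGt 1)))
  obtain ⟨n, hn, hn0, hn1⟩ := hev.exists
  obtain ⟨B, hB⟩ := (hψ n).continuous.bounded_above_of_compact_support (hψc n)
  have hB0 : 0 ≤ B := (norm_nonneg _).trans (hB 0)
  have hcont : Continuous fun x => Real.exp (2 * a * ‖ψ n x‖ ^ 2) - 1 := by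
    have := (hψ n).continuous
    fun_prop
  have hint : Integrable fun x => Real.exp (2 * a * ‖ψ n x‖ ^ 2) - 1 := by
    apply hcont.integrable_of_hasCompactSupport
    refine (hψc n).mono fun x hx h0 => hx ?_
    simp [h0]
  set E : ℝ := Real.exp (2 * a * B ^ 2) with hE
  refine ⟨δ, hδ0, ENNReal.ofReal E * ENNReal.ofReal (C₀ * (2 * a) * 2 ^ 2) +
    ∫⁻ x, ENNReal.ofReal (Real.exp (2 * a * ‖ψ n x‖ ^ 2) - 1), ?_, fun w k hwk hw hk => ?_⟩
  · exact ENNReal.add_lt_top.2 ⟨ENNReal.mul_lt_top ENNReal.ofReal_lt_top ENNReal.ofReal_lt_top, hint.lintegral_lt_top⟩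
  · have hr := hwk.sub (hVG n)
    have htri : ∀ {x y z : L2C}, ‖x - y‖ < δ → ‖z - y‖ < δ → ‖x - z‖ < 2 * δ := by
      intro x y z h1 h2
      have := norm_sub_le_norm_sub_add_norm_sub x y z
      rw [norm_sub_rev y z] at this
      linarith
    have hrn : ‖w - V n‖ < 2 * δ := htri hw hn
    have hk0 : ‖k 0 - G n 0‖ < 2 * δ := htri (hk 0) hn0
    have hk1 : ‖k 1 - G n 1‖ < 2 * δ := htri (hk 1) hn1
    have hsq : ∀ {x : ℝ}, 0 ≤ x → x < 2 * δ → x ^ 2 ≤ 4 * δ := by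
      intro x h0 h1
      nlinarith
    have hsum : 2 * a * ∑ j, ‖k j - G n j‖ ^ 2 < c := by
      rw [Fin.sum_univ_two]
      have := hsq (norm_nonneg _) hk0
      have := hsq (norm_nonneg _) hk1
      nlinarith
    have hmt := hMT _ _ hr (2 * a) (by positivity) hsum
    have hmt' : ∫⁻ x, ENNReal.ofReal (Real.exp (2 * a * ‖(w - V n) x‖ ^ 2) - 1) ≤
        ENNReal.ofReal (C₀ * (2 * a) * 2 ^ 2) := by
      refine hmt.trans (ENNReal.ofReal_le_ofReal ?_)
      gcongr
      linarith
    calc expInt a w ≤ ∫⁻ x, (ENNReal.ofReal E * ENNReal.ofReal (Real.exp (2 * a * ‖(w - V n) x‖ ^ 2) - 1) +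
          ENNReal.ofReal (Real.exp (2 * a * ‖ψ n x‖ ^ 2) - 1)) := by
          apply lintegral_mono_ae
          filter_upwards [hV n, Lp.coeFn_sub w (V n)] with x h1 h2
          rw [← ENNReal.ofReal_mul (by positivity), ← ENNReal.ofReal_add]
          rotate_left
          · exact mul_nonneg (by positivity) (sub_nonneg.2 (Real.one_le_exp (by positivity)))
          · exact sub_nonneg.2 (Real.one_le_exp (by positivity))
          apply ENNReal.ofReal_le_ofReal
          rw [Pi.sub_apply, h1] at h2
          have h3 : ‖w x‖ ≤ ‖ψ n x‖ + ‖(w - V n) x‖ := by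
            rw [h2]
            calc ‖w x‖ = ‖ψ n x + (w x - ψ n x)‖ := by congr 1; ring
              _ ≤ _ := norm_add_le _ _
          have h4 : a * ‖w x‖ ^ 2 ≤ 2 * a * ‖ψ n x‖ ^ 2 + 2 * a * ‖(w - V n) x‖ ^ 2 := by
            have h5 : ‖w x‖ ^ 2 ≤ 2 * ‖ψ n x‖ ^ 2 + 2 * ‖(w - V n) x‖ ^ 2 := by
              nlinarith [sq_nonneg (‖ψ n x‖ - ‖(w - V n) x‖), norm_nonneg (w x), norm_nonneg (ψ n x),
                norm_nonneg ((w - V n) x)]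
            nlinarith
          have h6 : Real.exp (2 * a * ‖ψ n x‖ ^ 2) ≤ E := by
            rw [hE]; gcongr; exact hB x
          have h7 : 1 ≤ Real.exp (2 * a * ‖(w - V n) x‖ ^ 2) := Real.one_le_exp (by positivity)
          have h8 := Real.exp_le_exp.2 h4
          rw [Real.exp_add] at h8
          nlinarith
      _ = ENNReal.ofReal E * (∫⁻ x, ENNReal.ofReal (Real.exp (2 * a * ‖(w - V n) x‖ ^ 2) - 1)) +
          ∫⁻ x, ENNReal.ofReal (Real.exp (2 * a * ‖ψ n x‖ ^ 2) - 1) := by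
          rw [lintegral_add_right _ hcont.measurable.ennreal_ofReal,
            lintegral_const_mul' _ _ ENNReal.ofReal_ne_top]
      _ ≤ _ := by gcongr

theorem HasGrad.expInt_lt_top {v : L2C} {g : Fin 2 → L2C} (h : HasGrad v g) {a : ℝ} (ha : 0 < a) :
    expInt a v < ⊤ := by
  obtain ⟨δ, hδ, C, hC, h'⟩ := h.exists_expInt_le ha
  exact (h' v g h (by simpa) (by simpa)).trans_lt hC

theorem eLpNorm_expWeight_le (v : L2C) {n : ℕ} (hn : n ≠ 0) :
    eLpNorm (fun x => expWeight (v x)) n volume ≤ (expInt (12 * Real.pi * n) v) ^ (1 / (n : ℝ)) := by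
  rw [eLpNorm_eq_lintegral_rpow_enorm_toReal (by simpa) (by simp)]
  simp only [ENNReal.toReal_natCast]
  gcongr
  refine lintegral_mono fun x => ?_
  rw [ENNReal.rpow_natCast, Real.enorm_eq_ofReal (expWeight_nonneg _), ← ENNReal.ofReal_pow (expWeight_nonneg _)]
  apply ENNReal.ofReal_le_ofReal
  refine (exp_sub_one_pow_le (by positivity) hn).trans (le_of_eq ?_)
  ring_nf

theorem aestronglyMeasurable_expWeight (v : L2C) : AEStronglyMeasurable (fun x => expWeight (v x)) :=
  continuous_expWeight.comp_aestronglyMeasurable (Lp.memLp v).1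

theorem HasGrad.memLp_expWeight {v : L2C} {g : Fin 2 → L2C} (h : HasGrad v g) {n : ℕ} (hn : n ≠ 0) :
    MemLp (fun x => expWeight (v x)) n volume :=
  ⟨aestronglyMeasurable_expWeight v, (eLpNorm_expWeight_le v hn).trans_lt
    (ENNReal.rpow_lt_top_of_nonneg (by positivity) (h.expInt_lt_top (by positivity)).ne)⟩

/-- The `L⁴` norm is controlled by the `L²` norm if the gradient is small. -/
theorem exists_eLpNorm_four_le : ∃ c : ℝ, 0 < c ∧ ∃ C : ℝ, 0 < C ∧
    ∀ (w : L2C) (k : Fin 2 → L2C), HasGrad w k → ∑ j, ‖k j‖ ^ 2 < c →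
      eLpNorm w 4 volume ≤ ENNReal.ofReal (C * ‖w‖ ^ 2) ^ (1 / 4 : ℝ) := by
  obtain ⟨c, hc, C₀, hC₀, hMT⟩ := exists_moser_trudinger
  refine ⟨c, hc, 2 * C₀, by positivity, fun w k hwk hk => ?_⟩
  have h1 := hMT w k hwk 1 one_pos (by simpa using hk)
  rw [eLpNorm_eq_lintegral_rpow_enorm_toReal (by norm_num) (by norm_num)]
  simp only [ENNReal.toReal_ofNat]
  gcongr
  calc ∫⁻ x, ‖w x‖ₑ ^ (4 : ℝ) ≤ ∫⁻ x, ENNReal.ofReal 2 * ENNReal.ofReal (Real.exp (1 * ‖w x‖ ^ 2) - 1) := by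
        refine lintegral_mono fun x => ?_
        rw [show (4 : ℝ) = ((4 : ℕ) : ℝ) by norm_num, ENNReal.rpow_natCast, ← ofReal_norm, ← ENNReal.ofReal_pow (norm_nonneg _),
          ← ENNReal.ofReal_mul (by norm_num)]
        apply ENNReal.ofReal_le_ofReal
        have := Real.quadratic_le_exp_of_nonneg (x := ‖w x‖ ^ 2) (by positivity)
        rw [one_mul]
        nlinarith [sq_nonneg (‖w x‖)]
    _ ≤ ENNReal.ofReal 2 * ENNReal.ofReal (C₀ * 1 * ‖w‖ ^ 2) := by
        rw [lintegral_const_mul' _ _ ENNReal.ofReal_ne_top]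
        gcongr
    _ = _ := by rw [← ENNReal.ofReal_mul (by norm_num)]; ring_nf

instance holderTriple_four_four_two : ENNReal.HolderTriple 4 4 2 where
  inv_add_inv_eq_inv := by
    rw [← ENNReal.toReal_eq_toReal_iff' (by simp) (by simp), ENNReal.toReal_add (by simp) (by simp)]
    simp; norm_num

theorem HasGrad.memLp_four {v : L2C} {g : Fin 2 → L2C} (h : HasGrad v g) : MemLp v 4 volume := by
  refine ⟨(Lp.memLp v).1, ?_⟩
  rw [eLpNorm_lt_top_iff_lintegral_rpow_enorm_lt_top (by norm_num) (by norm_num)]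
  refine lt_of_le_of_lt ?_ (ENNReal.mul_lt_top (ENNReal.ofReal_lt_top (r := 2)) (h.expInt_lt_top one_pos))
  rw [expInt, ← lintegral_const_mul' _ _ ENNReal.ofReal_ne_top]
  refine lintegral_mono fun x => ?_
  rw [ENNReal.toReal_ofNat, show (4 : ℝ) = ((4 : ℕ) : ℝ) by norm_num, ENNReal.rpow_natCast, ← ofReal_norm,
    ← ENNReal.ofReal_pow (norm_nonneg _), ← ENNReal.ofReal_mul (by norm_num)]
  apply ENNReal.ofReal_le_ofReal
  have := Real.quadratic_le_exp_of_nonneg (x := ‖v x‖ ^ 2) (by positivity)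
  rw [one_mul]
  nlinarith [sq_nonneg (‖v x‖)]

theorem HasGrad.memLp_nonlin {v : L2C} {g : Fin 2 → L2C} (h : HasGrad v g) :
    MemLp (fun x => nonlin (v x)) 2 volume := by
  have h1 : MemLp (fun x => expWeight (v x)) 4 volume := by
    exact_mod_cast h.memLp_expWeight (n := 4) (by norm_num)
  have h2 : MemLp (fun x => ‖v x‖ * expWeight (v x)) 2 volume := h1.mul h.memLp_four.norm
  refine h2.mono' (continuous_nonlin.comp_aestronglyMeasurable (Lp.memLp v).1)
    (Eventually.of_forall fun x => norm_nonlin_le _)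

open Classical in
/-- The nonlinearity as a map on `L²` (zero where it does not take values in `L²`). -/
def nlOp (v : L2C) : L2C :=
  if h : MemLp (fun x => nonlin (v x)) 2 volume then h.toLp _ else 0

theorem HasGrad.coeFn_nlOp {v : L2C} {g : Fin 2 → L2C} (h : HasGrad v g) :
    nlOp v =ᵐ[volume] fun x => nonlin (v x) := by
  rw [nlOp, dif_pos h.memLp_nonlin]
  exact h.memLp_nonlin.coeFn_toLp

/-- Hölder with exponents 4 and 4 on the pointwise bound `norm_nonlin_sub_le`. -/
theorem norm_nlOp_sub_le {v w : L2C} {g k : Fin 2 → L2C} (hv : HasGrad v g) (hw : HasGrad w k) :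
    ENNReal.ofReal ‖nlOp v - nlOp w‖ ≤ eLpNorm (v - w : L2C) 4 volume *
      (eLpNorm (fun x => expWeight (v x)) 4 volume + eLpNorm (fun x => expWeight (w x)) 4 volume) := by
  have h1 : ENNReal.ofReal ‖nlOp v - nlOp w‖ = eLpNorm (nlOp v - nlOp w : L2C) 2 volume := by
    rw [Lp.norm_def, ENNReal.ofReal_toReal (Lp.memLp _).2.ne]
  rw [h1]
  calc eLpNorm (nlOp v - nlOp w : L2C) 2 volume
      ≤ eLpNorm (fun x => ‖(v - w : L2C) x‖ * (expWeight (v x) + expWeight (w x))) 2 volume := by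
        apply eLpNorm_mono_ae
        filter_upwards [Lp.coeFn_sub (nlOp v) (nlOp w), hv.coeFn_nlOp, hw.coeFn_nlOp, Lp.coeFn_sub v w] with x h1 h2 h3 h4
        rw [h1, Pi.sub_apply, h2, h3, h4]
        exact (norm_nonlin_sub_le _ _).trans (le_abs_self _)
    _ ≤ eLpNorm (fun x => ‖(v - w : L2C) x‖) 4 volume * eLpNorm (fun x => expWeight (v x) + expWeight (w x)) 4 volume := by
        have := eLpNorm_smul_le_mul_eLpNorm (p := 4) (q := 4) (r := 2) (μ := (volume : Measure Plane))
          (f := fun x => expWeight (v x) + expWeight (w x)) (φ := fun x => ‖(v - w : L2C) x‖)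
          ((aestronglyMeasurable_expWeight v).add (aestronglyMeasurable_expWeight w)) (Lp.memLp _).1.norm
        exact this
    _ ≤ _ := by
        rw [eLpNorm_norm]
        gcongr
        exact eLpNorm_add_le (aestronglyMeasurable_expWeight v) (aestronglyMeasurable_expWeight w) (by norm_num)

/-! ### Solutions as curves in L²: bounds on compact time intervals and continuity. -/

/-- A solution of the equation, viewed as a curve in `L²`. -/
structure IsFlow (U : ℝ → L2C) (G : ℝ → Fin 2 → L2C) : Prop where
  grad : ∀ t, HasGrad (U t) (G t)
  contU : Continuous U
  contG : ∀ j, Continuous fun t => G t j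
  eq : ∀ (φ : Test) (t : ℝ), inner ℂ φ.toL2 (U t) = inner ℂ φ.toL2 (U 0) +
    Complex.I * ∫ s in (0 : ℝ)..t, (inner ℂ φ.lap.toL2 (U s) - inner ℂ φ.toL2 (nlOp (U s)))
  l4 : ∀ T : ℝ, ∀ j, ∫⁻ t in Set.Icc (-T) T, eLpNorm (G t j) 4 volume < ⊤

namespace IsFlow

variable {U : ℝ → L2C} {G : ℝ → Fin 2 → L2C}

/-- The local bounds in H¹ are glued by compactness of the time interval. -/
theorem exists_expInt_le (h : IsFlow U G) {a : ℝ} (ha : 0 < a) (T : ℝ) :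
    ∃ C < (⊤ : ENNReal), ∀ t ∈ Set.Icc (-T) T, expInt a (U t) ≤ C := by
  refine (isCompact_Icc (a := -T) (b := T)).induction_on
    (p := fun s => ∃ C < (⊤ : ENNReal), ∀ t ∈ s, expInt a (U t) ≤ C) ?_ ?_ ?_ ?_
  · exact ⟨0, by simp, by simp⟩
  · rintro s t hst ⟨C, hC, hCs⟩
    exact ⟨C, hC, fun x hx => hCs x (hst hx)⟩
  · rintro s t ⟨C, hC, hCs⟩ ⟨D, hD, hDs⟩
    refine ⟨C + D, ENNReal.add_lt_top.2 ⟨hC, hD⟩, ?_⟩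
    rintro x (hx | hx)
    · exact (hCs x hx).trans le_self_add
    · exact (hDs x hx).trans le_add_self
  · intro t _
    obtain ⟨δ, hδ, C, hC, hb⟩ := (h.grad t).exists_expInt_le ha
    have e1 : ∀ {x : ℝ → L2C}, Continuous x → ∀ᶠ s in 𝓝 t, ‖x s - x t‖ < δ := by
      intro x hx
      filter_upwards [Metric.tendsto_nhds.1 (hx.tendsto t) δ hδ] with s hs
      rwa [← dist_eq_norm]
    have hev : ∀ᶠ s in 𝓝 t, expInt a (U s) ≤ C := by
      filter_upwards [e1 h.contU, e1 (h.contG 0), e1 (h.contG 1)] with s h0 h1 h2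
      refine hb _ _ (h.grad s) h0 (fun j => ?_)
      fin_cases j
      · exact h1
      · exact h2
    exact ⟨_, mem_nhdsWithin_of_mem_nhds hev, C, hC, fun s hs => hs⟩

theorem exists_eLpNorm_expWeight_le (h : IsFlow U G) {n : ℕ} (hn : n ≠ 0) (T : ℝ) :
    ∃ C < (⊤ : ENNReal), ∀ t ∈ Set.Icc (-T) T, eLpNorm (fun x => expWeight (U t x)) n volume ≤ C := by
  obtain ⟨C, hC, hCt⟩ := h.exists_expInt_le (a := 12 * Real.pi * n) (by positivity) T
  refine ⟨C ^ (1 / (n : ℝ)), ENNReal.rpow_lt_top_of_nonneg (by positivity) hC.ne, fun t ht => ?_⟩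
  refine (eLpNorm_expWeight_le _ hn).trans ?_
  gcongr
  exact hCt t ht

/-- Differences tend to zero in `L⁴`. -/
theorem tendsto_eLpNorm_four (h : IsFlow U G) (t : ℝ) :
    Tendsto (fun s => eLpNorm (U s - U t : L2C) 4 volume) (𝓝 t) (𝓝 0) := by
  obtain ⟨c, hc, C, hC, hb⟩ := exists_eLpNorm_four_le
  have h1 : Tendsto (fun s => ∑ j, ‖G s j - G t j‖ ^ 2) (𝓝 t) (𝓝 0) := by
    have : Continuous fun s => ∑ j, ‖G s j - G t j‖ ^ 2 := by
      have := h.contG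
      fun_prop
    simpa using this.tendsto t
  have h2 : Tendsto (fun s => ENNReal.ofReal (C * ‖U s - U t‖ ^ 2) ^ (1 / 4 : ℝ)) (𝓝 t) (𝓝 0) := by
    have hc : Continuous fun s => ENNReal.ofReal (C * ‖U s - U t‖ ^ 2) ^ (1 / 4 : ℝ) :=
      (ENNReal.continuous_rpow_const).comp (ENNReal.continuous_ofReal.comp (by have := h.contU; fun_prop))
    have := hc.tendsto t
    simpa using this
  refine tendsto_of_tendsto_of_tendsto_of_le_of_le' tendsto_const_nhds h2 (Eventually.of_forall fun _ => zero_le) ?_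
  filter_upwards [h1.eventually (gt_mem_nhds hc)] with s hs
  exact hb _ _ ((h.grad s).sub (h.grad t)) hs

/-- Increments of U tend to zero in L⁴ while the exponential weights stay bounded in L⁴ near t. -/
theorem continuous_nlOp (h : IsFlow U G) : Continuous fun t => nlOp (U t) := by
  rw [continuous_iff_continuousAt]
  intro t
  obtain ⟨C, hC, hb⟩ := h.exists_eLpNorm_expWeight_le (n := 4) (by norm_num) (|t| + 1)
  have h1 : Tendsto (fun s => eLpNorm (U s - U t : L2C) 4 volume * (C + C)) (𝓝 t) (𝓝 0) := by
    have := ENNReal.Tendsto.mul_const (h.tendsto_eLpNorm_four t) (b := C + C)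
      (Or.inr (ENNReal.add_lt_top.2 ⟨hC, hC⟩).ne)
    simpa using this
  have h2 : Tendsto (fun s => ENNReal.ofReal ‖nlOp (U s) - nlOp (U t)‖) (𝓝 t) (𝓝 0) := by
    refine tendsto_of_tendsto_of_tendsto_of_le_of_le' tendsto_const_nhds h1 (Eventually.of_forall fun _ => zero_le) ?_
    have hmem : ∀ᶠ s in 𝓝 t, s ∈ Set.Icc (-(|t| + 1)) (|t| + 1) := by
      apply Icc_mem_nhds
      · linarith [neg_abs_le t]
      · linarith [le_abs_self t]
    filter_upwards [hmem] with s hs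
    refine (norm_nlOp_sub_le (h.grad s) (h.grad t)).trans ?_
    gcongr
    · exact_mod_cast hb s hs
    · exact_mod_cast hb t (mem_of_mem_nhds hmem)
  rw [ContinuousAt, tendsto_iff_norm_sub_tendsto_zero]
  have h3 := (ENNReal.tendsto_toReal ENNReal.zero_ne_top).comp h2
  simpa [Function.comp_def, ENNReal.toReal_ofReal] using h3

end IsFlow

/-! ### The mollified equation and conservation of mass. -/

theorem HasGrad.inner_convOp_pd {v x : L2C} {g : Fin 2 → L2C} (hv : HasGrad v g) (ρ : Test) (j : Fin 2) :
    inner ℂ v (convOp (ρ.pd j) x) = - inner ℂ (g j) (convOp ρ x) :=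
  hv.inner_eq (hasGrad_convOp ρ x) j

theorem HasGrad.convOp {v : L2C} {g : Fin 2 → L2C} (hv : HasGrad v g) (ρ : Test) :
    HasGrad (convOp ρ v) (fun j => convOp ρ (g j)) := by
  have h := hasGrad_convOp ρ v
  simpa only [hv.convOp_pd] using h

theorem tendsto_intervalIntegral_of_le_continuous {E : Type*} [NormedAddCommGroup E] [NormedSpace ℝ E]
    {F : ℕ → ℝ → E} {f : ℝ → E} {B : ℝ → ℝ} {a b : ℝ}
    (hF : ∀ n, Continuous (F n)) (hB : Continuous B) (hFB : ∀ n t, ‖F n t‖ ≤ B t)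
    (hf : ∀ t, Tendsto (fun n => F n t) atTop (𝓝 (f t))) :
    Tendsto (fun n => ∫ t in a..b, F n t) atTop (𝓝 (∫ t in a..b, f t)) :=
  intervalIntegral.tendsto_integral_filter_of_dominated_convergence B
    (Eventually.of_forall fun n => (hF n).aestronglyMeasurable)
    (Eventually.of_forall fun n => Eventually.of_forall fun t _ => hFB n t)
    (hB.intervalIntegrable _ _) (Eventually.of_forall fun t _ => hf t)

namespace IsFlow

variable {U : ℝ → L2C} {G : ℝ → Fin 2 → L2C}

/-- The time derivative of the mollified solution, up to the factor `i`. -/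
def mollRhs (U : ℝ → L2C) (G : ℝ → Fin 2 → L2C) (ρ : Test) (t : ℝ) : L2C :=
  ∑ j, convOp (ρ.pd j) (G t j) - convOp ρ (nlOp (U t))

theorem continuous_mollRhs (h : IsFlow U G) (ρ : Test) : Continuous (mollRhs U G ρ) := by
  have := h.contG
  have := h.continuous_nlOp
  unfold mollRhs
  fun_prop

/-- The equation is tested with the convolution of φ with the reflected kernel. One derivative of
the Laplacian stays on the kernel and the other becomes the gradient of U, so the integrand is
continuous in L². -/
theorem convOp_eq (h : IsFlow U G) (ρ : Test) (t : ℝ) :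
    convOp ρ (U t) = convOp ρ (U 0) + ∫ s in (0 : ℝ)..t, Complex.I • mollRhs U G ρ s := by
  refine L2C.ext_test fun φ => ?_
  have hc := h.continuous_mollRhs ρ
  have e1 : inner ℂ φ.toL2 (∫ s in (0 : ℝ)..t, Complex.I • mollRhs U G ρ s) =
      ∫ s in (0 : ℝ)..t, inner ℂ φ.toL2 (Complex.I • mollRhs U G ρ s) := by
    have := (innerSL ℂ φ.toL2).intervalIntegral_comp_comm (f := fun s => Complex.I • mollRhs U G ρ s)
      (a := 0) (b := t) (μ := volume) ((hc.const_smul Complex.I).intervalIntegrable _ _)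
    exact this.symm
  rw [inner_add_right, inner_test_convOp, inner_test_convOp, h.eq, e1, ← intervalIntegral.integral_const_mul]
  congr 1
  refine intervalIntegral.integral_congr fun s _ => ?_
  have e2 : ∀ j, inner ℂ (((ρ.refl.conv φ).pd j).pd j).toL2 (U s) = inner ℂ φ.toL2 (convOp (ρ.pd j) (G s j)) := by
    intro j
    rw [Test.conv_pd, Test.conv_pd, ← inner_test_convOp, inner_pd_convOp, inner_pd_convOp, neg_neg,
      (h.grad s).convOp_pd]
  rw [inner_smul_right, mollRhs, inner_sub_right, inner_sum, Fin.sum_univ_two, ← e2, ← e2, ← inner_add_left, ← Test.toL2_add,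
    ← inner_test_convOp]
  rfl

theorem hasDerivAt_convOp (h : IsFlow U G) (ρ : Test) (t : ℝ) :
    HasDerivAt (fun s => convOp ρ (U s)) (Complex.I • mollRhs U G ρ t) t := by
  have hc := (h.continuous_mollRhs ρ).const_smul Complex.I
  have := intervalIntegral.integral_hasDerivAt_right (hc.intervalIntegrable 0 t)
    (hc.stronglyMeasurableAtFilter _ _) hc.continuousAt
  rw [funext (h.convOp_eq ρ)]
  exact this.const_add _

/-- The weak equation extends to all φ in H¹, since one integration by parts leaves only φ and its
gradient. Functions of the solution thus become admissible tests. -/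
theorem integral_inner_eq (h : IsFlow U G) {φ : L2C} {k : Fin 2 → L2C} (hφ : HasGrad φ k) (a b : ℝ) :
    inner ℂ φ (U b) - inner ℂ φ (U a) =
      ∫ s in a..b, -Complex.I * (∑ j, inner ℂ (k j) (G s j) + inner ℂ φ (nlOp (U s))) := by
  have hG := h.contG
  have hN := h.continuous_nlOp
  have key : ∀ n, inner ℂ φ (convOp (moll n) (U b)) - inner ℂ φ (convOp (moll n) (U a)) =
      ∫ s in a..b, -Complex.I * (∑ j, inner ℂ (k j) (convOp (moll n) (G s j)) +
        inner ℂ φ (convOp (moll n) (nlOp (U s)))) := by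
    intro n
    symm
    apply intervalIntegral.integral_eq_sub_of_hasDerivAt (f := fun s => inner ℂ φ (convOp (moll n) (U s)))
    · intro s _
      have h1 := (hasDerivAt_const s φ).inner ℂ (h.hasDerivAt_convOp (moll n) s)
      refine h1.congr_deriv ?_
      simp only [mollRhs, inner_smul_right, inner_sub_right, inner_sum, hφ.inner_convOp_pd, inner_zero_left,
        Finset.sum_neg_distrib]
      ring
    · apply Continuous.intervalIntegrable
      fun_prop
  refine tendsto_nhds_unique (f := fun n => inner ℂ φ (convOp (moll n) (U b)) - inner ℂ φ (convOp (moll n) (U a)))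
    (l := atTop) ?_ ?_
  · exact (tendsto_const_nhds.inner (tendsto_convOp_moll _)).sub (tendsto_const_nhds.inner (tendsto_convOp_moll _))
  · simp_rw [key]
    refine tendsto_intervalIntegral_of_le_continuous
      (B := fun s => ∑ j, ‖k j‖ * ‖G s j‖ + ‖φ‖ * ‖nlOp (U s)‖) (fun n => by fun_prop) (by fun_prop) ?_ ?_
    · intro n s
      rw [norm_mul, norm_neg, Complex.norm_I, one_mul]
      have hb : ∀ x y : L2C, ‖inner ℂ x (convOp (moll n) y)‖ ≤ ‖x‖ * ‖y‖ := fun x y =>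
        (norm_inner_le_norm _ _).trans (by gcongr; exact norm_convOp_moll_le n y)
      refine (norm_add_le _ _).trans (add_le_add ((norm_sum_le _ _).trans (Finset.sum_le_sum fun j _ => hb _ _)) (hb _ _))
    · intro s
      exact ((tendsto_finsetSum _ fun j _ => tendsto_const_nhds.inner (tendsto_convOp_moll _)).add
        (tendsto_const_nhds.inner (tendsto_convOp_moll _))).const_mul _

theorem inner_mollRhs (h : IsFlow U G) (ρ : Test) (s t : ℝ) :
    inner ℂ (convOp ρ (U s)) (mollRhs U G ρ t) = -∑ j, inner ℂ (convOp ρ (G s j)) (convOp ρ (G t j)) -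
      inner ℂ (convOp ρ (U s)) (convOp ρ (nlOp (U t))) := by
  simp only [mollRhs, inner_sub_right, inner_sum, ((h.grad s).convOp ρ).inner_convOp_pd, Finset.sum_neg_distrib]

/-- Evolution of the inner product of two time translates. -/
theorem inner_shift_sub (h : IsFlow U G) (p q a b : ℝ) :
    inner ℂ (U (b + p)) (U (b + q)) - inner ℂ (U (a + p)) (U (a + q)) =
      ∫ t in a..b, Complex.I * (inner ℂ (nlOp (U (t + p))) (U (t + q)) -
        inner ℂ (U (t + p)) (nlOp (U (t + q)))) := by
  have hU := h.contU
  have hN := h.continuous_nlOp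
  have hN' : ∀ p, Continuous fun t => nlOp (U (t + p)) := fun p => hN.comp (by fun_prop)
  have key : ∀ n, inner ℂ (convOp (moll n) (U (b + p))) (convOp (moll n) (U (b + q))) -
      inner ℂ (convOp (moll n) (U (a + p))) (convOp (moll n) (U (a + q))) =
      ∫ t in a..b, Complex.I * (inner ℂ (convOp (moll n) (nlOp (U (t + p)))) (convOp (moll n) (U (t + q))) -
        inner ℂ (convOp (moll n) (U (t + p))) (convOp (moll n) (nlOp (U (t + q))))) := by
    intro n
    symm
    apply intervalIntegral.integral_eq_sub_of_hasDerivAt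
      (f := fun s => inner ℂ (convOp (moll n) (U (s + p))) (convOp (moll n) (U (s + q))))
    · intro s _
      have h1 := ((h.hasDerivAt_convOp (moll n) (s + p)).comp_add_const s p).inner ℂ
        ((h.hasDerivAt_convOp (moll n) (s + q)).comp_add_const s q)
      refine h1.congr_deriv ?_
      -- Both pairings produce the same gradient term, with factors i and -i; only the nonlinear
      -- terms survive.
      have e1 := h.inner_mollRhs (moll n) (s + p) (s + q)
      have e2 := congrArg (starRingEnd ℂ) (h.inner_mollRhs (moll n) (s + q) (s + p))
      simp only [map_sub, map_neg, map_sum, inner_conj_symm] at e2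
      rw [inner_smul_right, inner_smul_left, Complex.conj_I, e1, e2]
      ring
    · apply Continuous.intervalIntegrable
      have := hN' p
      have := hN' q
      fun_prop
  have hJ := tendsto_convOp_moll
  refine tendsto_nhds_unique (f := fun n => inner ℂ (convOp (moll n) (U (b + p))) (convOp (moll n) (U (b + q))) -
      inner ℂ (convOp (moll n) (U (a + p))) (convOp (moll n) (U (a + q))))
    (l := atTop) (((hJ _).inner (hJ _)).sub ((hJ _).inner (hJ _))) ?_
  simp_rw [key]
  have := hN' p
  have := hN' q
  refine tendsto_intervalIntegral_of_le_continuous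
    (B := fun t => ‖nlOp (U (t + p))‖ * ‖U (t + q)‖ + ‖U (t + p)‖ * ‖nlOp (U (t + q))‖)
    (fun n => by fun_prop) (by fun_prop) ?_ ?_
  · intro n s
    rw [norm_mul, Complex.norm_I, one_mul]
    have hb : ∀ x y : L2C, ‖inner ℂ (convOp (moll n) x) (convOp (moll n) y)‖ ≤ ‖x‖ * ‖y‖ := fun x y =>
      (norm_inner_le_norm _ _).trans (by gcongr <;> exact norm_convOp_moll_le n _)
    exact (norm_sub_le _ _).trans (add_le_add (hb _ _) (hb _ _))
  · intro s
    exact (((hJ _).inner (hJ _)).sub ((hJ _).inner (hJ _))).const_mul _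

theorem _root_.HasGrad.inner_nlOp_eq {v : L2C} {g : Fin 2 → L2C} (h : HasGrad v g) :
    inner ℂ (nlOp v) v = inner ℂ v (nlOp v) := by
  rw [L2.inner_def, L2.inner_def]
  apply integral_congr_ae
  filter_upwards [h.coeFn_nlOp] with x hx
  rw [hx, nonlin_eq]
  simp
  ring

/-- Conservation of mass. -/
theorem norm_eq (h : IsFlow U G) (t : ℝ) : ‖U t‖ = ‖U 0‖ := by
  have h1 := h.inner_shift_sub 0 0 0 t
  simp only [add_zero, fun t => (h.grad t).inner_nlOp_eq, sub_self, mul_zero, intervalIntegral.integral_zero] at h1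
  rw [inner_self_eq_norm_sq_to_K, inner_self_eq_norm_sq_to_K, sub_eq_zero] at h1
  have h2 : ‖U t‖ ^ 2 = ‖U 0‖ ^ 2 := by exact_mod_cast h1
  exact (pow_left_inj₀ (norm_nonneg _) (norm_nonneg _) two_ne_zero).1 h2

end IsFlow

/-! ### The trapezoidal defect of the potential energy. -/

/-- The potential energy. -/
def potInt (v : L2C) : ℝ := ∫ x, potential (v x)

/-- The error in the trapezoidal expansion of the potential energy. -/
def potDefect (v w : L2C) : ℝ := potInt w - potInt v - (inner ℂ (nlOp v + nlOp w) (w - v)).re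

theorem HasGrad.integrable_potential {v : L2C} {g : Fin 2 → L2C} (h : HasGrad v g) :
    Integrable fun x => potential (v x) := by
  refine ⟨continuous_potential.comp_aestronglyMeasurable (Lp.memLp v).1, ?_⟩
  refine lt_of_le_of_lt (lintegral_mono fun x => ?_) (h.expInt_lt_top (a := 4 * Real.pi) (by positivity))
  rw [Real.enorm_eq_ofReal (potential_nonneg _)]
  exact ENNReal.ofReal_le_ofReal (potential_le _)

theorem L2C.re_inner (v w : L2C) : (inner ℂ v w).re = ∫ x, inner ℝ (v x) (w x) := by
  rw [L2.inner_def]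
  exact (integral_re (L2.integrable_inner (𝕜 := ℂ) v w)).symm

theorem L2C.integrable_inner_real (v w : L2C) : Integrable fun x => (inner ℝ (v x) (w x) : ℝ) :=
  (L2.integrable_inner (𝕜 := ℂ) v w).re

theorem abs_potDefect_le {v w : L2C} {g k : Fin 2 → L2C} (hv : HasGrad v g) (hw : HasGrad w k) :
    ENNReal.ofReal |potDefect v w| ≤
      5 * ∫⁻ x, ‖(w - v : L2C) x‖ₑ ^ 2 * ‖expWeight (v x) + expWeight (w x)‖ₑ := by
  have e1 : potDefect v w = ∫ x, (potential (w x) - potential (v x) -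
      inner ℝ ((nlOp v + nlOp w : L2C) x) ((w - v : L2C) x)) := by
    rw [potDefect, L2C.re_inner, potInt, potInt, ← integral_sub hw.integrable_potential hv.integrable_potential,
      ← integral_sub (by exact hw.integrable_potential.sub hv.integrable_potential) (L2C.integrable_inner_real _ _)]
  rw [e1, ← Real.norm_eq_abs, ofReal_norm]
  refine (enorm_integral_le_lintegral_enorm _).trans ?_
  rw [← lintegral_const_mul' _ _ (by simp)]
  apply lintegral_mono_ae
  filter_upwards [Lp.coeFn_add (nlOp v) (nlOp w), Lp.coeFn_sub w v, hv.coeFn_nlOp, hw.coeFn_nlOp] with x h1 h2 h3 h4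
  rw [h1, h2, Pi.add_apply, Pi.sub_apply, h3, h4]
  have h5 := abs_potential_sub_sub_le (v x) (w x)
  rw [← ofReal_norm, ← ofReal_norm, ← ofReal_norm, Real.norm_eq_abs, Real.norm_of_nonneg
    (add_nonneg (expWeight_nonneg _) (expWeight_nonneg _)), ← ENNReal.ofReal_pow (norm_nonneg _),
    ← ENNReal.ofReal_mul (by positivity), show (5 : ENNReal) = ENNReal.ofReal 5 by simp, ← ENNReal.ofReal_mul (by norm_num)]
  exact ENNReal.ofReal_le_ofReal h5

/-- Hölder with exponents 5/4 and 5. The power 5/2 is the one obtained by testing the equation with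
|w|^{1/2} w. -/
theorem lintegral_sq_mul_le {w : Plane → ℂ} {e : Plane → ℝ} (hw : AEStronglyMeasurable w)
    (he : AEStronglyMeasurable e) :
    ∫⁻ x, ‖w x‖ₑ ^ 2 * ‖e x‖ₑ ≤ (∫⁻ x, ‖w x‖ₑ ^ (5 / 2 : ℝ)) ^ (4 / 5 : ℝ) * eLpNorm e 5 volume := by
  have hpq : (5 / 4 : ℝ).HolderConjugate 5 := by constructor <;> norm_num
  have h1 := ENNReal.lintegral_mul_le_Lp_mul_Lq volume hpq (f := fun x => ‖w x‖ₑ ^ 2) (g := fun x => ‖e x‖ₑ)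
    (hw.enorm.pow_const 2) he.enorm
  refine h1.trans (le_of_eq ?_)
  rw [eLpNorm_eq_lintegral_rpow_enorm_toReal (by norm_num) (by norm_num)]
  simp only [ENNReal.toReal_ofNat]
  congr 2
  · refine lintegral_congr fun x => ?_
    rw [← ENNReal.rpow_natCast, ← ENNReal.rpow_mul]; norm_num
  · norm_num

/-- A crude bound by the powers 2 and 4, enough for the continuity of the potential energy. -/
theorem lintegral_five_halves_le (w : L2C) :
    ∫⁻ x, ‖w x‖ₑ ^ (5 / 2 : ℝ) ≤ ENNReal.ofReal (‖w‖ ^ 2) + eLpNorm w 4 volume ^ 4 := by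
  have e4 : eLpNorm w 4 volume ^ 4 = ∫⁻ x, ‖w x‖ₑ ^ (4 : ℝ) := by
    rw [eLpNorm_eq_lintegral_rpow_enorm_toReal (by norm_num) (by norm_num), ← ENNReal.rpow_natCast, ← ENNReal.rpow_mul]
    norm_num
  have e2 := L2C.lintegral_sq w
  rw [e4, ← e2, ← lintegral_add_left']
  · refine lintegral_mono fun x => ?_
    rw [ENNReal.ofReal_pow (norm_nonneg _), ofReal_norm]
    rcases le_total ‖w x‖ₑ 1 with h | h
    · refine le_add_right ?_
      rw [← ENNReal.rpow_natCast]
      exact ENNReal.rpow_le_rpow_of_exponent_ge h (by norm_num)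
    · exact le_add_left (ENNReal.rpow_le_rpow_of_exponent_le h (by norm_num))
  · exact ((Lp.memLp w).1.norm.aemeasurable.pow_const 2).ennreal_ofReal

theorem ofReal_abs_potDefect_le {v w : L2C} {g k : Fin 2 → L2C} (hv : HasGrad v g) (hw : HasGrad w k) :
    ENNReal.ofReal |potDefect v w| ≤ 5 * ((∫⁻ x, ‖(w - v : L2C) x‖ₑ ^ (5 / 2 : ℝ)) ^ (4 / 5 : ℝ) *
      (eLpNorm (fun x => expWeight (v x)) 5 volume + eLpNorm (fun x => expWeight (w x)) 5 volume)) := by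
  refine (abs_potDefect_le hv hw).trans ?_
  gcongr
  refine (lintegral_sq_mul_le (Lp.memLp _).1
    ((aestronglyMeasurable_expWeight v).add (aestronglyMeasurable_expWeight w))).trans ?_
  gcongr
  exact eLpNorm_add_le (aestronglyMeasurable_expWeight v) (aestronglyMeasurable_expWeight w) (by norm_num)

/-! ### Testing the equation with a power of the increment. -/

/-- A smooth regularization of `|z|^{1/2} z`. -/
def regPow (δ : ℝ) (z : ℂ) : ℂ := ((‖z‖ ^ 2 + δ ^ 4) ^ (1 / 4 : ℝ) : ℝ) • z

variable {δ : ℝ}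

theorem hasFDerivAt_regPow (hδ : 0 < δ) (z : ℂ) : HasFDerivAt (regPow δ)
    (((‖z‖ ^ 2 + δ ^ 4) ^ (1 / 4 : ℝ) : ℝ) • ContinuousLinearMap.id ℝ ℂ +
      ((((1 / 4 : ℝ) * (‖z‖ ^ 2 + δ ^ 4) ^ (1 / 4 - 1 : ℝ)) • ((2 : ℝ) • innerSL ℝ z)).smulRight z)) z := by
  have h1 : HasFDerivAt (fun z : ℂ => ‖z‖ ^ 2 + δ ^ 4) ((2 : ℝ) • innerSL ℝ z) z := by
    have h2 := (hasStrictFDerivAt_norm_sq z).hasFDerivAt.add_const (δ ^ 4)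
    rwa [← Nat.cast_smul_eq_nsmul ℝ, Nat.cast_ofNat] at h2
  have h2 := h1.rpow_const (p := 1 / 4) (Or.inl (by positivity))
  exact h2.smul (hasFDerivAt_id z)

theorem contDiff_regPow (hδ : 0 < δ) : ContDiff ℝ 1 (regPow δ) := by
  have h1 : ContDiff ℝ 1 fun z : ℂ => ‖z‖ ^ 2 := contDiff_norm_sq ℝ
  have h2 : ContDiff ℝ 1 fun z : ℂ => (‖z‖ ^ 2 + δ ^ 4) ^ (1 / 4 : ℝ) :=
    (h1.add contDiff_const).rpow_const_of_ne fun z => by positivity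
  exact h2.smul contDiff_id

/-- The parameter enters `regPow` as δ⁴ so that after the fourth root it costs only an additive δ.
-/
theorem rpow_quarter_le (hδ : 0 < δ) (z : ℂ) : (‖z‖ ^ 2 + δ ^ 4) ^ (1 / 4 : ℝ) ≤ Real.sqrt ‖z‖ + δ := by
  have h0 : 0 ≤ Real.sqrt ‖z‖ := Real.sqrt_nonneg _
  have h1 : ‖z‖ ^ 2 + δ ^ 4 ≤ (Real.sqrt ‖z‖ + δ) ^ 4 := by
    have : ‖z‖ ^ 2 = Real.sqrt ‖z‖ ^ 4 := by
      rw [show 4 = 2 * 2 by rfl, pow_mul, Real.sq_sqrt (norm_nonneg _)]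
    rw [this]
    have : 0 ≤ Real.sqrt ‖z‖ ^ 3 * δ + Real.sqrt ‖z‖ ^ 2 * δ ^ 2 + Real.sqrt ‖z‖ * δ ^ 3 := by positivity
    nlinarith [show 0 ≤ Real.sqrt ‖z‖ ^ 2 * δ ^ 2 by positivity, show 0 ≤ Real.sqrt ‖z‖ ^ 3 * δ by positivity,
      show 0 ≤ Real.sqrt ‖z‖ * δ ^ 3 by positivity]
  calc (‖z‖ ^ 2 + δ ^ 4) ^ (1 / 4 : ℝ) ≤ ((Real.sqrt ‖z‖ + δ) ^ 4) ^ (1 / 4 : ℝ) := by gcongr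
    _ = _ := by
      rw [← Real.rpow_natCast, ← Real.rpow_mul (by positivity)]; norm_num

theorem norm_regPow_le (hδ : 0 < δ) (z : ℂ) : ‖regPow δ z‖ ≤ (Real.sqrt ‖z‖ + δ) * ‖z‖ := by
  rw [regPow, norm_smul, Real.norm_of_nonneg (by positivity)]
  gcongr
  exact rpow_quarter_le hδ z

theorem le_inner_regPow (hδ : 0 < δ) (z : ℂ) : ‖z‖ ^ (5 / 2 : ℝ) ≤ inner ℝ (regPow δ z) z := by
  rw [regPow, real_inner_smul_left, real_inner_self_eq_norm_sq]
  have h1 : (‖z‖ ^ 2) ^ (1 / 4 : ℝ) ≤ (‖z‖ ^ 2 + δ ^ 4) ^ (1 / 4 : ℝ) := by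
    gcongr; linarith [show 0 < δ ^ 4 by positivity]
  calc ‖z‖ ^ (5 / 2 : ℝ) = (‖z‖ ^ 2) ^ (1 / 4 : ℝ) * ‖z‖ ^ 2 := by
        rw [← Real.rpow_natCast, ← Real.rpow_mul (norm_nonneg _), ← Real.rpow_add_of_nonneg (norm_nonneg _) (by norm_num) (by norm_num)]
        norm_num
    _ ≤ _ := by gcongr

theorem norm_fderiv_regPow_le (hδ : 0 < δ) (z : ℂ) :
    ‖fderiv ℝ (regPow δ) z‖ ≤ 3 / 2 * (Real.sqrt ‖z‖ + δ) := by
  rw [(hasFDerivAt_regPow hδ z).fderiv]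
  have hA : 0 < ‖z‖ ^ 2 + δ ^ 4 := by positivity
  have h1 : ‖(((1 / 4 : ℝ) * (‖z‖ ^ 2 + δ ^ 4) ^ (1 / 4 - 1 : ℝ)) • ((2 : ℝ) • innerSL ℝ z)).smulRight z‖ ≤
      1 / 2 * (‖z‖ ^ 2 + δ ^ 4) ^ (1 / 4 : ℝ) := by
    rw [ContinuousLinearMap.norm_smulRight_apply, norm_smul, norm_smul, innerSL_apply_norm, Real.norm_of_nonneg (by positivity),
      Real.norm_of_nonneg (by norm_num)]
    have : (‖z‖ ^ 2 + δ ^ 4) ^ (1 / 4 : ℝ) = (‖z‖ ^ 2 + δ ^ 4) ^ (1 / 4 - 1 : ℝ) * (‖z‖ ^ 2 + δ ^ 4) := by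
      rw [Real.rpow_sub_one hA.ne']; field_simp
    rw [this]
    have h2 : 0 ≤ (‖z‖ ^ 2 + δ ^ 4) ^ (1 / 4 - 1 : ℝ) := by positivity
    nlinarith [mul_nonneg h2 (show 0 ≤ δ ^ 4 by positivity)]
  have h3 : ‖((‖z‖ ^ 2 + δ ^ 4) ^ (1 / 4 : ℝ) : ℝ) • ContinuousLinearMap.id ℝ ℂ‖ ≤ (‖z‖ ^ 2 + δ ^ 4) ^ (1 / 4 : ℝ) := by
    rw [norm_smul, Real.norm_of_nonneg (by positivity)]
    exact mul_le_of_le_one_right (by positivity) ContinuousLinearMap.norm_id_le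
  refine (norm_add_le _ _).trans ?_
  linarith [rpow_quarter_le hδ z]


/-- The `L⁴` norm as a real number. -/
def normFour (y : L2C) : ℝ := (eLpNorm y 4 volume).toReal

/-- Hölder with exponents 4 and 4: the L⁴ norm of |w|^{1/2} is the square root of the L² norm of w.
-/
theorem memLp_of_le_sqrt_mul {w y : L2C} (hy : MemLp y 4 volume) (hδ : 0 ≤ δ) {f : Plane → ℂ}
    (hf : AEStronglyMeasurable f) (hfy : ∀ᵐ x, ‖f x‖ ≤ (Real.sqrt ‖w x‖ + δ) * ‖y x‖) :
    ∃ z : L2C, z =ᵐ[volume] f ∧ ‖z‖ ≤ Real.sqrt ‖w‖ * normFour y + δ * ‖y‖ := by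
  have h2 := Lp.memLp y
  have hs : AEStronglyMeasurable (fun x => Real.sqrt ‖w x‖) volume :=
    Real.continuous_sqrt.comp_aestronglyMeasurable (Lp.memLp w).1.norm
  have h1 : eLpNorm f 2 volume ≤ eLpNorm w 2 volume ^ (1 / 2 : ℝ) * eLpNorm y 4 volume + ENNReal.ofReal δ * eLpNorm y 2 volume := by
    calc eLpNorm f 2 volume ≤ eLpNorm ((fun x => Real.sqrt ‖w x‖ * ‖y x‖) + fun x => δ * ‖y x‖) 2 volume := by
          apply eLpNorm_mono_ae
          filter_upwards [hfy] with x hx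
          refine hx.trans ((le_of_eq ?_).trans (le_abs_self _))
          simp only [Pi.add_apply]; ring
      _ ≤ eLpNorm (fun x => Real.sqrt ‖w x‖ * ‖y x‖) 2 volume + eLpNorm (fun x => δ * ‖y x‖) 2 volume :=
          eLpNorm_add_le (hs.mul h2.1.norm) (h2.1.norm.const_mul δ) (by norm_num)
      _ ≤ _ := by
          gcongr
          · have h3 : eLpNorm (fun x => Real.sqrt ‖w x‖ * ‖y x‖) 2 volume ≤
                eLpNorm (fun x => Real.sqrt ‖w x‖) 4 volume * eLpNorm (fun x => ‖y x‖) 4 volume :=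
              eLpNorm_smul_le_mul_eLpNorm (p := 4) (q := 4) (r := 2) (μ := (volume : Measure Plane))
                (f := fun x => ‖y x‖) (φ := fun x => Real.sqrt ‖w x‖) h2.1.norm hs
            rw [eLpNorm_norm] at h3
            refine h3.trans (le_of_eq ?_)
            have h4 := eLpNorm_norm_rpow (p := 4) (μ := volume) (w : Plane → ℂ) (q := 1 / 2) (by norm_num)
            simp only [← Real.sqrt_eq_rpow] at h4
            rw [h4]
            congr 3
            rw [← ENNReal.toReal_eq_toReal_iff' (ENNReal.mul_ne_top (by simp) (by simp)) (by simp), ENNReal.toReal_mul,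
              ENNReal.toReal_ofReal (by norm_num)]
            norm_num
          · have := eLpNorm_const_smul_le (p := 2) (μ := (volume : Measure Plane)) (c := δ) (f := fun x => ‖y x‖)
            rw [eLpNorm_norm, Real.enorm_eq_ofReal hδ] at this
            exact this
  have hfin : eLpNorm w 2 volume ^ (1 / 2 : ℝ) * eLpNorm y 4 volume + ENNReal.ofReal δ * eLpNorm y 2 volume < ⊤ :=
    ENNReal.add_lt_top.2 ⟨ENNReal.mul_lt_top (ENNReal.rpow_lt_top_of_nonneg (by norm_num) (Lp.memLp w).2.ne) hy.2,
      ENNReal.mul_lt_top ENNReal.ofReal_lt_top h2.2⟩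
  have hm : MemLp f 2 volume := ⟨hf, h1.trans_lt hfin⟩
  refine ⟨hm.toLp f, hm.coeFn_toLp, ?_⟩
  rw [Lp.norm_toLp]
  refine (ENNReal.toReal_mono hfin.ne h1).trans (le_of_eq ?_)
  rw [ENNReal.toReal_add (ENNReal.add_lt_top.1 hfin).1.ne (ENNReal.add_lt_top.1 hfin).2.ne, ENNReal.toReal_mul,
    ENNReal.toReal_mul, ENNReal.toReal_ofReal hδ, ← ENNReal.toReal_rpow, Real.sqrt_eq_rpow]
  rfl

theorem integrable_sqrt_mul_test {w y : L2C} (hy : MemLp y 4 volume) (hδ : 0 ≤ δ) (φ : Test) :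
    Integrable fun x => (Real.sqrt ‖w x‖ + δ) * ‖y x‖ * |φ x| := by
  have hs : AEStronglyMeasurable (fun x => Real.sqrt ‖w x‖) volume :=
    Real.continuous_sqrt.comp_aestronglyMeasurable (Lp.memLp w).1.norm
  obtain ⟨z, hz, -⟩ := memLp_of_le_sqrt_mul (w := w) (f := fun x => ((Real.sqrt ‖w x‖ + δ : ℝ) : ℂ) * (‖y x‖ : ℂ)) hy hδ
    ((Complex.continuous_ofReal.comp_aestronglyMeasurable (hs.add_const δ)).mul
      (Complex.continuous_ofReal.comp_aestronglyMeasurable (Lp.memLp y).1.norm))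
    (Eventually.of_forall fun x => by
      rw [norm_mul, Complex.norm_real, Complex.norm_real, norm_norm, Real.norm_of_nonneg (by positivity)])
  refine (integrable_mul_test z φ).norm.congr ?_
  filter_upwards [hz] with x hx
  rw [hx, norm_mul, norm_mul, Complex.norm_real, Complex.norm_real, Complex.norm_real, norm_norm, Real.norm_of_nonneg (by positivity)]
  rfl

/-- The gradient of |w|^{1/2} w is at most (3/2)|w|^{1/2}|∇w|, square integrable when ∇w is in L⁴.
The W^{1,4} regularity serves to make this an H¹ test function. -/
theorem HasGrad.exists_regPow {w : L2C} {k : Fin 2 → L2C} (h : HasGrad w k) (hk : ∀ j, MemLp (k j) 4 volume) (hδ : 0 < δ) :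
    ∃ (y : L2C) (l : Fin 2 → L2C), HasGrad y l ∧ (y =ᵐ[volume] fun x => regPow δ (w x)) ∧
      ‖y‖ ≤ Real.sqrt ‖w‖ * normFour w + δ * ‖w‖ ∧
      ∀ j, ‖l j‖ ≤ 3 / 2 * (Real.sqrt ‖w‖ * normFour (k j) + δ * ‖k j‖) := by
  have hC := contDiff_regPow hδ
  obtain ⟨y, hy, hyn⟩ := memLp_of_le_sqrt_mul (w := w) h.memLp_four hδ.le
    (hC.continuous.comp_aestronglyMeasurable (Lp.memLp w).1) (Eventually.of_forall fun x => norm_regPow_le hδ (w x))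
  have hl : ∀ j, ∃ z : L2C, (z =ᵐ[volume] fun x => fderiv ℝ (regPow δ) (w x) (k j x)) ∧
      ‖z‖ ≤ 3 / 2 * (Real.sqrt ‖w‖ * normFour (k j) + δ * ‖k j‖) := by
    intro j
    have hmeas := aestronglyMeasurable_fderiv_apply hC (Lp.memLp w).1 (Lp.memLp (k j)).1
    obtain ⟨z, hz, hzn⟩ := memLp_of_le_sqrt_mul (w := w) (hk j) hδ.le
      (f := fun x => (2 / 3 : ℂ) * fderiv ℝ (regPow δ) (w x) (k j x)) (hmeas.const_mul _) (Eventually.of_forall fun x => by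
        rw [norm_mul]
        have h1 := (fderiv ℝ (regPow δ) (w x)).le_of_opNorm_le (norm_fderiv_regPow_le hδ (w x)) (k j x)
        have h2 : ‖(2 / 3 : ℂ)‖ = 2 / 3 := by simp
        rw [h2]; linarith)
    refine ⟨(3 / 2 : ℂ) • z, ?_, ?_⟩
    · filter_upwards [Lp.coeFn_smul (3 / 2 : ℂ) z, hz] with x h1 h2
      rw [h1, Pi.smul_apply, h2, smul_eq_mul]; ring
    · rw [norm_smul]
      have h2 : ‖(3 / 2 : ℂ)‖ = 3 / 2 := by simp
      rw [h2]; gcongr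
  choose l hl hln using hl
  refine ⟨y, l, fun φ j => ?_, hy, hyn, hln⟩
  rw [Test.inner_toL2, Test.inner_toL2]
  have e1 : ∫ x, y x * (φ.pd j x : ℂ) = ∫ x, regPow δ (w x) * (φ.pd j x : ℂ) := by
    apply integral_congr_ae
    filter_upwards [hy] with x hx
    rw [hx]
  have e2 : ∫ x, l j x * (φ x : ℂ) = ∫ x, fderiv ℝ (regPow δ) (w x) (k j x) * (φ x : ℂ) := by
    apply integral_congr_ae
    filter_upwards [hl j] with x hx
    rw [hx]
  rw [e1, e2]
  refine h.chain hC (b₀ := fun s => (Real.sqrt s + δ) * s) (b₁ := fun s => 3 / 2 * (Real.sqrt s + δ)) (norm_regPow_le hδ)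
    (norm_fderiv_regPow_le hδ) ?_ ?_ φ j (integrable_sqrt_mul_test h.memLp_four hδ.le _) ?_
  · intro s t hs hst
    have := Real.sqrt_le_sqrt hst
    exact mul_le_mul (by linarith) hst hs (by positivity)
  · intro s t hs hst
    have := Real.sqrt_le_sqrt hst
    show 3 / 2 * (Real.sqrt s + δ) ≤ 3 / 2 * (Real.sqrt t + δ)
    linarith
  · refine ((integrable_sqrt_mul_test (w := w) (hk j) hδ.le φ).const_mul (3 / 2)).congr (Eventually.of_forall fun x => ?_)
    ring

namespace IsFlow

variable {U : ℝ → L2C} {G : ℝ → Fin 2 → L2C}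

theorem norm_inner_sub_le (h : IsFlow U G) {φ : L2C} {k : Fin 2 → L2C} (hφ : HasGrad φ k) {B s t : ℝ}
    (hG : ∀ r ∈ Set.uIcc s t, ∀ j, ‖G r j‖ ≤ B) (hN : ∀ r ∈ Set.uIcc s t, ‖nlOp (U r)‖ ≤ B) :
    ‖inner ℂ φ (U t - U s)‖ ≤ B * (∑ j, ‖k j‖ + ‖φ‖) * |t - s| := by
  rw [inner_sub_right, h.integral_inner_eq hφ]
  apply intervalIntegral.norm_integral_le_of_norm_le_const
  intro r hr
  have hr := Set.uIoc_subset_uIcc hr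
  rw [norm_mul, norm_neg, Complex.norm_I, one_mul, mul_add, Finset.mul_sum]
  refine (norm_add_le _ _).trans (add_le_add ((norm_sum_le _ _).trans (Finset.sum_le_sum fun j _ => ?_)) ?_)
  · refine (norm_inner_le_norm _ _).trans ?_
    rw [mul_comm]
    gcongr
    exact hG r hr j
  · refine (norm_inner_le_norm _ _).trans ?_
    rw [mul_comm]
    gcongr
    exact hN r hr

/-- The pairing of w with the regularized |w|^{1/2} w dominates the integral of |w|^{5/2}, and the
equation bounds it by the time step times an H¹ norm. The regularization parameter then tends to
zero. -/
theorem lintegral_sub_le (h : IsFlow U G) {B s t : ℝ} (hB : 0 ≤ B)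
    (hG : ∀ r ∈ Set.uIcc s t, ∀ j, ‖G r j‖ ≤ B) (hN : ∀ r ∈ Set.uIcc s t, ‖nlOp (U r)‖ ≤ B)
    (h4 : ∀ j, MemLp (G t j - G s j : L2C) 4 volume) :
    ∫⁻ x, ‖(U t - U s : L2C) x‖ₑ ^ (5 / 2 : ℝ) ≤ ENNReal.ofReal (B * (3 / 2 * Real.sqrt ‖U t - U s‖ *
      (∑ j, normFour (G t j - G s j) + normFour (U t - U s))) * |t - s|) := by
  set w := U t - U s with hw
  have hwg : HasGrad w (fun j => G t j - G s j) := (h.grad t).sub (h.grad s)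
  have q0 : ∀ y : L2C, 0 ≤ normFour y := fun y => ENNReal.toReal_nonneg
  have hδ : ∀ δ : ℝ, 0 < δ → ∫⁻ x, ‖w x‖ₑ ^ (5 / 2 : ℝ) ≤ ENNReal.ofReal (B * (3 / 2 * Real.sqrt ‖w‖ *
      (∑ j, normFour (G t j - G s j) + normFour w) + δ * (3 / 2 * ∑ j, ‖G t j - G s j‖ + ‖w‖)) * |t - s|) := by
    intro δ hδ
    obtain ⟨y, l, hyl, hy, hyn, hln⟩ := hwg.exists_regPow h4 hδ
    have h1 := h.norm_inner_sub_le hyl hG hN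
    have h2 : ∫⁻ x, ‖w x‖ₑ ^ (5 / 2 : ℝ) ≤ ENNReal.ofReal (inner ℂ y w).re := by
      rw [L2C.re_inner, ofReal_integral_eq_lintegral_ofReal (L2C.integrable_inner_real _ _)]
      · apply lintegral_mono_ae
        filter_upwards [hy] with x hx
        rw [hx, ← ofReal_norm, ENNReal.ofReal_rpow_of_nonneg (norm_nonneg _) (by norm_num)]
        exact ENNReal.ofReal_le_ofReal (le_inner_regPow hδ _)
      · filter_upwards [hy] with x hx
        rw [hx]
        exact (Real.rpow_nonneg (norm_nonneg _) _).trans (le_inner_regPow hδ (w x))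
    refine h2.trans (ENNReal.ofReal_le_ofReal (((Complex.re_le_norm _).trans h1).trans ?_))
    have h3 := Finset.sum_le_sum fun j (_ : j ∈ Finset.univ) => hln j
    rw [← Finset.mul_sum, Finset.sum_add_distrib, ← Finset.mul_sum, ← Finset.mul_sum] at h3
    have h4 : 0 ≤ Real.sqrt ‖w‖ * normFour w := mul_nonneg (Real.sqrt_nonneg _) (q0 _)
    have h5 : ∑ j, ‖l j‖ + ‖y‖ ≤ 3 / 2 * Real.sqrt ‖w‖ * (∑ j, normFour (G t j - G s j) + normFour w) +
        δ * (3 / 2 * ∑ j, ‖G t j - G s j‖ + ‖w‖) := by linarith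
    gcongr
  have hlim : Tendsto (fun δ : ℝ => ENNReal.ofReal (B * (3 / 2 * Real.sqrt ‖w‖ *
      (∑ j, normFour (G t j - G s j) + normFour w) + δ * (3 / 2 * ∑ j, ‖G t j - G s j‖ + ‖w‖)) * |t - s|)) (𝓝[>] 0)
      (𝓝 (ENNReal.ofReal (B * (3 / 2 * Real.sqrt ‖w‖ * (∑ j, normFour (G t j - G s j) + normFour w)) * |t - s|))) := by
    apply (ENNReal.continuous_ofReal.tendsto _).comp
    refine tendsto_nhdsWithin_of_tendsto_nhds (Continuous.tendsto' (by fun_prop) _ _ (by simp))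
  refine ge_of_tendsto hlim ?_
  filter_upwards [self_mem_nhdsWithin] with δ h
  exact hδ δ h

end IsFlow

theorem eLpNorm_four_le_expInt (v : L2C) : eLpNorm v 4 volume ≤ (ENNReal.ofReal 2 * expInt 1 v) ^ (1 / 4 : ℝ) := by
  rw [eLpNorm_eq_lintegral_rpow_enorm_toReal (by norm_num) (by norm_num)]
  simp only [ENNReal.toReal_ofNat]
  gcongr
  rw [expInt, ← lintegral_const_mul' _ _ ENNReal.ofReal_ne_top]
  refine lintegral_mono fun x => ?_
  rw [show (4 : ℝ) = ((4 : ℕ) : ℝ) by norm_num, ENNReal.rpow_natCast, ← ofReal_norm,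
    ← ENNReal.ofReal_pow (norm_nonneg _), ← ENNReal.ofReal_mul (by norm_num)]
  apply ENNReal.ofReal_le_ofReal
  have := Real.quadratic_le_exp_of_nonneg (x := ‖v x‖ ^ 2) (by positivity)
  rw [one_mul]
  nlinarith [sq_nonneg (‖v x‖)]

theorem normFour_nonneg (v : L2C) : 0 ≤ normFour v := ENNReal.toReal_nonneg

theorem normFour_sub_le {v w : L2C} (hv : MemLp v 4 volume) (hw : MemLp w 4 volume) :
    normFour (v - w) ≤ normFour v + normFour w := by
  unfold normFour
  rw [← ENNReal.toReal_add hv.2.ne hw.2.ne, eLpNorm_congr_ae (Lp.coeFn_sub v w)]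
  exact ENNReal.toReal_mono (ENNReal.add_lt_top.2 ⟨hv.2, hw.2⟩).ne (eLpNorm_sub_le hv.1 hw.1 (by norm_num))

/-- Fatou along an almost everywhere convergent subsequence. The L⁴ norm is not continuous on L²,
but this gives its measurability in time. -/
theorem lowerSemicontinuous_eLpNorm_four : LowerSemicontinuous fun v : L2C => eLpNorm v 4 volume := by
  rw [lowerSemicontinuous_iff_isClosed_preimage]
  intro y
  apply IsSeqClosed.isClosed
  intro V v hV hv
  obtain ⟨ns, -, hns⟩ := exists_subseq_ae hv
  refine (Lp.eLpNorm_lim_le_liminf_eLpNorm (fun n => (Lp.memLp (V (ns n))).1) v hns).trans ?_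
  refine (liminf_le_liminf (v := fun _ : ℕ => y) (Eventually.of_forall fun n => hV (ns n))).trans ?_
  simp

theorem potDefect_self (v : L2C) : potDefect v v = 0 := by simp [potDefect]

namespace IsFlow

variable {U : ℝ → L2C} {G : ℝ → Fin 2 → L2C}

theorem exists_normFour_le (h : IsFlow U G) (T : ℝ) : ∃ W, 0 ≤ W ∧ ∀ t ∈ Set.Icc (-T) T, normFour (U t) ≤ W := by
  obtain ⟨C, hC, hb⟩ := h.exists_expInt_le one_pos T
  refine ⟨((ENNReal.ofReal 2 * C) ^ (1 / 4 : ℝ)).toReal, ENNReal.toReal_nonneg, fun t ht => ?_⟩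
  refine ENNReal.toReal_mono (ENNReal.rpow_lt_top_of_nonneg (by norm_num) (ENNReal.mul_lt_top ENNReal.ofReal_lt_top hC).ne).ne
    ((eLpNorm_four_le_expInt _).trans ?_)
  gcongr
  exact hb t ht

theorem exists_norm_le (h : IsFlow U G) (T : ℝ) : ∃ B, 0 < B ∧ ∀ t ∈ Set.Icc (-T) T,
    (∀ j, ‖G t j‖ ≤ B) ∧ ‖nlOp (U t)‖ ≤ B := by
  have hc : Continuous fun t => ∑ j, ‖G t j‖ + ‖nlOp (U t)‖ := by
    have := h.contG
    have := h.continuous_nlOp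
    fun_prop
  obtain ⟨B, hB⟩ := (isCompact_Icc (a := -T) (b := T)).exists_bound_of_continuousOn hc.continuousOn
  refine ⟨max B 1, by positivity, fun t ht => ?_⟩
  have h1 := (le_abs_self _).trans ((hB t ht).trans (le_max_left B 1))
  have h2 : ∀ j, 0 ≤ ‖G t j‖ := fun j => norm_nonneg _
  refine ⟨fun j => ?_, ?_⟩
  · have := Finset.single_le_sum (fun j _ => h2 j) (Finset.mem_univ j)
    linarith [norm_nonneg (nlOp (U t))]
  · have := Finset.sum_nonneg fun j (_ : j ∈ Finset.univ) => h2 j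
    linarith

/-- The trapezoidal error is of smaller order than the time step. -/
theorem exists_potDefect_le (h : IsFlow U G) (T : ℝ) {ε : ℝ} (hε : 0 < ε) : ∃ δ > 0,
    ∀ s ∈ Set.Icc (-T) T, ∀ t ∈ Set.Icc (-T) T, |t - s| < δ →
      ENNReal.ofReal |potDefect (U s) (U t)| ≤ ENNReal.ofReal (ε * |t - s|) *
        (1 + ∑ j, (eLpNorm (G s j) 4 volume + eLpNorm (G t j) 4 volume)) := by
  obtain ⟨W, hW0, hW⟩ := h.exists_normFour_le T
  obtain ⟨B, hB0, hB⟩ := h.exists_norm_le T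
  obtain ⟨Γ', hΓ', hΓt⟩ := h.exists_eLpNorm_expWeight_le (n := 5) (by norm_num) T
  obtain ⟨Γ, rfl⟩ : ∃ Γ : NNReal, Γ' = Γ := ⟨Γ'.toNNReal, (ENNReal.coe_toNNReal hΓ'.ne).symm⟩
  set κ : ℝ := ε / (10 * Γ + 1) with hκ
  have hκ0 : 0 < κ := by positivity
  set D : ℝ := (3 / 2 * B) ^ 4 * B * (1 + 2 * W) ^ 4 with hD
  have hD0 : 0 < D := by positivity
  -- The estimates below give x⁴ ≤ D η τ⁵ (1 + Q)⁵; this η turns it into x^{4/5} ≤ κ τ (1 + Q), and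
  -- κ absorbs the weights.
  set η : ℝ := κ ^ 5 / D with hη
  have hη0 : 0 < η := by positivity
  have huc : ∃ δ > 0, ∀ s ∈ Set.Icc (-T) T, ∀ t ∈ Set.Icc (-T) T, |t - s| < δ →
      ∑ j, ‖G t j - G s j‖ + ‖U t - U s‖ ≤ η := by
    have hc : Continuous fun t => (G t 0, G t 1, U t) := by
      have := h.contG
      have := h.contU
      fun_prop
    obtain ⟨δ, hδ, hu⟩ := Metric.uniformContinuousOn_iff.1
      (isCompact_Icc.uniformContinuousOn_of_continuous (hc.continuousOn (s := Set.Icc (-T) T))) (η / 3) (by positivity)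
    refine ⟨δ, hδ, fun s hs t ht hst => ?_⟩
    have h1 := hu t ht s hs (by rwa [Real.dist_eq])
    rw [dist_eq_norm] at h1
    have h2 : ‖G t 0 - G s 0‖ < η / 3 := (norm_fst_le _).trans_lt h1
    have h3 : ‖((G t 1, U t) - (G s 1, U s) : L2C × L2C)‖ < η / 3 := (norm_snd_le _).trans_lt h1
    have h4 : ‖G t 1 - G s 1‖ < η / 3 := (norm_fst_le _).trans_lt h3
    have h5 : ‖U t - U s‖ < η / 3 := (norm_snd_le _).trans_lt h3
    rw [Fin.sum_univ_two]
    linarith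
  obtain ⟨δ, hδ, hu⟩ := huc
  refine ⟨δ, hδ, fun s hs t ht hst => ?_⟩
  rcases eq_or_ne s t with rfl | hne
  · simp [potDefect_self]
  have hτ : 0 < |t - s| := abs_pos.2 (sub_ne_zero.2 hne.symm)
  set τ := |t - s| with hτd
  by_cases hfin : ∑ j, (eLpNorm (G s j) 4 volume + eLpNorm (G t j) 4 volume) = ⊤
  · rw [hfin, add_top, ENNReal.mul_top (by simp; positivity)]
    exact le_top
  have hfin' : ∀ j, eLpNorm (G s j) 4 volume < ⊤ ∧ eLpNorm (G t j) 4 volume < ⊤ := fun j =>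
    ENNReal.add_lt_top.1 (ENNReal.sum_lt_top.1 (lt_top_iff_ne_top.2 hfin) j (Finset.mem_univ j))
  have hs4 : ∀ j, MemLp (G s j) 4 volume := fun j => ⟨(Lp.memLp _).1, (hfin' j).1⟩
  have ht4 : ∀ j, MemLp (G t j) 4 volume := fun j => ⟨(Lp.memLp _).1, (hfin' j).2⟩
  have hd4 : ∀ j, MemLp (G t j - G s j : L2C) 4 volume := fun j =>
    (memLp_congr_ae (Lp.coeFn_sub _ _)).2 ((ht4 j).sub (hs4 j))
  set Q := ∑ j, (normFour (G s j) + normFour (G t j)) with hQ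
  have hQ0 : 0 ≤ Q := Finset.sum_nonneg fun j _ => add_nonneg (normFour_nonneg _) (normFour_nonneg _)
  have hQe : ∑ j, (eLpNorm (G s j) 4 volume + eLpNorm (G t j) 4 volume) = ENNReal.ofReal Q := by
    rw [hQ, ENNReal.ofReal_sum_of_nonneg fun j _ => add_nonneg (normFour_nonneg _) (normFour_nonneg _)]
    refine Finset.sum_congr rfl fun j _ => ?_
    rw [ENNReal.ofReal_add (normFour_nonneg _) (normFour_nonneg _), normFour, normFour,
      ENNReal.ofReal_toReal (hfin' j).1.ne, ENNReal.ofReal_toReal (hfin' j).2.ne]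
  have hsub : Set.uIcc s t ⊆ Set.Icc (-T) T := Set.uIcc_subset_Icc hs ht
  have hGB : ∀ r ∈ Set.uIcc s t, ∀ j, ‖G r j‖ ≤ B := fun r hr => (hB r (hsub hr)).1
  have hNB : ∀ r ∈ Set.uIcc s t, ‖nlOp (U r)‖ ≤ B := fun r hr => (hB r (hsub hr)).2
  have hX := h.lintegral_sub_le hB0.le hGB hNB hd4
  set w := U t - U s with hw
  have hwg : HasGrad w (fun j => G t j - G s j) := (h.grad t).sub (h.grad s)
  -- Testing with w itself gives ‖w‖² = O(ητ). In x, which contains τ‖w‖^{1/2}, this supplies the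
  -- missing quarter power of τ together with the smallness.
  have hm2 : ‖w‖ ^ 2 ≤ B * η * τ := by
    have h1 := h.norm_inner_sub_le hwg hGB hNB
    rw [← hw, inner_self_eq_norm_sq_to_K, norm_pow, RCLike.norm_ofReal, abs_norm] at h1
    refine h1.trans ?_
    gcongr
    exact hu s hs t ht hst
  have hq : ∑ j, normFour (G t j - G s j) + normFour w ≤ (1 + 2 * W) * (1 + Q) := by
    have h1 : ∑ j, normFour (G t j - G s j) ≤ Q := Finset.sum_le_sum fun j _ => by
      rw [add_comm]; exact normFour_sub_le (ht4 j) (hs4 j)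
    have h2 := normFour_sub_le (h.grad t).memLp_four (h.grad s).memLp_four
    have := hW s hs
    have := hW t ht
    nlinarith
  set x := B * (3 / 2 * Real.sqrt ‖w‖ * (∑ j, normFour (G t j - G s j) + normFour w)) * τ with hx
  have hq0 : 0 ≤ ∑ j, normFour (G t j - G s j) + normFour w :=
    add_nonneg (Finset.sum_nonneg fun j _ => normFour_nonneg _) (normFour_nonneg _)
  have hx0 : 0 ≤ x := by positivity
  have hx4 : x ^ 4 ≤ (κ * τ * (1 + Q)) ^ 5 := by
    calc x ^ 4 = (3 / 2 * B) ^ 4 * (Real.sqrt ‖w‖ ^ 2) ^ 2 * (∑ j, normFour (G t j - G s j) + normFour w) ^ 4 * τ ^ 4 := by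
          rw [hx]; ring
      _ ≤ (3 / 2 * B) ^ 4 * (B * η * τ) * ((1 + 2 * W) * (1 + Q)) ^ 4 * τ ^ 4 := by
          rw [Real.sq_sqrt (norm_nonneg _)]
          gcongr
      _ = D * η * τ ^ 5 * (1 + Q) ^ 4 * 1 := by rw [hD]; ring
      _ ≤ D * η * τ ^ 5 * (1 + Q) ^ 4 * (1 + Q) := by gcongr; linarith
      _ = (κ * τ * (1 + Q)) ^ 5 := by rw [hη, mul_div_cancel₀ _ hD0.ne']; ring
  have hx45 : x ^ (4 / 5 : ℝ) ≤ κ * τ * (1 + Q) := by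
    calc x ^ (4 / 5 : ℝ) = (x ^ 4) ^ (1 / 5 : ℝ) := by
          rw [← Real.rpow_natCast, ← Real.rpow_mul hx0]; norm_num
      _ ≤ ((κ * τ * (1 + Q)) ^ 5) ^ (1 / 5 : ℝ) := by gcongr
      _ = _ := by
          rw [← Real.rpow_natCast, ← Real.rpow_mul (by positivity)]; norm_num
  clear_value x
  have hs5 : eLpNorm (fun x => expWeight (U s x)) 5 volume ≤ Γ := by exact_mod_cast hΓt s hs
  have ht5 : eLpNorm (fun x => expWeight (U t x)) 5 volume ≤ Γ := by exact_mod_cast hΓt t ht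
  calc ENNReal.ofReal |potDefect (U s) (U t)|
      ≤ 5 * ((ENNReal.ofReal x) ^ (4 / 5 : ℝ) * (Γ + Γ)) := by
        refine (ofReal_abs_potDefect_le (h.grad s) (h.grad t)).trans ?_
        gcongr
    _ = ENNReal.ofReal (5 * (x ^ (4 / 5 : ℝ) * (Γ + Γ))) := by
        rw [ENNReal.ofReal_mul (by norm_num), ENNReal.ofReal_mul (by positivity), ENNReal.ofReal_rpow_of_nonneg hx0 (by norm_num),
          ENNReal.ofReal_add (by positivity) (by positivity)]
        simp
    _ ≤ ENNReal.ofReal (ε * τ * (1 + Q)) := by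
        apply ENNReal.ofReal_le_ofReal
        calc 5 * (x ^ (4 / 5 : ℝ) * ((Γ : ℝ) + Γ)) ≤ 5 * ((κ * τ * (1 + Q)) * ((Γ : ℝ) + Γ)) := by gcongr
          _ = (κ * (10 * Γ)) * (τ * (1 + Q)) := by ring
          _ ≤ ε * (τ * (1 + Q)) := by
            gcongr
            rw [hκ, div_mul_eq_mul_div, div_le_iff₀ (by positivity)]
            nlinarith [Γ.2]
          _ = _ := by ring
    _ = _ := by
        rw [hQe, ENNReal.ofReal_mul (by positivity), ENNReal.ofReal_add (by norm_num) hQ0, ENNReal.ofReal_one]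

theorem continuous_potInt (h : IsFlow U G) : Continuous fun t => potInt (U t) := by
  rw [continuous_iff_continuousAt]
  intro t
  have hU := h.contU
  have hN := h.continuous_nlOp
  obtain ⟨C, hC, hb⟩ := h.exists_eLpNorm_expWeight_le (n := 5) (by norm_num) (|t| + 1)
  have h0 : Tendsto (fun s => ENNReal.ofReal (‖U s - U t‖ ^ 2) + eLpNorm (U s - U t : L2C) 4 volume ^ 4) (𝓝 t) (𝓝 0) := by
    have e1 : Tendsto (fun s => ENNReal.ofReal (‖U s - U t‖ ^ 2)) (𝓝 t) (𝓝 0) :=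
      (ENNReal.continuous_ofReal.comp (by fun_prop : Continuous fun s => ‖U s - U t‖ ^ 2)).tendsto' _ _ (by simp)
    have e2 := ENNReal.Tendsto.pow (n := 4) (h.tendsto_eLpNorm_four t)
    simpa using e1.add e2
  have h1 : Tendsto (fun s => 5 * ((ENNReal.ofReal (‖U s - U t‖ ^ 2) + eLpNorm (U s - U t : L2C) 4 volume ^ 4) ^ (4 / 5 : ℝ) *
      (C + C))) (𝓝 t) (𝓝 0) := by
    have e1 := (ENNReal.continuous_rpow_const (y := 4 / 5)).tendsto 0 |>.comp h0
    have e2 := ENNReal.Tendsto.const_mul (a := 5) (ENNReal.Tendsto.mul_const e1 (b := C + C)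
      (Or.inr (ENNReal.add_lt_top.2 ⟨hC, hC⟩).ne)) (Or.inr (by simp))
    simpa using e2
  have h2 : Tendsto (fun s => ENNReal.ofReal |potDefect (U t) (U s)|) (𝓝 t) (𝓝 0) := by
    refine tendsto_of_tendsto_of_tendsto_of_le_of_le' tendsto_const_nhds h1 (Eventually.of_forall fun _ => zero_le) ?_
    have hmem : ∀ᶠ s in 𝓝 t, s ∈ Set.Icc (-(|t| + 1)) (|t| + 1) := by
      apply Icc_mem_nhds
      · linarith [neg_abs_le t]
      · linarith [le_abs_self t]
    filter_upwards [hmem] with s hs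
    refine (ofReal_abs_potDefect_le (h.grad t) (h.grad s)).trans ?_
    gcongr
    · exact lintegral_five_halves_le _
    · exact_mod_cast hb t (mem_of_mem_nhds hmem)
    · exact_mod_cast hb s hs
  have h3 : Tendsto (fun s => potDefect (U t) (U s)) (𝓝 t) (𝓝 0) := by
    rw [tendsto_zero_iff_abs_tendsto_zero]
    have := (ENNReal.tendsto_toReal ENNReal.zero_ne_top).comp h2
    simpa [Function.comp_def, ENNReal.toReal_ofReal] using this
  have h4 : Tendsto (fun s => (inner ℂ (nlOp (U t) + nlOp (U s)) (U s - U t)).re) (𝓝 t) (𝓝 0) := by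
    have hc : Continuous fun s => (inner ℂ (nlOp (U t) + nlOp (U s)) (U s - U t)).re :=
      Complex.continuous_re.comp (by fun_prop)
    exact hc.tendsto' _ _ (by simp)
  have h5 := (h3.add h4).add_const (potInt (U t))
  simp only [add_zero, zero_add] at h5
  refine h5.congr fun s => ?_
  rw [potDefect]; ring

end IsFlow

/-! ### Conservation of energy. -/

namespace IsFlow

variable {U : ℝ → L2C} {G : ℝ → Fin 2 → L2C}

theorem measurable_eLpNorm_four (h : IsFlow U G) (j : Fin 2) : Measurable fun t => eLpNorm (G t j) 4 volume :=
  (lowerSemicontinuous_eLpNorm_four.comp (h.contG j)).measurable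

/-- The trapezoidal error, integrated in time. -/
theorem exists_integral_potDefect_le (h : IsFlow U G) (a b : ℝ) (hab : a ≤ b) : ∃ M : ℝ, ∀ ε > 0, ∃ δ > 0,
    ∀ τ, 0 < τ → τ < δ → |∫ t in a..b, potDefect (U t) (U (t + τ))| ≤ ε * τ * M := by
  -- The margin 1 leaves room for shifts τ < 1.
  set T := max |a| |b| + 1 with hT
  have haT : |a| + 1 ≤ T := by rw [hT]; gcongr; exact le_max_left _ _
  have hbT : |b| + 1 ≤ T := by rw [hT]; gcongr; exact le_max_right _ _
  have hmem : ∀ τ, 0 ≤ τ → τ < 1 → ∀ t ∈ Set.Ioc a b, t + τ ∈ Set.Icc (-T) T := fun τ h0 h1 t ht =>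
    ⟨by linarith [ht.1, neg_abs_le a], by linarith [ht.2, le_abs_self b]⟩
  -- M depends on neither ε nor τ; it is finite because the L⁴ norm of the gradient is integrable in
  -- time.
  set M : ENNReal := ENNReal.ofReal (b - a) + ∑ j, ((∫⁻ t in Set.Icc (-T) T, eLpNorm (G t j) 4 volume) +
    ∫⁻ t in Set.Icc (-T) T, eLpNorm (G t j) 4 volume) with hM
  have hMfin : M < ⊤ := ENNReal.add_lt_top.2 ⟨ENNReal.ofReal_lt_top, ENNReal.sum_lt_top.2 fun j _ =>
    ENNReal.add_lt_top.2 ⟨h.l4 T j, h.l4 T j⟩⟩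
  refine ⟨M.toReal, fun ε hε => ?_⟩
  obtain ⟨δ, hδ, hb⟩ := h.exists_potDefect_le T hε
  refine ⟨min δ 1, lt_min hδ one_pos, fun τ hτ hτδ => ?_⟩
  have hτ1 : τ < 1 := hτδ.trans_le (min_le_right _ _)
  have hshift : ∀ (j : Fin 2) (r : ℝ), 0 ≤ r → r < 1 → ∫⁻ t in Set.Ioc a b, eLpNorm (G (t + r) j) 4 volume ≤
      ∫⁻ t in Set.Icc (-T) T, eLpNorm (G t j) 4 volume := by
    intro j r hr0 hr1
    rw [← lintegral_indicator measurableSet_Ioc, ← lintegral_indicator measurableSet_Icc,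
      ← lintegral_add_right_eq_self ((Set.Icc (-T) T).indicator fun t => eLpNorm (G t j) 4 volume) r]
    refine lintegral_mono fun t => ?_
    by_cases ht : t ∈ Set.Ioc a b
    · rw [Set.indicator_of_mem ht, Set.indicator_of_mem (hmem r hr0 hr1 t ht)]
    · rw [Set.indicator_of_notMem ht]; exact zero_le
  have key : ENNReal.ofReal |∫ t in a..b, potDefect (U t) (U (t + τ))| ≤ ENNReal.ofReal (ε * τ) * M := by
    rw [intervalIntegral.integral_of_le hab, ← Real.norm_eq_abs, ofReal_norm]
    refine (enorm_integral_le_lintegral_enorm _).trans ?_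
    calc ∫⁻ t in Set.Ioc a b, ‖potDefect (U t) (U (t + τ))‖ₑ
        ≤ ∫⁻ t in Set.Ioc a b, ENNReal.ofReal (ε * τ) *
            (1 + ∑ j, (eLpNorm (G t j) 4 volume + eLpNorm (G (t + τ) j) 4 volume)) := by
          refine setLIntegral_mono' measurableSet_Ioc fun t ht => ?_
          have h1 := hb t (by simpa using hmem 0 le_rfl one_pos t ht) (t + τ) (hmem τ hτ.le hτ1 t ht)
          rw [add_sub_cancel_left, abs_of_pos hτ, ← Real.norm_eq_abs, ofReal_norm] at h1
          exact h1 (hτδ.trans_le (min_le_left _ _))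
      _ = ENNReal.ofReal (ε * τ) * (ENNReal.ofReal (b - a) + ∑ j, ((∫⁻ t in Set.Ioc a b, eLpNorm (G t j) 4 volume) +
            ∫⁻ t in Set.Ioc a b, eLpNorm (G (t + τ) j) 4 volume)) := by
          have hm := h.measurable_eLpNorm_four
          have hm' : ∀ j, Measurable fun t => eLpNorm (G (t + τ) j) 4 volume := fun j =>
            (hm j).comp (measurable_add_const τ)
          rw [lintegral_const_mul' _ _ ENNReal.ofReal_ne_top, lintegral_add_left measurable_const,
            lintegral_finsetSum _ (fun j _ => by exact (hm j).add (hm' j))]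
          simp_rw [lintegral_add_left (hm _)]
          simp
      _ ≤ ENNReal.ofReal (ε * τ) * M := by
          rw [hM]
          refine mul_le_mul_right (add_le_add le_rfl (Finset.sum_le_sum fun j _ => add_le_add ?_ (hshift j τ hτ.le hτ1))) _
          simpa using hshift j 0 le_rfl one_pos
  have h3 := ENNReal.toReal_mono (ENNReal.mul_lt_top ENNReal.ofReal_lt_top hMfin).ne key
  rwa [ENNReal.toReal_ofReal (abs_nonneg _), ENNReal.toReal_mul, ENNReal.toReal_ofReal (by positivity)] at h3

/-- The integrand in the time evolution of `Im ⟪U b, U s⟫`. -/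
def pairRate (U : ℝ → L2C) (G : ℝ → Fin 2 → L2C) (b s : ℝ) : ℝ :=
  -(∑ j, inner ℂ (G b j) (G s j) + inner ℂ (U b) (nlOp (U s))).re

theorem continuous_pairRate (h : IsFlow U G) (b : ℝ) : Continuous (pairRate U G b) := by
  have := h.contG
  have := h.continuous_nlOp
  exact (Complex.continuous_re.comp (by fun_prop)).neg

/-- The value at τ = 0 is real. The rate at s = b contains minus the kinetic energy, which is how
the latter enters the energy identity. -/
theorem im_inner_add (h : IsFlow U G) (b τ : ℝ) :
    (inner ℂ (U b) (U (b + τ))).im = ∫ s in b..(b + τ), pairRate U G b s := by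
  have h1 := congrArg Complex.im (h.integral_inner_eq (h.grad b) b (b + τ))
  have h2 : (inner ℂ (U b) (U b)).im = 0 := by
    rw [inner_self_eq_norm_sq_to_K]; norm_cast
  rw [Complex.sub_im, h2, sub_zero] at h1
  rw [h1]
  have hG := h.contG
  have hN := h.continuous_nlOp
  have hc : Continuous fun s => -Complex.I * (∑ j, inner ℂ (G b j) (G s j) + inner ℂ (U b) (nlOp (U s))) := by fun_prop
  have h3 := Complex.imCLM.intervalIntegral_comp_comm (hc.intervalIntegrable (μ := volume) b (b + τ))
  rw [← Complex.imCLM_apply, ← h3]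
  refine intervalIntegral.integral_congr fun s _ => ?_
  simp [pairRate]

theorem integral_shift_sub {f : ℝ → ℝ} (hf : Continuous f) (a b τ : ℝ) :
    ∫ t in a..b, (f (t + τ) - f t) = (∫ t in b..(b + τ), f t) - ∫ t in a..(a + τ), f t := by
  have hi := fun a b => hf.intervalIntegrable (μ := volume) a b
  rw [intervalIntegral.integral_sub ((by fun_prop : Continuous fun t => f (t + τ)).intervalIntegrable _ _) (hi _ _),
    intervalIntegral.integral_comp_add_right f τ]
  have h1 := intervalIntegral.integral_add_adjacent_intervals (hi a b) (hi b (b + τ))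
  have h2 := intervalIntegral.integral_add_adjacent_intervals (hi a (a + τ)) (hi (a + τ) (b + τ))
  linarith

/-- The defect is a difference of time shifts of one function, minus the imaginary part of the rate
of ⟪U t, U (t + τ)⟫. Both integrate to terms at the two ends, so no time derivative is ever paired
with the nonlinearity. -/
theorem integral_potDefect_eq (h : IsFlow U G) (a b τ : ℝ) :
    ∫ t in a..b, potDefect (U t) (U (t + τ)) =
      (∫ s in b..(b + τ), (potInt (U s) - (inner ℂ (nlOp (U s)) (U s)).re - pairRate U G b s)) -
      ∫ s in a..(a + τ), (potInt (U s) - (inner ℂ (nlOp (U s)) (U s)).re - pairRate U G a s) := by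
  have hU := h.contU
  have hN := h.continuous_nlOp
  have hU' : Continuous fun t => U (t + τ) := by fun_prop
  have hN' : Continuous fun t => nlOp (U (t + τ)) := hN.comp (by fun_prop)
  have hP := h.continuous_potInt
  have hR := h.continuous_pairRate
  set f : ℝ → ℝ := fun s => potInt (U s) - (inner ℂ (nlOp (U s)) (U s)).re with hf
  have hfc : Continuous f := hP.sub (Complex.continuous_re.comp (by fun_prop))
  have hi := fun a b => hfc.intervalIntegrable (μ := volume) a b
  have hr := fun c a b => (hR c).intervalIntegrable (μ := volume) a b
  rw [intervalIntegral.integral_sub (hi _ _) (hr _ _ _), intervalIntegral.integral_sub (hi _ _) (hr _ _ _),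
    ← h.im_inner_add, ← h.im_inner_add]
  have h1 := congrArg Complex.im (h.inner_shift_sub 0 τ a b)
  simp only [add_zero] at h1
  have hc : Continuous fun t => Complex.I * (inner ℂ (nlOp (U t)) (U (t + τ)) - inner ℂ (U t) (nlOp (U (t + τ)))) := by
    fun_prop
  rw [← Complex.imCLM_apply (∫ t in a..b, _), ← Complex.imCLM.intervalIntegral_comp_comm (hc.intervalIntegrable (μ := volume) a b),
    Complex.sub_im] at h1
  have h2 := integral_shift_sub hfc a b τ
  have hc2 : Continuous fun t => Complex.imCLM (Complex.I * (inner ℂ (nlOp (U t)) (U (t + τ)) -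
      inner ℂ (U t) (nlOp (U (t + τ))))) := Complex.imCLM.continuous.comp hc
  have h3 : ∫ t in a..b, potDefect (U t) (U (t + τ)) = ∫ t in a..b, ((f (t + τ) - f t) -
      Complex.imCLM (Complex.I * (inner ℂ (nlOp (U t)) (U (t + τ)) - inner ℂ (U t) (nlOp (U (t + τ)))))) := by
    refine intervalIntegral.integral_congr fun t _ => ?_
    have e1 : (inner ℂ (nlOp (U (t + τ))) (U t)).re = (inner ℂ (U t) (nlOp (U (t + τ)))).re := by
      rw [← inner_conj_symm, Complex.conj_re]
    simp only [potDefect, hf, inner_add_left, inner_sub_right, Complex.add_re, Complex.sub_re, Complex.imCLM_apply,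
      Complex.I_mul_im, e1]
    ring
  rw [h3, intervalIntegral.integral_sub ((by fun_prop : Continuous fun t => f (t + τ) - f t).intervalIntegrable _ _)
    (hc2.intervalIntegrable _ _), h2, ← h1]
  ring

/-- Conservation of energy. -/
theorem energy_eq (h : IsFlow U G) (a b : ℝ) :
    ∑ j, ‖G b j‖ ^ 2 + potInt (U b) = ∑ j, ‖G a j‖ ^ 2 + potInt (U a) := by
  wlog hab : a ≤ b generalizing a b
  · exact (this b a (le_of_not_ge hab)).symm
  have hN := h.continuous_nlOp
  have hU := h.contU
  have hc : ∀ c, Continuous fun s => potInt (U s) - (inner ℂ (nlOp (U s)) (U s)).re - pairRate U G c s := fun c =>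
    (h.continuous_potInt.sub (Complex.continuous_re.comp (by fun_prop))).sub (h.continuous_pairRate c)
  -- At s = c the boundary integrand is the total energy, so the boundary integrals divided by τ
  -- tend to the energies at b and a.
  have hval : ∀ c, potInt (U c) - (inner ℂ (nlOp (U c)) (U c)).re - pairRate U G c c =
      ∑ j, ‖G c j‖ ^ 2 + potInt (U c) := by
    intro c
    have e : ∀ j, inner ℂ (G c j) (G c j) = ((‖G c j‖ ^ 2 : ℝ) : ℂ) := fun j => by
      rw [inner_self_eq_norm_sq_to_K]; norm_cast
    simp only [pairRate, e, Complex.add_re, (h.grad c).inner_nlOp_eq, ← Complex.ofReal_sum, Complex.ofReal_re]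
    ring
  have hd : ∀ c, HasDerivAt (fun τ => ∫ s in c..(c + τ), (potInt (U s) - (inner ℂ (nlOp (U s)) (U s)).re - pairRate U G c s))
      (∑ j, ‖G c j‖ ^ 2 + potInt (U c)) 0 := by
    intro c
    have h1 := intervalIntegral.integral_hasDerivAt_right ((hc c).intervalIntegrable c (c + 0))
      ((hc c).stronglyMeasurableAtFilter _ _) (hc c).continuousAt
    have h2 := h1.comp_const_add c 0
    rwa [add_zero, hval] at h2
  have hD := ((hd b).sub (hd a)).tendsto_slope_zero_right
  obtain ⟨M, hM⟩ := h.exists_integral_potDefect_le a b hab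
  -- The integrated defect is o(τ), hence contributes nothing to the limit of the quotients.
  have hbd : ∀ ε > 0, |(∑ j, ‖G b j‖ ^ 2 + potInt (U b)) - (∑ j, ‖G a j‖ ^ 2 + potInt (U a))| ≤ ε * M := by
    intro ε hε
    obtain ⟨δ, hδ, hb⟩ := hM ε hε
    refine le_of_tendsto hD.abs ?_
    filter_upwards [Ioo_mem_nhdsGT hδ] with τ hτ
    have h1 := hb τ hτ.1 hτ.2
    rw [h.integral_potDefect_eq] at h1
    simp only [zero_add, Pi.sub_apply, add_zero, intervalIntegral.integral_same, sub_zero, smul_eq_mul]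
    rw [abs_mul, abs_inv, abs_of_pos hτ.1, inv_mul_le_iff₀ hτ.1]
    linarith
  have hlim : Tendsto (fun ε : ℝ => ε * M) (𝓝[>] 0) (𝓝 0) :=
    tendsto_nhdsWithin_of_tendsto_nhds (Continuous.tendsto' (by fun_prop) _ _ (by simp))
  have := ge_of_tendsto hlim (by filter_upwards [self_mem_nhdsWithin] with ε hε using hbd ε hε)
  exact sub_eq_zero.1 (abs_nonpos_iff.1 this)

end IsFlow

/-! ### The truncated virial identity. -/

/-- This is 2 Re(p̄ ∂p) = ∂|p|² integrated against ψ. -/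
theorem HasGrad.two_mul_re_inner_mulOp {p : L2C} {q : Fin 2 → L2C} (h : HasGrad p q) (ψ : Test) (j : Fin 2) :
    2 * (inner ℂ (mulOp ψ (q j)) p).re = -(inner ℂ (mulOp (ψ.pd j) p) p).re := by
  have h1 := congrArg Complex.re ((h.mul_test ψ).inner_eq h j)
  rw [inner_add_left, Complex.neg_re, Complex.add_re, inner_mulOp, ← inner_conj_symm, Complex.conj_re] at h1
  linarith

/-- The rate of change of the truncated virial quantity. -/
def virialRate (φ : Test) (v : L2C) (g : Fin 2 → L2C) (N : L2C) : ℝ :=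
  2 * ∑ j, ∑ k, (inner ℂ (mulOp ((φ.pd j).pd k) (g j)) (g k)).re +
    ∑ k, (inner ℂ (mulOp (φ.lap.pd k) v) (g k)).re +
    (2 * ∑ j, (inner ℂ (mulOp (φ.pd j) (g j)) N).re + (inner ℂ (mulOp φ.lap v) N).re)

/-- The truncated virial quantity. -/
def virial (φ : Test) (v : L2C) (g : Fin 2 → L2C) : ℝ := ∑ j, (inner ℂ v (mulOp (φ.pd j) (g j))).im

theorem mulOp_lap (φ : Test) (v : L2C) : mulOp φ.lap v = ∑ j, mulOp ((φ.pd j).pd j) v := by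
  rw [Fin.sum_univ_two]; exact mulOp_add_left _ _ _

/-- Linear part of the virial identity: each second derivative `q k k` is integrated by parts. The
terms with Δφ |∇v|² cancel, which uses the symmetry of the second derivatives. -/
theorem HasGrad.virial_laplacian {v : L2C} {p : Fin 2 → L2C} {q : Fin 2 → Fin 2 → L2C} (hv : HasGrad v p)
    (hp : ∀ j, HasGrad (p j) (q j)) (hq : ∀ j k, q j k = q k j) (φ : Test) :
    -(2 * ∑ j, (inner ℂ (mulOp (φ.pd j) (p j)) (∑ k, q k k)).re + (inner ℂ (mulOp φ.lap v) (∑ k, q k k)).re) =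
      2 * ∑ j, ∑ k, (inner ℂ (mulOp ((φ.pd j).pd k) (p j)) (p k)).re +
        ∑ k, (inner ℂ (mulOp (φ.lap.pd k) v) (p k)).re := by
  have h1 : ∀ j k, (inner ℂ (mulOp (φ.pd j) (p j)) (q k k)).re =
      -((inner ℂ (mulOp (φ.pd j) (q k j)) (p k)).re + (inner ℂ (mulOp ((φ.pd j).pd k) (p j)) (p k)).re) := by
    intro j k
    rw [((hp j).mul_test (φ.pd j)).inner_eq (hp k) k, inner_add_left, hq k j, Complex.neg_re, Complex.add_re]
  have h2 : ∀ k, (inner ℂ (mulOp φ.lap v) (q k k)).re =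
      -((inner ℂ (mulOp φ.lap (p k)) (p k)).re + (inner ℂ (mulOp (φ.lap.pd k) v) (p k)).re) := by
    intro k
    rw [(hv.mul_test φ.lap).inner_eq (hp k) k, inner_add_left, Complex.neg_re, Complex.add_re]
  have h3 : ∀ j k, 2 * (inner ℂ (mulOp (φ.pd j) (q k j)) (p k)).re = -(inner ℂ (mulOp ((φ.pd j).pd j) (p k)) (p k)).re :=
    fun j k => (hp k).two_mul_re_inner_mulOp (φ.pd j) j
  have h4 : ∀ k, (inner ℂ (mulOp φ.lap (p k)) (p k)).re = ∑ j, (inner ℂ (mulOp ((φ.pd j).pd j) (p k)) (p k)).re := by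
    intro k
    rw [mulOp_lap, sum_inner, Complex.re_sum]
  simp only [Fin.sum_univ_two, inner_add_right, Complex.add_re, h1, h2, h4]
  have := h3 0 0
  have := h3 0 1
  have := h3 1 0
  have := h3 1 1
  linarith

theorem continuous_virialRate {X : Type*} [TopologicalSpace X] {φ : Test} {v N : X → L2C} {g : X → Fin 2 → L2C}
    (hv : Continuous v) (hg : ∀ j, Continuous fun x => g x j) (hN : Continuous N) :
    Continuous fun x => virialRate φ (v x) (g x) (N x) := by
  have hi : ∀ (S : L2C →L[ℂ] L2C) {y z : X → L2C}, Continuous y → Continuous z →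
      Continuous fun x => (inner ℂ (S (y x)) (z x)).re := fun S y z hy hz =>
    Complex.continuous_re.comp ((S.continuous.comp hy).inner hz)
  exact ((continuous_const.mul (continuous_finsetSum _ fun j _ => continuous_finsetSum _ fun k _ => hi _ (hg j) (hg k))).add
    (continuous_finsetSum _ fun k _ => hi _ hv (hg k))).add
    ((continuous_const.mul (continuous_finsetSum _ fun j _ => hi _ (hg j) hN)).add (hi _ hv hN))

namespace IsFlow

variable {U : ℝ → L2C} {G : ℝ → Fin 2 → L2C}

/-- The mollified solution has L² derivatives of every order in space, so the formal computation is
legitimate. The rate contains the mollified nonlinearity, not the nonlinearity of the mollified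
function. -/
theorem hasDerivAt_virial_convOp (h : IsFlow U G) (φ ρ : Test) (t : ℝ) :
    HasDerivAt (fun s => virial φ (convOp ρ (U s)) (fun j => convOp ρ (G s j)))
      (virialRate φ (convOp ρ (U t)) (fun j => convOp ρ (G t j)) (convOp ρ (nlOp (U t)))) t := by
  have hpd : ∀ s j, convOp ρ (G s j) = convOp (ρ.pd j) (U s) := fun s j => ((h.grad s).convOp_pd ρ j).symm
  have hv : HasGrad (convOp ρ (U t)) (fun j => convOp (ρ.pd j) (U t)) := hasGrad_convOp ρ (U t)
  have hp : ∀ j, HasGrad (convOp (ρ.pd j) (U t)) (fun k => convOp ((ρ.pd j).pd k) (U t)) := fun j => hasGrad_convOp _ _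
  have hlap := hv.virial_laplacian hp (fun j k => by rw [Test.pd_comm]) φ
  have hD : ∀ ρ : Test, mollRhs U G ρ t = ∑ k, convOp ((ρ.pd k).pd k) (U t) - convOp ρ (nlOp (U t)) := by
    intro ρ
    rw [mollRhs]
    congr 1
    exact Finset.sum_congr rfl fun k _ => ((h.grad t).convOp_pd (ρ.pd k) k).symm
  have hDg : HasGrad (mollRhs U G ρ t) (fun j => mollRhs U G (ρ.pd j) t) := by
    intro ψ j
    simp only [hD, inner_sub_right, inner_add_right, inner_pd_convOp, Fin.sum_univ_two, Test.pd_comm j]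
    ring
  simp only [virial, hpd]
  have hder := HasDerivAt.fun_sum (u := Finset.univ) fun (j : Fin 2) _ =>
    (Complex.imCLM.hasFDerivAt.comp_hasDerivAt t ((h.hasDerivAt_convOp ρ t).inner ℂ
      (((mulOp (φ.pd j)).restrictScalars ℝ).hasFDerivAt.comp_hasDerivAt t (h.hasDerivAt_convOp (ρ.pd j) t))))
  refine hder.congr_deriv ?_
  set v := convOp ρ (U t)
  set p : Fin 2 → L2C := fun j => convOp (ρ.pd j) (U t) with hpdef
  set D := mollRhs U G ρ t with hDdef
  have hj : ∀ j, Complex.imCLM (inner ℂ v (mulOp (φ.pd j) (Complex.I • mollRhs U G (ρ.pd j) t)) +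
      inner ℂ (Complex.I • D) (mulOp (φ.pd j) (p j))) =
      -(2 * (inner ℂ (mulOp (φ.pd j) (p j)) D).re + (inner ℂ (mulOp ((φ.pd j).pd j) v) D).re) := by
    intro j
    have e1 := (hv.mul_test (φ.pd j)).inner_eq hDg j
    have e2 : (inner ℂ D (mulOp (φ.pd j) (p j))).re = (inner ℂ (mulOp (φ.pd j) (p j)) D).re := by
      rw [← inner_conj_symm, Complex.conj_re]
    rw [← inner_mulOp, inner_smul_right, e1, inner_smul_left, inner_add_left, map_add, Complex.imCLM_apply, Complex.imCLM_apply,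
      Complex.conj_I, Complex.I_mul_im, neg_mul, Complex.neg_im, Complex.I_mul_im, e2, Complex.neg_re, Complex.add_re]
    ring
  refine (Finset.sum_congr rfl fun j _ => hj j).trans ?_
  have hL : (inner ℂ (mulOp φ.lap v) D).re = ∑ j, (inner ℂ (mulOp ((φ.pd j).pd j) v) D).re := by
    rw [mulOp_lap, sum_inner, Complex.re_sum]
  rw [Finset.sum_neg_distrib, Finset.sum_add_distrib, ← hL, ← Finset.mul_sum, virialRate, ← hlap]
  rw [hDdef, hD]
  simp only [inner_sub_right, Complex.sub_re, Finset.sum_sub_distrib, hpdef]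
  ring

/-- The rate involves only U, its first derivatives and the nonlinearity, all continuous in L², so
the mollification can be removed. -/
theorem virial_sub_eq (h : IsFlow U G) (φ : Test) (a b : ℝ) :
    virial φ (U b) (G b) - virial φ (U a) (G a) = ∫ t in a..b, virialRate φ (U t) (G t) (nlOp (U t)) := by
  have hU := h.contU
  have hG := h.contG
  have hN := h.continuous_nlOp
  have hJ := tendsto_convOp_moll
  have key : ∀ n, virial φ (convOp (moll n) (U b)) (fun j => convOp (moll n) (G b j)) -
      virial φ (convOp (moll n) (U a)) (fun j => convOp (moll n) (G a j)) = ∫ t in a..b,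
        virialRate φ (convOp (moll n) (U t)) (fun j => convOp (moll n) (G t j)) (convOp (moll n) (nlOp (U t))) := by
    intro n
    symm
    apply intervalIntegral.integral_eq_sub_of_hasDerivAt
      (f := fun t => virial φ (convOp (moll n) (U t)) (fun j => convOp (moll n) (G t j)))
    · exact fun t _ => h.hasDerivAt_virial_convOp φ (moll n) t
    · exact (continuous_virialRate (by fun_prop) (fun j => by fun_prop) (by fun_prop)).intervalIntegrable _ _
  have hvir : ∀ t, Tendsto (fun n => virial φ (convOp (moll n) (U t)) (fun j => convOp (moll n) (G t j))) atTop
      (𝓝 (virial φ (U t) (G t))) := fun t => tendsto_finsetSum _ fun j _ =>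
    (Complex.continuous_im.tendsto _).comp ((hJ _).inner (((mulOp (φ.pd j)).continuous.tendsto _).comp (hJ _)))
  refine tendsto_nhds_unique ((hvir b).sub (hvir a)) ?_
  simp_rw [key]
  refine tendsto_intervalIntegral_of_le_continuous
    (B := fun t => 2 * ∑ j, ∑ k, ‖mulOp ((φ.pd j).pd k)‖ * ‖G t j‖ * ‖G t k‖ +
      ∑ k, ‖mulOp (φ.lap.pd k)‖ * ‖U t‖ * ‖G t k‖ + (2 * ∑ j, ‖mulOp (φ.pd j)‖ * ‖G t j‖ * ‖nlOp (U t)‖ +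
        ‖mulOp φ.lap‖ * ‖U t‖ * ‖nlOp (U t)‖))
    (fun n => continuous_virialRate (by fun_prop) (fun j => by fun_prop) (by fun_prop)) (by fun_prop) ?_ ?_
  · intro n t
    have hb : ∀ (S : L2C →L[ℂ] L2C) (x y : L2C), ‖(inner ℂ (S (convOp (moll n) x)) (convOp (moll n) y)).re‖ ≤ ‖S‖ * ‖x‖ * ‖y‖ := by
      intro S x y
      refine (Complex.abs_re_le_norm _).trans ((norm_inner_le_norm _ _).trans ?_)
      gcongr
      · exact (S.le_opNorm _).trans (by gcongr; exact norm_convOp_moll_le n x)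
      · exact norm_convOp_moll_le n y
    have h2 : ‖(2 : ℝ)‖ = 2 := by norm_num
    rw [virialRate]
    refine (norm_add_le _ _).trans (add_le_add ((norm_add_le _ _).trans (add_le_add ?_ ?_))
      ((norm_add_le _ _).trans (add_le_add ?_ (hb _ _ _))))
    · rw [norm_mul, h2]
      gcongr
      exact (norm_sum_le _ _).trans (Finset.sum_le_sum fun j _ => (norm_sum_le _ _).trans (Finset.sum_le_sum fun k _ => hb _ _ _))
    · exact (norm_sum_le _ _).trans (Finset.sum_le_sum fun j _ => hb _ _ _)
    · rw [norm_mul, h2]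
      gcongr
      exact (norm_sum_le _ _).trans (Finset.sum_le_sum fun j _ => hb _ _ _)
  · intro t
    have hi : ∀ (S : L2C →L[ℂ] L2C) (x y : L2C), Tendsto (fun n => (inner ℂ (S (convOp (moll n) x)) (convOp (moll n) y)).re)
        atTop (𝓝 (inner ℂ (S x) y).re) := fun S x y =>
      (Complex.continuous_re.tendsto _).comp (((S.continuous.tendsto _).comp (hJ _)).inner (hJ _))
    exact (((tendsto_finsetSum _ fun j _ => tendsto_finsetSum _ fun k _ => hi _ _ _).const_mul 2).add
      (tendsto_finsetSum _ fun k _ => hi _ _ _)).add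
      (((tendsto_finsetSum _ fun j _ => hi _ _ _).const_mul 2).add (hi _ _ _))

end IsFlow

/-! ### The nonlinear virial density. -/

/-- The density of the nonlinear contribution to the virial identity. -/
def virialDens (z : ℂ) : ℝ := ‖z‖ ^ 2 * nlFactor (‖z‖ ^ 2) - potential z

theorem contDiff_potential : ContDiff ℝ 1 fun z => (potential z : ℂ) := by
  have h1 : ContDiff ℝ 1 fun z : ℂ => ‖z‖ ^ 2 := contDiff_norm_sq ℝ
  have h2 : ContDiff ℝ 1 potential := by
    have e : potential = fun z => 1 / (4 * Real.pi) * (Real.exp (4 * Real.pi * ‖z‖ ^ 2) - 1 - 4 * Real.pi * ‖z‖ ^ 2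
        - 8 * Real.pi ^ 2 * (‖z‖ ^ 2) ^ 2) := by
      ext z; rw [potential]; ring
    rw [e]
    fun_prop
  exact Complex.ofRealCLM.contDiff.comp h2

theorem fderiv_potential_apply (z w : ℂ) : fderiv ℝ (fun z => (potential z : ℂ)) z w =
    ((2 * inner ℝ (nonlin z) w : ℝ) : ℂ) := by
  have h := Complex.ofRealCLM.hasFDerivAt.comp z (hasFDerivAt_potential z)
  have h' : HasFDerivAt (fun z => (potential z : ℂ)) _ z := h
  rw [h'.fderiv]
  simp [innerSL_apply_apply]
  ring

/-- The chain rule for F(v); its growth conditions follow from exponential integrability at every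
exponent. -/
theorem HasGrad.integral_potential_mul {v : L2C} {g : Fin 2 → L2C} (h : HasGrad v g) (φ : Test) (j : Fin 2) :
    ∫ x, potential (v x) * φ.pd j x = -∫ x, 2 * inner ℝ (nonlin (v x)) (g j x) * φ x := by
  have h4 : MemLp (fun x => expWeight (v x)) 4 volume := by
    exact_mod_cast h.memLp_expWeight (n := 4) (by norm_num)
  have h2 : MemLp (fun x => ‖v x‖ * expWeight (v x)) 2 volume := h4.mul h.memLp_four.norm
  have h1 : Integrable fun x => Real.exp (4 * Real.pi * ‖v x‖ ^ 2) - 1 := by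
    refine ⟨(by fun_prop : Continuous fun z : ℂ => Real.exp (4 * Real.pi * ‖z‖ ^ 2) - 1).comp_aestronglyMeasurable
      (Lp.memLp v).1, ?_⟩
    refine lt_of_le_of_lt (lintegral_mono fun x => ?_) (h.expInt_lt_top (a := 4 * Real.pi) (by positivity))
    rw [Real.enorm_eq_ofReal (sub_nonneg.2 (Real.one_le_exp (by positivity)))]
  have hbd : ∀ (ψ : Test) {f : Plane → ℝ}, Integrable f → Integrable fun x => f x * |ψ x| := by
    intro ψ f hf
    obtain ⟨C, -, hC⟩ := ψ.exists_bound
    exact hf.mul_bdd (c := C) ψ.continuous.abs.aestronglyMeasurable (Eventually.of_forall fun x => by simpa using hC x)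
  have key := h.chain contDiff_potential (b₀ := fun s => Real.exp (4 * Real.pi * s ^ 2) - 1)
    (b₁ := fun s => 2 * (s * (Real.exp (12 * Real.pi * s ^ 2) - 1))) ?_ ?_ ?_ ?_ φ j (hbd _ h1) ?_
  · simp only [fderiv_potential_apply, ← Complex.ofReal_mul, integral_complex_ofReal] at key
    exact_mod_cast key
  · intro z
    rw [Complex.norm_real, Real.norm_of_nonneg (potential_nonneg _)]
    exact potential_le z
  · intro z
    refine ContinuousLinearMap.opNorm_le_bound _ (by
      have := expWeight_nonneg z; unfold expWeight at this; positivity) fun w => ?_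
    rw [fderiv_potential_apply, Complex.norm_real, norm_mul, Real.norm_ofNat, mul_assoc]
    refine mul_le_mul_of_nonneg_left ((norm_inner_le_norm _ _).trans ?_) (by norm_num)
    gcongr
    exact norm_nonlin_le z
  · intro s t hs hst
    gcongr
  · intro s t hs hst
    have : 1 ≤ Real.exp (12 * Real.pi * s ^ 2) := Real.one_le_exp (by positivity)
    gcongr
    linarith
  · have := (hbd φ (h2.integrable_mul (Lp.memLp (g j)).norm)).const_mul 2
    refine this.congr (Eventually.of_forall fun x => ?_)
    simp only [Pi.mul_apply, expWeight]; ring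

theorem re_inner_mulOp (φ : Test) (v w : L2C) : (inner ℂ (mulOp φ v) w).re = ∫ x, φ x * inner ℝ (v x) (w x) := by
  rw [L2C.re_inner]
  apply integral_congr_ae
  filter_upwards [coeFn_mulOp φ v] with x hx
  rw [hx, ← Complex.real_smul, real_inner_smul_left]

theorem integrable_test_mul {f : Plane → ℝ} (hf : Integrable f) (φ : Test) : Integrable fun x => φ x * f x := by
  obtain ⟨C, -, hC⟩ := φ.exists_bound
  exact hf.bdd_mul φ.continuous.aestronglyMeasurable (Eventually.of_forall fun x => by simpa using hC x)

theorem HasGrad.inner_nonlin_integrable {v : L2C} {g : Fin 2 → L2C} (h : HasGrad v g) :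
    Integrable fun x => ‖v x‖ ^ 2 * nlFactor (‖v x‖ ^ 2) := by
  refine (L2C.integrable_inner_real v (nlOp v)).congr ?_
  filter_upwards [h.coeFn_nlOp] with x hx
  rw [hx, nonlin_eq, ← Complex.real_smul, real_inner_smul_right, real_inner_self_eq_norm_sq, mul_comm]

theorem HasGrad.integrable_virialDens {v : L2C} {g : Fin 2 → L2C} (h : HasGrad v g) :
    Integrable fun x => virialDens (v x) := h.inner_nonlin_integrable.sub h.integrable_potential

/-- The nonlinear contribution to the virial identity. -/
theorem HasGrad.virial_nonlin {v : L2C} {g : Fin 2 → L2C} (h : HasGrad v g) (φ : Test) :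
    2 * ∑ j, (inner ℂ (mulOp (φ.pd j) (g j)) (nlOp v)).re + (inner ℂ (mulOp φ.lap v) (nlOp v)).re =
      ∫ x, φ.lap x * virialDens (v x) := by
  have h1 : ∀ j, 2 * (inner ℂ (mulOp (φ.pd j) (g j)) (nlOp v)).re = -∫ x, (φ.pd j).pd j x * potential (v x) := by
    intro j
    rw [re_inner_mulOp, ← integral_const_mul]
    have := h.integral_potential_mul (φ.pd j) j
    simp_rw [mul_comm (potential _)] at this
    rw [this, neg_neg]
    apply integral_congr_ae
    filter_upwards [h.coeFn_nlOp] with x hx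
    rw [hx, real_inner_comm]; ring
  have h2 : (inner ℂ (mulOp φ.lap v) (nlOp v)).re = ∫ x, φ.lap x * (‖v x‖ ^ 2 * nlFactor (‖v x‖ ^ 2)) := by
    rw [re_inner_mulOp]
    apply integral_congr_ae
    filter_upwards [h.coeFn_nlOp] with x hx
    rw [hx, nonlin_eq, ← Complex.real_smul, real_inner_smul_right, real_inner_self_eq_norm_sq, mul_comm (‖v x‖ ^ 2)]
  have h3 : ∫ x, φ.lap x * potential (v x) = (∫ x, (φ.pd 0).pd 0 x * potential (v x)) + ∫ x, (φ.pd 1).pd 1 x * potential (v x) := by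
    rw [← integral_add (integrable_test_mul h.integrable_potential _) (integrable_test_mul h.integrable_potential _)]
    refine integral_congr_ae (Eventually.of_forall fun x => ?_)
    simp only [Test.lap, Test.add]; ring
  have h4 : ∫ x, φ.lap x * virialDens (v x) = (∫ x, φ.lap x * (‖v x‖ ^ 2 * nlFactor (‖v x‖ ^ 2))) -
      ∫ x, φ.lap x * potential (v x) := by
    rw [← integral_sub (integrable_test_mul h.inner_nonlin_integrable _) (integrable_test_mul h.integrable_potential _)]
    refine integral_congr_ae (Eventually.of_forall fun x => ?_)
    simp only [virialDens]; ring
  rw [h4, h3, ← h2, Fin.sum_univ_two]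
  have := h1 0
  have := h1 1
  linarith

/-- With x = 4π|z|² this reads (x - 2) exp x + x + 2 ≥ 0, an increasing expression that vanishes at
0. -/
theorem potential_le_virialDens (z : ℂ) : potential z ≤ virialDens z := by
  have hp := Real.pi_pos
  have hmono : MonotoneOn (fun x : ℝ => (x - 2) * Real.exp x + x + 2) (Set.Ici 0) := by
    apply monotoneOn_of_deriv_nonneg (convex_Ici 0) (by fun_prop) (by fun_prop)
    intro x _
    have hd : HasDerivAt (fun x : ℝ => (x - 2) * Real.exp x + x + 2) ((1 * Real.exp x + (x - 2) * Real.exp x) + 1) x :=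
      ((((hasDerivAt_id x).sub_const 2).mul (Real.hasDerivAt_exp x)).add (hasDerivAt_id x)).add_const 2
    rw [hd.deriv]
    have h1 := Real.add_one_le_exp (-x)
    have h2 : Real.exp (-x) * Real.exp x = 1 := by rw [← Real.exp_add]; simp
    nlinarith [Real.exp_pos x]
  have h := hmono (Set.mem_Ici.2 le_rfl) (Set.mem_Ici.2 (show 0 ≤ 4 * Real.pi * ‖z‖ ^ 2 by positivity)) (by positivity)
  simp only [Real.exp_zero] at h
  have e : virialDens z - potential z = 1 / (4 * Real.pi) * ((4 * Real.pi * ‖z‖ ^ 2 - 2) * Real.exp (4 * Real.pi * ‖z‖ ^ 2) +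
      4 * Real.pi * ‖z‖ ^ 2 + 2) := by
    rw [virialDens, potential, nlFactor]; field_simp; ring
  have : 0 ≤ virialDens z - potential z := by
    rw [e]; apply mul_nonneg (by positivity); linarith
  linarith

theorem virialDens_nonneg (z : ℂ) : 0 ≤ virialDens z := (potential_nonneg z).trans (potential_le_virialDens z)

/-- The density is at most 16π²|z|⁶ exp(4π|z|²), and |z|⁶ ≤ (6 / L³)(exp(L|z|²) - 1). The factor L⁻³
outweighs the factor linear in L from Moser-Trudinger, so smallness comes without a small mass. -/
theorem virialDens_le {L : ℝ} (hL : 0 < L) (z : ℂ) :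
    virialDens z ≤ 96 * Real.pi ^ 2 / L ^ 3 * (Real.exp ((L + 4 * Real.pi) * ‖z‖ ^ 2) - 1) := by
  have hp := Real.pi_pos
  set A := ‖z‖ ^ 2 with hA
  have hA0 : 0 ≤ A := by positivity
  set x := 4 * Real.pi * A with hx
  have hx0 : 0 ≤ x := by positivity
  have h1 : Real.exp x - 1 ≤ x * Real.exp x := by
    have h1 := Real.add_one_le_exp (-x)
    have h2 : Real.exp (-x) * Real.exp x = 1 := by rw [← Real.exp_add]; simp
    nlinarith [Real.exp_pos x]
  have h2 : nlFactor A ≤ x ^ 2 * Real.exp x := by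
    have h3 : 1 ≤ Real.exp x := Real.one_le_exp hx0
    have : nlFactor A = Real.exp x - 1 - x := rfl
    nlinarith
  have h3 : (L * A) ^ 3 / 6 ≤ Real.exp (L * A) - 1 := by
    have := Real.sum_le_exp_of_nonneg (x := L * A) (by positivity) 4
    simp [Finset.sum_range_succ, Nat.factorial] at this
    have h4 : 0 ≤ L * A := by positivity
    nlinarith [sq_nonneg (L * A)]
  have h4 : Real.exp x * (Real.exp (L * A) - 1) ≤ Real.exp ((L + 4 * Real.pi) * A) - 1 := by
    have : (L + 4 * Real.pi) * A = x + L * A := by rw [hx]; ring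
    rw [this, Real.exp_add]
    nlinarith [Real.one_le_exp hx0]
  calc virialDens z ≤ A * nlFactor A := by rw [virialDens]; linarith [potential_nonneg z]
    _ ≤ A * (x ^ 2 * Real.exp x) := by gcongr
    _ = 96 * Real.pi ^ 2 / L ^ 3 * (Real.exp x * ((L * A) ^ 3 / 6)) := by rw [hx]; field_simp; ring
    _ ≤ 96 * Real.pi ^ 2 / L ^ 3 * (Real.exp x * (Real.exp (L * A) - 1)) := by gcongr
    _ ≤ _ := by gcongr

/-! ### Control of the exterior nonlinear density by the exterior kinetic energy. -/

/-- The exterior of the open disc of radius `R`. -/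
def exterior (R : ℝ) : Set Plane := {x | R ≤ ‖x‖}

theorem measurableSet_exterior (R : ℝ) : MeasurableSet (exterior R) := measurableSet_le measurable_const measurable_norm

/-- The kinetic energy outside a disc. -/
def extKin (R : ℝ) (g : Fin 2 → L2C) : ℝ := ∑ j, ∫ x in exterior R, ‖g j x‖ ^ 2

theorem L2C.integrable_sq (g : L2C) : Integrable fun x => ‖g x‖ ^ 2 := (Lp.memLp g).integrable_norm_pow two_ne_zero

theorem L2C.norm_sq_eq (g : L2C) : ‖g‖ ^ 2 = ∫ x, ‖g x‖ ^ 2 := by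
  have h := L2C.re_inner g g
  rw [inner_self_eq_norm_sq_to_K] at h
  simp only [real_inner_self_eq_norm_sq] at h
  rw [← h]; norm_cast

theorem extKin_nonneg (R : ℝ) (g : Fin 2 → L2C) : 0 ≤ extKin R g :=
  Finset.sum_nonneg fun j _ => integral_nonneg fun x => by positivity

theorem extKin_anti {R S : ℝ} (h : R ≤ S) (g : Fin 2 → L2C) : extKin S g ≤ extKin R g :=
  Finset.sum_le_sum fun j _ => setIntegral_mono_set (L2C.integrable_sq (g j)).integrableOn
    (Eventually.of_forall fun x => by positivity)
    (Eventually.of_forall fun x hx => h.trans hx)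

theorem sub_setIntegral_le {a b e : Plane → ℝ} {A : Set Plane} (hA : MeasurableSet A) (ha : Integrable a) (hb : Integrable b)
    (he : Integrable e) (hin : ∀ᵐ x, x ∉ A → b x ≤ a x) (hout : ∀ᵐ x, x ∈ A → b x - e x ≤ a x) :
    (∫ x, b x) - ∫ x in A, e x ≤ ∫ x, a x := by
  rw [← integral_indicator hA, ← integral_sub hb (he.indicator hA)]
  apply integral_mono_ae (hb.sub (he.indicator hA)) ha
  filter_upwards [hin, hout] with x h1 h2
  by_cases hx : x ∈ A
  · simpa [hx] using h2 hx
  · simpa [hx] using h1 hx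

theorem cutoff_nonneg (x : Plane) : 0 ≤ cutoff x := stdBump.nonneg

theorem cutoff_le_one (x : Plane) : cutoff x ≤ 1 := stdBump.le_one

theorem cutoff_eq_zero {x : Plane} (hx : 2 ≤ ‖x‖) : cutoff x = 0 :=
  stdBump.zero_of_le_dist (by simpa [stdBump] using hx)

theorem norm_sub_mulOp_sq_le {R : ℝ} (hR : 0 < R) (g : L2C) :
    ‖g - mulOp (cutoff.dil R hR.ne') g‖ ^ 2 ≤ ∫ x in exterior R, ‖g x‖ ^ 2 := by
  rw [L2C.norm_sq_eq, ← integral_indicator (measurableSet_exterior R)]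
  apply integral_mono_ae (L2C.integrable_sq _) ((L2C.integrable_sq g).indicator (measurableSet_exterior R))
  filter_upwards [Lp.coeFn_sub g (mulOp (cutoff.dil R hR.ne') g), coeFn_mulOp (cutoff.dil R hR.ne') g] with x h1 h2
  rw [h1, Pi.sub_apply, h2]
  change ‖g x - ((cutoff (R⁻¹ • x) : ℝ) : ℂ) * g x‖ ^ 2 ≤ _
  by_cases hx : x ∈ exterior R
  · rw [Set.indicator_of_mem hx]
    have : g x - ((cutoff (R⁻¹ • x) : ℝ) : ℂ) * g x = ((1 - cutoff (R⁻¹ • x) : ℝ) : ℂ) * g x := by push_cast; ring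
    rw [this, norm_mul, Complex.norm_real, Real.norm_of_nonneg (sub_nonneg.2 (cutoff_le_one _))]
    exact pow_le_pow_left₀ (mul_nonneg (sub_nonneg.2 (cutoff_le_one _)) (norm_nonneg _))
      (mul_le_of_le_one_left (norm_nonneg _) (sub_le_self _ (cutoff_nonneg _))) 2
  · rw [Set.indicator_of_notMem hx]
    have hx' : ‖x‖ < R := not_le.1 hx
    have : cutoff (R⁻¹ • x) = 1 := by
      apply cutoff_eq_one
      rw [norm_smul, norm_inv, Real.norm_of_nonneg hR.le, inv_mul_le_iff₀ hR]
      linarith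
    rw [this]; simp

/-- Smallness of the exterior kinetic energy forces smallness of the exterior nonlinear density. -/
theorem exists_exterior_virialDens_le {m η : ℝ} (hη : 0 < η) : ∃ θ > 0, ∃ R₀ > 0, ∀ R ≥ R₀,
    ∀ (v : L2C) (g : Fin 2 → L2C), HasGrad v g → ‖v‖ ≤ m → extKin R g ≤ θ →
      ∫ x in exterior (2 * R), virialDens (v x) ≤ η := by
  obtain ⟨c, hc, C₀, hC₀, hMT⟩ := exists_moser_trudinger
  obtain ⟨B₀, hB₀, hB₀'⟩ := (cutoff.pd 0).exists_bound
  obtain ⟨B₁, hB₁, hB₁'⟩ := (cutoff.pd 1).exists_bound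
  set B := B₀ + B₁ with hB
  have hBj : ∀ j x, |cutoff.pd j x| ≤ B := by
    intro j x
    fin_cases j
    · exact (hB₀' x).trans (by linarith)
    · exact (hB₁' x).trans (by linarith)
  have hB0 : 0 ≤ B := by positivity
  have hp := Real.pi_gt_three
  -- L depends on the mass and η only, before θ is fixed. Here 768 = 96 · 2 · 4, from K ≤ 2L and ‖w‖
  -- ≤ 2m.
  set L := 4 * Real.pi + 768 * Real.pi ^ 2 * C₀ * m ^ 2 / η with hL
  have hL4 : 4 * Real.pi ≤ L := by rw [hL]; linarith [show 0 ≤ 768 * Real.pi ^ 2 * C₀ * m ^ 2 / η by positivity]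
  have hL0 : 0 < L := by linarith
  have hLη : 768 * Real.pi ^ 2 * C₀ * m ^ 2 ≤ L * η := by
    rw [hL, add_mul, div_mul_cancel₀ _ hη.ne']
    linarith [show 0 ≤ 4 * Real.pi * η by positivity]
  set K := L + 4 * Real.pi with hK
  have hK0 : 0 < K := by positivity
  -- In the smallness condition the exterior kinetic energy and the gradient of the cutoff are
  -- allowed c / 4 each.
  refine ⟨c / (8 * K), by positivity, 1 + 16 * B ^ 2 * m ^ 2 * K / c, by positivity, fun R hR v g h hv hg => ?_⟩
  have hR1 : 1 ≤ R := le_trans (by linarith [show 0 ≤ 16 * B ^ 2 * m ^ 2 * K / c by positivity]) hR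
  have hR0 : 0 < R := by linarith
  have hRB : 16 * B ^ 2 * m ^ 2 * K ≤ c * R := by
    have : 16 * B ^ 2 * m ^ 2 * K / c ≤ R := by linarith
    rwa [div_le_iff₀' hc] at this
  -- The function (1 - χ) v has its gradient controlled by data beyond radius R and equals v beyond
  -- radius 2R, whence the radius 2 * R.
  set χ := cutoff.dil R hR0.ne' with hχ
  have hw := h.sub (h.mul_test χ)
  set w := v - mulOp χ v with hwd
  have hm0 : 0 ≤ m := (norm_nonneg _).trans hv
  have hwn : ‖w‖ ≤ 2 * m := by
    have h1 := norm_mulOp_le χ (C := 1) (fun x => cutoff_abs_le _) v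
    have := norm_sub_le v (mulOp χ v)
    linarith
  have hkj : ∀ j, ‖g j - (mulOp χ (g j) + mulOp (χ.pd j) v)‖ ^ 2 ≤
      2 * (∫ x in exterior R, ‖g j x‖ ^ 2) + 2 * (B * m) ^ 2 / R := by
    intro j
    have e1 := norm_sub_mulOp_sq_le hR0 (g j)
    have e2 : ‖mulOp (χ.pd j) v‖ ≤ R⁻¹ * B * m := by
      refine (norm_mulOp_le (C := R⁻¹ * B) _ (fun x => ?_) v).trans (by gcongr)
      rw [hχ, Test.pd_dil, abs_mul, abs_of_pos (inv_pos.2 hR0)]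
      gcongr
      exact hBj j _
    have e3 : ‖mulOp (χ.pd j) v‖ ^ 2 ≤ (B * m) ^ 2 / R := by
      calc ‖mulOp (χ.pd j) v‖ ^ 2 ≤ (R⁻¹ * B * m) ^ 2 := by gcongr
        _ = (B * m) ^ 2 / R ^ 2 := by field_simp
        _ ≤ _ := by gcongr; nlinarith
    have e4 : ‖g j - (mulOp χ (g j) + mulOp (χ.pd j) v)‖ ≤ ‖g j - mulOp χ (g j)‖ + ‖mulOp (χ.pd j) v‖ := by
      rw [← sub_sub]; exact norm_sub_le _ _
    have e5 : ‖g j - (mulOp χ (g j) + mulOp (χ.pd j) v)‖ ^ 2 ≤ 2 * ‖g j - mulOp χ (g j)‖ ^ 2 + 2 * ‖mulOp (χ.pd j) v‖ ^ 2 := by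
      have := pow_le_pow_left₀ (norm_nonneg _) e4 2
      nlinarith [sq_nonneg (‖g j - mulOp χ (g j)‖ - ‖mulOp (χ.pd j) v‖)]
    rw [mul_div_assoc]
    linarith
  have hsmall : K * ∑ j, ‖g j - (mulOp χ (g j) + mulOp (χ.pd j) v)‖ ^ 2 < c := by
    have e1 : ∑ j, ‖g j - (mulOp χ (g j) + mulOp (χ.pd j) v)‖ ^ 2 ≤ 2 * extKin R g + 4 * ((B * m) ^ 2 / R) := by
      rw [Fin.sum_univ_two, extKin, Fin.sum_univ_two]
      have := hkj 0
      have := hkj 1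
      rw [mul_div_assoc] at *
      linarith
    have e2 : K * (2 * extKin R g) ≤ c / 4 := by
      calc K * (2 * extKin R g) ≤ K * (2 * (c / (8 * K))) := by gcongr
        _ = c / 4 := by field_simp; ring
    have e3 : K * (4 * ((B * m) ^ 2 / R)) ≤ c / 4 := by
      rw [show K * (4 * ((B * m) ^ 2 / R)) = (16 * B ^ 2 * m ^ 2 * K) / R / 4 by ring]
      gcongr
      rwa [div_le_iff₀ hR0]
    calc _ ≤ K * (2 * extKin R g + 4 * ((B * m) ^ 2 / R)) := by gcongr
      _ ≤ c / 4 + c / 4 := by rw [mul_add]; linarith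
      _ < c := by linarith
  have hmt := hMT w _ hw K hK0 hsmall
  have hid := hw.integrable_virialDens
  have h1 : ∫ x in exterior (2 * R), virialDens (v x) ≤ ∫ x, virialDens (w x) := by
    have e1 : ∫ x in exterior (2 * R), virialDens (v x) = ∫ x in exterior (2 * R), virialDens (w x) := by
      apply setIntegral_congr_ae (measurableSet_exterior _)
      filter_upwards [Lp.coeFn_sub v (mulOp χ v), coeFn_mulOp χ v] with x e1 e2 hx
      rw [hwd, e1, Pi.sub_apply, e2]
      have : χ x = 0 := by
        apply cutoff_eq_zero
        have hx : 2 * R ≤ ‖x‖ := hx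
        rw [norm_smul, norm_inv, Real.norm_of_nonneg hR0.le, le_inv_mul_iff₀ hR0]
        linarith
      rw [this]; simp
    rw [e1]
    exact setIntegral_le_integral hid (Eventually.of_forall fun x => virialDens_nonneg _)
  refine h1.trans ?_
  rw [← ENNReal.ofReal_le_ofReal_iff hη.le, ofReal_integral_eq_lintegral_ofReal hid
    (Eventually.of_forall fun x => virialDens_nonneg _)]
  calc ∫⁻ x, ENNReal.ofReal (virialDens (w x))
      ≤ ∫⁻ x, ENNReal.ofReal (96 * Real.pi ^ 2 / L ^ 3) * ENNReal.ofReal (Real.exp (K * ‖w x‖ ^ 2) - 1) := by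
        refine lintegral_mono fun x => ?_
        rw [← ENNReal.ofReal_mul (by positivity)]
        exact ENNReal.ofReal_le_ofReal (virialDens_le hL0 _)
    _ ≤ ENNReal.ofReal (96 * Real.pi ^ 2 / L ^ 3) * ENNReal.ofReal (C₀ * K * ‖w‖ ^ 2) := by
        rw [lintegral_const_mul' _ _ ENNReal.ofReal_ne_top]
        gcongr
    _ = ENNReal.ofReal (96 * Real.pi ^ 2 / L ^ 3 * (C₀ * K * ‖w‖ ^ 2)) := (ENNReal.ofReal_mul (by positivity)).symm
    _ ≤ ENNReal.ofReal η := by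
        apply ENNReal.ofReal_le_ofReal
        have hL1 : 1 ≤ L := by linarith
        calc 96 * Real.pi ^ 2 / L ^ 3 * (C₀ * K * ‖w‖ ^ 2) ≤ 96 * Real.pi ^ 2 / L ^ 3 * (C₀ * (2 * L) * (2 * m) ^ 2) := by
              gcongr; linarith
          _ = (768 * Real.pi ^ 2 * C₀ * m ^ 2) / L ^ 2 := by field_simp; ring
          _ ≤ (L * η) / L ^ 2 := by gcongr
          _ = η / L := by field_simp
          _ ≤ η := div_le_self hη.le hL1

/-! ### The dilated quadratic weight and the contradiction. -/

/-- The scalar multiple of a test function. -/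
def Test.smul (c : ℝ) (φ : Test) : Test := ⟨fun x => c * φ x, contDiff_const.mul φ.smooth, φ.cpt.mul_left⟩

theorem Test.pd_smul (c : ℝ) (φ : Test) (j : Fin 2) : (φ.smul c).pd j = (φ.pd j).smul c := by
  ext x
  change fderiv ℝ (fun x => c * φ x) x _ = c * fderiv ℝ φ x _
  rw [fderiv_const_mul (φ.differentiable x)]; rfl

theorem Test.dil_pd (φ : Test) (c : ℝ) (hc : c ≠ 0) (j : Fin 2) : (φ.dil c hc).pd j = ((φ.pd j).dil c hc).smul c⁻¹ := by
  ext x; exact Test.pd_dil φ c hc j x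

theorem Test.dil_pd_pd (φ : Test) (c : ℝ) (hc : c ≠ 0) (j k : Fin 2) (x : Plane) :
    ((φ.dil c hc).pd j).pd k x = (c ^ 2)⁻¹ * ((φ.pd j).pd k) (c⁻¹ • x) := by
  rw [Test.dil_pd, Test.pd_smul, Test.dil_pd]
  change c⁻¹ * (c⁻¹ * _) = _
  rw [← mul_assoc, ← mul_inv, ← sq]; rfl

theorem Test.dil_lap (φ : Test) (c : ℝ) (hc : c ≠ 0) : (φ.dil c hc).lap = (φ.lap.dil c hc).smul (c ^ 2)⁻¹ := by
  ext x
  change ((φ.dil c hc).pd 0).pd 0 x + ((φ.dil c hc).pd 1).pd 1 x = (c ^ 2)⁻¹ * (_ + _)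
  rw [Test.dil_pd_pd, Test.dil_pd_pd, mul_add]

/-- The truncated quadratic weight. -/
def quadWeight : Test :=
  ⟨fun x => ‖x‖ ^ 2 * cutoff x, (contDiff_norm_sq ℝ).mul cutoff.smooth, cutoff.cpt.mul_left⟩

theorem quadWeight_pd_pd (j k : Fin 2) {x : Plane} (hx : ‖x‖ < 1) :
    (quadWeight.pd j).pd k x = if j = k then 2 else 0 := by
  have hU : ∀ {y : Plane}, ‖y‖ < 1 → ∀ᶠ z in 𝓝 y, ‖z‖ < 1 := fun hy => continuous_norm.continuousAt.eventually_lt_const hy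
  have h1 : ∀ y : Plane, ‖y‖ < 1 → quadWeight.pd j y = 2 * y j := by
    intro y hy
    have e1 : (quadWeight : Plane → ℝ) =ᶠ[𝓝 y] fun z => ‖z‖ ^ 2 := by
      filter_upwards [hU hy] with z hz
      change ‖z‖ ^ 2 * cutoff z = _
      rw [cutoff_eq_one hz.le, mul_one]
    rw [Test.pd_apply, e1.fderiv_eq, (hasStrictFDerivAt_norm_sq y).hasFDerivAt.fderiv]
    simp [innerSL_apply_apply, EuclideanSpace.inner_single_right]
  have e2 : (quadWeight.pd j : Plane → ℝ) =ᶠ[𝓝 x] fun z => ((2 : ℝ) • EuclideanSpace.proj (𝕜 := ℝ) j : Plane →L[ℝ] ℝ) z := by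
    filter_upwards [hU hx] with z hz
    rw [h1 z hz]; simp
  rw [Test.pd_apply, e2.fderiv_eq, ContinuousLinearMap.fderiv]
  by_cases hjk : j = k
  · simp [hjk]
  · simp [hjk]

/-- A finite family of test functions is uniformly bounded. -/
theorem Test.exists_uniform_bound {ι : Type*} [Fintype ι] (φ : ι → Test) : ∃ C, 0 ≤ C ∧ ∀ i x, |φ i x| ≤ C := by
  choose C hC0 hC using fun i => (φ i).exists_bound
  exact ⟨∑ i, C i, Finset.sum_nonneg fun i _ => hC0 i, fun i x => (hC i x).trans
    (Finset.single_le_sum (fun i _ => hC0 i) (Finset.mem_univ i))⟩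

theorem norm_inv_smul_lt_one {R : ℝ} (hR : 0 < R) {x : Plane} (hx : x ∉ exterior R) : ‖R⁻¹ • x‖ < 1 := by
  have hx' : ‖x‖ < R := not_le.1 hx
  rw [norm_smul, norm_inv, Real.norm_of_nonneg hR.le, inv_mul_lt_iff₀ hR]
  linarith

/-- Lower bound for the virial rate of the dilated quadratic weight. -/
theorem exists_le_virialRate : ∃ C, 0 ≤ C ∧ ∀ (R : ℝ) (hR : 0 < R) (v : L2C) (g : Fin 2 → L2C), HasGrad v g →
    4 * (∑ j, ‖g j‖ ^ 2 + potInt v) - C * extKin R g - C / R * (‖v‖ * ∑ j, ‖g j‖) -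
      C * ∫ x in exterior R, virialDens (v x) ≤ R ^ 2 * virialRate (quadWeight.dil R hR.ne') v g (nlOp v) := by
  obtain ⟨C₁, hC₁, hC₁'⟩ := Test.exists_uniform_bound fun i : Fin 2 × Fin 2 => (quadWeight.pd i.1).pd i.2
  obtain ⟨C₂, hC₂, hC₂'⟩ := Test.exists_uniform_bound fun k : Fin 2 => quadWeight.lap.pd k
  have hlap : ∀ x, |quadWeight.lap x| ≤ 2 * C₁ := fun x =>
    (abs_add_le _ _).trans (by have := hC₁' (0, 0) x; have := hC₁' (1, 1) x; simp only at *; linarith)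
  refine ⟨8 * (C₁ + 2) + C₂, by positivity, fun R hR v g h => ?_⟩
  set φ := quadWeight.dil R hR.ne' with hφ
  have hR2 : R ^ 2 ≠ 0 := by positivity
  have hA := measurableSet_exterior R
  -- R² undoes the dilation of second derivatives. Inside the disc the Hessian is twice the
  -- identity; outside it is merely bounded, and the main term is conceded there at the cost of
  -- exterior energy.
  have h1 : ∀ j k, (if j = k then 2 * ‖g j‖ ^ 2 else 0) - (C₁ + 2) * ((∫ x in exterior R, ‖g j x‖ ^ 2) +
      ∫ x in exterior R, ‖g k x‖ ^ 2) ≤ R ^ 2 * (inner ℂ (mulOp ((φ.pd j).pd k) (g j)) (g k)).re := by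
    intro j k
    have hsq := fun j => L2C.integrable_sq (g j)
    have e1 : (if j = k then 2 * ‖g j‖ ^ 2 else 0) = ∫ x, (if j = k then 2 else 0) * ‖g j x‖ ^ 2 := by
      rw [integral_const_mul, ← L2C.norm_sq_eq]; split_ifs <;> simp
    rw [re_inner_mulOp, ← integral_const_mul, e1, ← integral_add (hsq j).integrableOn (hsq k).integrableOn, ← integral_const_mul]
    have e2 : ∀ x, R ^ 2 * ((φ.pd j).pd k x * inner ℝ (g j x) (g k x)) =
        (quadWeight.pd j).pd k (R⁻¹ • x) * inner ℝ (g j x) (g k x) := by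
      intro x
      rw [hφ, Test.dil_pd_pd]; field_simp
    refine sub_setIntegral_le hA ((integrable_test_mul (L2C.integrable_inner_real _ _) _).const_mul _)
      ((hsq j).const_mul _) (((hsq j).add (hsq k)).const_mul _) (Eventually.of_forall fun x hx => ?_)
      (Eventually.of_forall fun x _ => ?_)
    · rw [e2, quadWeight_pd_pd j k (norm_inv_smul_lt_one hR hx)]
      by_cases hjk : j = k
      · subst hjk; simp
      · simp [hjk]
    · rw [e2]
      have b1 : |(quadWeight.pd j).pd k (R⁻¹ • x) * inner ℝ (g j x) (g k x)| ≤ C₁ * (‖g j x‖ ^ 2 + ‖g k x‖ ^ 2) := by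
        rw [abs_mul]
        have := abs_real_inner_le_norm (g j x) (g k x)
        have : |(inner ℝ (g j x) (g k x) : ℝ)| ≤ ‖g j x‖ ^ 2 + ‖g k x‖ ^ 2 := by
          nlinarith [sq_nonneg (‖g j x‖ - ‖g k x‖), sq_nonneg (‖g j x‖ + ‖g k x‖)]
        gcongr
        exact hC₁' (j, k) _
      have b2 : (if j = k then (2 : ℝ) else 0) * ‖g j x‖ ^ 2 ≤ 2 * (‖g j x‖ ^ 2 + ‖g k x‖ ^ 2) := by
        split_ifs
        · nlinarith [sq_nonneg ‖g k x‖]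
        · rw [zero_mul]; positivity
      have := neg_abs_le ((quadWeight.pd j).pd k (R⁻¹ • x) * inner ℝ (g j x) (g k x))
      nlinarith
  -- Third derivatives of the dilated weight scale like R⁻³, so a factor 1 / R remains.
  have h2 : ∀ k, -(C₂ / R * (‖v‖ * ‖g k‖)) ≤ R ^ 2 * (inner ℂ (mulOp (φ.lap.pd k) v) (g k)).re := by
    intro k
    have e1 : ‖mulOp (φ.lap.pd k) v‖ ≤ (R ^ 2)⁻¹ * R⁻¹ * C₂ * ‖v‖ := by
      refine norm_mulOp_le _ (fun x => ?_) v
      rw [hφ, Test.dil_lap, Test.pd_smul, Test.dil_pd]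
      change |(R ^ 2)⁻¹ * (R⁻¹ * _)| ≤ _
      rw [← mul_assoc, abs_mul, abs_of_pos (by positivity)]
      gcongr
      exact hC₂' k _
    have e2 : |(inner ℂ (mulOp (φ.lap.pd k) v) (g k)).re| ≤ (R ^ 2)⁻¹ * R⁻¹ * C₂ * ‖v‖ * ‖g k‖ :=
      (Complex.abs_re_le_norm _).trans ((norm_inner_le_norm _ _).trans (by gcongr))
    have e3 := (abs_le.1 e2).1
    calc -(C₂ / R * (‖v‖ * ‖g k‖)) = R ^ 2 * -((R ^ 2)⁻¹ * R⁻¹ * C₂ * ‖v‖ * ‖g k‖) := by field_simp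
      _ ≤ _ := by gcongr
  -- Inside the disc the Laplacian of the weight is 4 and the density dominates the potential.
  have h3 : 4 * potInt v - (2 * C₁ + 4) * ∫ x in exterior R, virialDens (v x) ≤
      R ^ 2 * (2 * ∑ j, (inner ℂ (mulOp (φ.pd j) (g j)) (nlOp v)).re + (inner ℂ (mulOp φ.lap v) (nlOp v)).re) := by
    rw [h.virial_nonlin, ← integral_const_mul, potInt, ← integral_const_mul, ← integral_const_mul]
    have hid := h.integrable_virialDens
    have e2 : ∀ x, R ^ 2 * (φ.lap x * virialDens (v x)) = quadWeight.lap (R⁻¹ • x) * virialDens (v x) := by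
      intro x
      rw [hφ, Test.dil_lap]
      change R ^ 2 * (((R ^ 2)⁻¹ * quadWeight.lap (R⁻¹ • x)) * _) = _
      field_simp
    refine sub_setIntegral_le hA ((integrable_test_mul hid _).const_mul _)
      (h.integrable_potential.const_mul _) (hid.const_mul _) (Eventually.of_forall fun x hx => ?_)
      (Eventually.of_forall fun x _ => ?_)
    · have : quadWeight.lap (R⁻¹ • x) = 4 := by
        change (quadWeight.pd 0).pd 0 (R⁻¹ • x) + (quadWeight.pd 1).pd 1 (R⁻¹ • x) = 4
        rw [quadWeight_pd_pd _ _ (norm_inv_smul_lt_one hR hx), quadWeight_pd_pd _ _ (norm_inv_smul_lt_one hR hx)]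
        norm_num
      rw [e2, this]
      linarith [potential_le_virialDens (v x)]
    · rw [e2]
      have b1 := (abs_le.1 (hlap (R⁻¹ • x))).1
      have b2 := virialDens_nonneg (v x)
      have b3 := potential_le_virialDens (v x)
      nlinarith
  have hd0 : 0 ≤ ∫ x in exterior R, virialDens (v x) := integral_nonneg fun x => virialDens_nonneg _
  have hk0 := extKin_nonneg R g
  have h4 : 0 ≤ 1 / R * (‖v‖ * ∑ j, ‖g j‖) := by positivity
  rw [virialRate]
  simp only [extKin, Fin.sum_univ_two] at *
  have a1 := h1 0 0
  have a2 := h1 0 1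
  have a3 := h1 1 0
  have a4 := h1 1 1
  have a5 := h2 0
  have a6 := h2 1
  simp only [if_true, zero_ne_one, one_ne_zero, if_false] at a1 a2 a3 a4
  have a7 := mul_nonneg hC₂ hk0
  have a8 := mul_nonneg hC₂ hd0
  have a9 := mul_nonneg hC₁ hd0
  have a10 := mul_nonneg hC₁ h4
  simp only [div_eq_mul_inv] at *
  linarith

namespace IsFlow

variable {U : ℝ → L2C} {G : ℝ → Fin 2 → L2C}

/-- A solution of positive energy cannot keep its kinetic energy in a bounded region. -/
theorem not_extKin_small (h : IsFlow U G) (hE : 0 < ∑ j, ‖G 0 j‖ ^ 2 + potInt (U 0))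
    (hc : ∀ ε > 0, ∃ R T : ℝ, ∀ t ≥ T, extKin R (G t) < ε) : False := by
  set E := ∑ j, ‖G 0 j‖ ^ 2 + potInt (U 0) with hEd
  set m := ‖U 0‖ with hm
  have henergy : ∀ t, ∑ j, ‖G t j‖ ^ 2 + potInt (U t) = E := fun t => h.energy_eq 0 t
  clear_value E
  have hGb : ∀ t j, ‖G t j‖ ≤ 1 + E := by
    intro t j
    have h1 : ‖G t j‖ ^ 2 ≤ ∑ j, ‖G t j‖ ^ 2 :=
      Finset.single_le_sum (f := fun j => ‖G t j‖ ^ 2) (fun j _ => by positivity) (Finset.mem_univ j)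
    have h2 : 0 ≤ potInt (U t) := integral_nonneg fun x => potential_nonneg _
    have := henergy t
    nlinarith [norm_nonneg (G t j)]
  obtain ⟨C, hC0, hC⟩ := exists_le_virialRate
  obtain ⟨θ, hθ, R₀, hR₀, hext⟩ := exists_exterior_virialDens_le (m := m) (η := E / (C + 1))
    (div_pos hE (by linarith))
  obtain ⟨R₁, T, hT⟩ := hc (min θ (E / (C + 1))) (lt_min hθ (div_pos hE (by linarith)))
  -- The last entry keeps the 1 / R error below E. The disc has radius 2 * S because the density is
  -- controlled only beyond twice S.
  set S := max R₀ (max R₁ (2 * C * m * (1 + E) / E)) with hS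
  have hS0 : 0 < S := hR₀.trans_le (le_max_left _ _)
  have hS1 : R₁ ≤ S := (le_max_left _ _).trans (le_max_right _ _)
  have hS2 : 2 * C * m * (1 + E) / E ≤ S := (le_max_right _ _).trans (le_max_right _ _)
  set R := 2 * S with hR
  have hR0 : 0 < R := by positivity
  set φ := quadWeight.dil R hR0.ne' with hφ
  -- Each of the three errors is at most E, which leaves 4E - 3E.
  have hrate : ∀ t ≥ T, E / R ^ 2 ≤ virialRate φ (U t) (G t) (nlOp (U t)) := by
    intro t ht
    have hk := hT t ht
    have hkS : extKin S (G t) ≤ min θ (E / (C + 1)) := (extKin_anti hS1 _).trans hk.le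
    have hkR : extKin R (G t) ≤ E / (C + 1) := (extKin_anti (by linarith) _).trans (hkS.trans (min_le_right _ _))
    have hd := hext S (le_max_left _ _) (U t) (G t) (h.grad t) (h.norm_eq t).le (hkS.trans (min_le_left _ _))
    have key := hC R hR0 (U t) (G t) (h.grad t)
    rw [henergy t, h.norm_eq t] at key
    have hCE : C * (E / (C + 1)) ≤ E := by
      rw [mul_div_assoc', div_le_iff₀ (by positivity)]; nlinarith
    have b1 : C * extKin R (G t) ≤ E := (mul_le_mul_of_nonneg_left hkR hC0).trans hCE
    have b2 : C * ∫ x in exterior R, virialDens (U t x) ≤ E := (mul_le_mul_of_nonneg_left hd hC0).trans hCE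
    have b3 : C / R * (‖U 0‖ * ∑ j, ‖G t j‖) ≤ E := by
      rw [Fin.sum_univ_two, div_mul_eq_mul_div, div_le_iff₀ hR0]
      have c1 : 2 * C * m * (1 + E) ≤ S * E := by rwa [div_le_iff₀ hE] at hS2
      have c2 : C * (‖U 0‖ * (‖G t 0‖ + ‖G t 1‖)) ≤ C * (m * ((1 + E) + (1 + E))) := by
        gcongr
        · exact hGb t 0
        · exact hGb t 1
      nlinarith
    rw [div_le_iff₀ (by positivity)]
    linarith
  have hbound : ∃ B, ∀ t, |virial φ (U t) (G t)| ≤ B := by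
    refine ⟨∑ j, m * (‖mulOp (φ.pd j)‖ * (1 + E)), fun t => (Finset.abs_sum_le_sum_abs _ _).trans
      (Finset.sum_le_sum fun j _ => (Complex.abs_im_le_norm _).trans ((norm_inner_le_norm _ _).trans ?_))⟩
    rw [h.norm_eq t]
    gcongr
    exact ((mulOp (φ.pd j)).le_opNorm _).trans (by gcongr; exact hGb t j)
  obtain ⟨B, hB⟩ := hbound
  have hgrow : ∀ t ≥ T, (t - T) * (E / R ^ 2) ≤ 2 * B := by
    intro t ht
    have e1 := h.virial_sub_eq φ T t
    have e2 : ∫ s in T..t, E / R ^ 2 ≤ ∫ s in T..t, virialRate φ (U s) (G s) (nlOp (U s)) :=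
      intervalIntegral.integral_mono_on ht (continuous_const.intervalIntegrable _ _)
        ((continuous_virialRate h.contU h.contG h.continuous_nlOp).intervalIntegrable _ _) fun s hs => hrate s hs.1
    rw [intervalIntegral.integral_const, smul_eq_mul, ← e1] at e2
    have := (abs_le.1 (hB t)).2
    have := (abs_le.1 (hB T)).1
    linarith
  have hB0 : 0 ≤ B := (abs_nonneg _).trans (hB 0)
  have hq : 0 < E / R ^ 2 := by positivity
  have := hgrow (T + (2 * B + 1) / (E / R ^ 2)) (by
    have : 0 ≤ (2 * B + 1) / (E / R ^ 2) := by positivity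
    linarith)
  rw [add_sub_cancel_left, div_mul_cancel₀ _ hq.ne'] at this
  linarith

end IsFlow

/-! ### From the given solution to a curve in L², and the conclusion. -/

namespace MemH1

variable {v w : Plane → ℂ}

theorem hasWeakGradient (h : MemH1 v) : HasWeakGradient v (weakGradient v) := by
  have hex : ∃ g, HasWeakGradient v g := ⟨_, h.2.choose_spec.1⟩
  rw [weakGradient, dif_pos hex]
  exact hex.choose_spec

theorem memLp_weakGradient (h : MemH1 v) : MemLp (weakGradient v) 2 volume := by
  obtain ⟨g, hg, hg2⟩ := h.2
  exact (memLp_congr_ae (h.hasWeakGradient.ae_eq hg)).2 hg2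

theorem memLp_weakGradient_apply (h : MemH1 v) (j : Fin 2) : MemLp (fun x => weakGradient v x j) 2 volume :=
  (EuclideanSpace.proj (𝕜 := ℂ) j).comp_memLp' h.memLp_weakGradient

/-- An `H¹` function as an element of `L²`. -/
def vec (h : MemH1 v) : L2C := h.1.toLp v

/-- The components of the weak gradient of an `H¹` function as elements of `L²`. -/
def grad (h : MemH1 v) (j : Fin 2) : L2C := (h.memLp_weakGradient_apply j).toLp _

theorem coeFn_vec (h : MemH1 v) : h.vec =ᵐ[volume] v := h.1.coeFn_toLp

theorem coeFn_grad (h : MemH1 v) (j : Fin 2) : h.grad j =ᵐ[volume] fun x => weakGradient v x j :=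
  (h.memLp_weakGradient_apply j).coeFn_toLp

theorem inner_test_vec (h : MemH1 v) (φ : Test) : inner ℂ φ.toL2 h.vec = ∫ x, v x * (φ x : ℂ) := by
  rw [Test.inner_toL2]
  apply integral_congr_ae
  filter_upwards [h.coeFn_vec] with x hx
  rw [hx]

theorem hasGrad (h : MemH1 v) : HasGrad h.vec h.grad := by
  intro φ j
  rw [h.inner_test_vec, Test.inner_toL2]
  refine (h.hasWeakGradient.integral_eq φ φ.isTest j).trans ?_
  congr 1
  apply integral_congr_ae
  filter_upwards [h.coeFn_grad j] with x hx
  rw [hx]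

theorem norm_vec_sub (h : MemH1 v) (k : MemH1 w) : ‖h.vec - k.vec‖ = (eLpNorm (v - w) 2 volume).toReal := by
  rw [vec, vec, ← MemLp.toLp_sub, Lp.norm_toLp]

theorem norm_grad_sub_le (h : MemH1 v) (k : MemH1 w) (j : Fin 2) :
    ‖h.grad j - k.grad j‖ ≤ (eLpNorm (weakGradient v - weakGradient w) 2 volume).toReal := by
  rw [grad, grad, ← MemLp.toLp_sub, Lp.norm_toLp]
  refine ENNReal.toReal_mono (h.memLp_weakGradient.sub k.memLp_weakGradient).2.ne (eLpNorm_mono fun x => ?_)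
  exact PiLp.norm_apply_le (weakGradient v x - weakGradient w x) j

theorem extKin_grad (h : MemH1 v) (R : ℝ) : extKin R h.grad = ∫ x in exterior R, ‖weakGradient v x‖ ^ 2 := by
  rw [extKin, ← integral_finsetSum _ fun j _ => (L2C.integrable_sq (h.grad j)).integrableOn]
  apply setIntegral_congr_ae (measurableSet_exterior R)
  filter_upwards [h.coeFn_grad 0, h.coeFn_grad 1] with x h0 h1 _
  rw [EuclideanSpace.norm_sq_eq, Fin.sum_univ_two, Fin.sum_univ_two, h0, h1]

theorem energy_eq (h : MemH1 v) : ∑ j, ‖h.grad j‖ ^ 2 + potInt h.vec = hamiltonian v := by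
  simp only [L2C.norm_sq_eq]
  rw [potInt, hamiltonian, ← integral_finsetSum _ fun j _ => (L2C.integrable_sq (h.grad j)),
    ← integral_add (integrable_finsetSum _ fun j _ => L2C.integrable_sq (h.grad j)) h.hasGrad.integrable_potential]
  apply integral_congr_ae
  filter_upwards [h.coeFn_grad 0, h.coeFn_grad 1, h.coeFn_vec] with x h0 h1 h2
  rw [EuclideanSpace.norm_sq_eq, Fin.sum_univ_two, Fin.sum_univ_two, h0, h1, h2]

/-- `weakGradient` chooses a representative, possibly a different one for functions equal almost
everywhere; uniqueness of weak gradients removes the choice. It is needed since the initial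
condition holds only almost everywhere. -/
theorem hamiltonian_congr (h : MemH1 v) (k : MemH1 w) (hvw : v =ᵐ[volume] w) : hamiltonian v = hamiltonian w := by
  have hw : HasWeakGradient w (weakGradient v) := by
    refine ⟨k.hasWeakGradient.locallyIntegrable, h.hasWeakGradient.locallyIntegrable_grad, fun φ hφ j => ?_⟩
    rw [← h.hasWeakGradient.integral_eq φ hφ j]
    apply integral_congr_ae
    filter_upwards [hvw] with x hx
    rw [hx]
  apply integral_congr_ae
  filter_upwards [hvw, hw.ae_eq k.hasWeakGradient] with x h1 h2
  rw [h1, h2]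

end MemH1

theorem IsNLSSolution.isFlow {u₀ : Plane → ℂ} {u : ℝ → Plane → ℂ} (hu : IsNLSSolution u₀ u) :
    IsFlow (fun t => (hu.memH1 t).vec) (fun t => (hu.memH1 t).grad) where
  grad t := (hu.memH1 t).hasGrad
  contU := by
    rw [continuous_iff_continuousAt]
    intro t
    rw [ContinuousAt, tendsto_iff_norm_sub_tendsto_zero]
    simp_rw [MemH1.norm_vec_sub]
    have h1 := tendsto_of_tendsto_of_tendsto_of_le_of_le tendsto_const_nhds (hu.continuous_H1 t)
      (fun _ => zero_le) (fun s => le_self_add (a := eLpNorm (u s - u t) 2 volume))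
    exact (ENNReal.tendsto_toReal ENNReal.zero_ne_top).comp h1
  contG j := by
    rw [continuous_iff_continuousAt]
    intro t
    rw [ContinuousAt, tendsto_iff_norm_sub_tendsto_zero]
    have h1 := tendsto_of_tendsto_of_tendsto_of_le_of_le tendsto_const_nhds (hu.continuous_H1 t)
      (fun _ => zero_le) (fun s => le_add_self (a := eLpNorm (weakGradient (u s) - weakGradient (u t)) 2 volume))
    exact squeeze_zero (fun _ => norm_nonneg _) (fun s => (hu.memH1 s).norm_grad_sub_le (hu.memH1 t) j)
      ((ENNReal.tendsto_toReal ENNReal.zero_ne_top).comp h1)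
  eq φ t := by
    have h1 : ∫ x, u₀ x * (φ x : ℂ) = inner ℂ φ.toL2 (hu.memH1 0).vec := by
      rw [MemH1.inner_test_vec]
      apply integral_congr_ae
      filter_upwards [hu.initial] with x hx
      rw [hx]
    rw [← h1, MemH1.inner_test_vec, hu.equation φ φ.isTest t]
    congr 2
    refine intervalIntegral.integral_congr fun s _ => ?_
    rw [Test.inner_toL2, Test.inner_toL2, ← integral_sub (integrable_mul_test _ _) (integrable_mul_test _ _)]
    apply integral_congr_ae
    filter_upwards [(hu.memH1 s).coeFn_vec, (hu.memH1 s).hasGrad.coeFn_nlOp] with x h2 h3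
    rw [h3, h2, Test.laplacian_eq]
  -- The L⁴ norm is at most 1 plus its fourth power, and the time interval has finite length.
  l4 T j := by
    refine lt_of_le_of_lt (lintegral_mono (g := fun t => 1 + (eLpNorm (u t) 4 volume +
      eLpNorm (weakGradient (u t)) 4 volume) ^ 4) fun t => ?_) ?_
    · have h1 : eLpNorm ((hu.memH1 t).grad j) 4 volume ≤ eLpNorm (u t) 4 volume + eLpNorm (weakGradient (u t)) 4 volume := by
        refine le_add_left ?_
        rw [eLpNorm_congr_ae ((hu.memH1 t).coeFn_grad j)]
        exact eLpNorm_mono fun x => PiLp.norm_apply_le (weakGradient (u t) x) j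
      refine h1.trans ?_
      rcases le_total (eLpNorm (u t) 4 volume + eLpNorm (weakGradient (u t)) 4 volume) 1 with h2 | h2
      · exact le_add_right h2
      · exact le_add_left (le_self_pow₀ h2 (by norm_num))
    · rw [lintegral_add_left measurable_const]
      exact ENNReal.add_lt_top.2 ⟨by simp, hu.locL4_W14 T⟩

end

theorem mainTheorem4 (u₀ : Plane → ℂ) (hu₀ : MemH1 u₀) (hrad : IsRadial u₀)
    (u : ℝ → Plane → ℂ) (hu : IsNLSSolution u₀ u) (hH : hamiltonian u₀ = 1) :
    ∃ ε₀ : ℝ, 0 < ε₀ ∧ ∃ t R : ℕ → ℝ,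
      Tendsto t atTop atTop ∧ Tendsto R atTop atTop ∧
      ∀ n : ℕ, ε₀ ≤ ∫ x in {x : Plane | R n ≤ ‖x‖}, ‖weakGradient (u (t n)) x‖ ^ 2 := by
  have hflow := hu.isFlow
  have hE : 0 < ∑ j, ‖(hu.memH1 0).grad j‖ ^ 2 + potInt (hu.memH1 0).vec := by
    rw [(hu.memH1 0).energy_eq, (hu.memH1 0).hamiltonian_congr hu₀ hu.initial, hH]
    exact one_pos
  have hnot : ¬ ∀ ε > 0, ∃ R T : ℝ, ∀ t ≥ T, extKin R (hu.memH1 t).grad < ε := hflow.not_extKin_small hE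
  push Not at hnot
  obtain ⟨ε, hε, h⟩ := hnot
  -- The lower bound is available for every radius and beyond every time, so both are taken equal to
  -- n.
  choose t htn ht using fun n : ℕ => h n n
  refine ⟨ε, hε, t, fun n => n, tendsto_atTop_mono htn tendsto_natCast_atTop_atTop, tendsto_natCast_atTop_atTop,
    fun n => ?_⟩
  have h1 := ht n
  rwa [(hu.memH1 (t n)).extKin_grad] at h1
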